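/- Let $X,Y$ be separable real Hilbert spaces, $T>0$, and let the following standing assumptions hold. (1) $U(t,s)\in\mathcal L(X)$, $0\le s\le t\le T$, is a strongly continuous evolution operator: $(s,t)\mapsto U(t,s)x$ is continuous for every $x\in X$, $U(t,t)=I$, and $U(t,r)U(r,s)=U(t,s)$ for $s\le r\le t$. (2) $B(t)\in\mathcal L(Y;X)$, $t\in[0,T]$, is bounded in norm and $t\mapsto B(t)y$ is measurable for every $y\in Y$. (3) $f:[0,T]\to X$ is bounded and measurable. (4) For all $0\le s<t\le T$ the operator $Q(t,s)=\int_s^t U(t,r)B(r)B(r)^*U(t,r)^*\,dr$ has finite trace. Put $$m^x(t,s)=U(t,s)x+\int_s^tU(t,r)f(r)\,dr,\qquad P_{s,t}\varphi(x)=\int_X\varphi(y+m^x(t,s))\,\mathcal N_{0,Q(t,s)}(dy),$$ where $\mathcal N_{0,Q}$ is the Gaussian measure on $X$ with mean $0$ and covariance $Q$. Let $(E,\|\cdot\|_E)$ be a normed space continuously embedded in $X$. Denote by $D_E^k$ the $k$-th Fréchet differential along $E$, i.e. with increments $h\in E$ and remainders $o(\|h\|_E)$, taking values in the bounded $k$-linear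 forms $\mathcal L^k(E)$. For $k\in\mathbb N\cup\{0\}$, $C_E^k(X)$ is the space of bounded continuous $\varphi:X\to\mathbb R$ that are $k$ times $E$-Fréchet differentiable at every point, with $D_E^j\varphi:X\to\mathcal L^j(E)$ continuous and bounded for $j\le k$, normed by $\|\varphi\|_\infty+\sum_{j=1}^k\sup_x\|D^j_E\varphi(x)\|$. For $\sigma\in(0,1)$, $C_E^{k+\sigma}(X)$ is the space of $\varphi\in C^k_E(X)$ with $$[D_E^k\varphi]_{C^\sigma_E}=\sup_{x\in X,\,0\ne h\in E}\frac{\|D_E^k\varphi(x+h)-D_E^k\varphi(x)\|}{\|h\|_E^{\sigma}}<\infty,$$ normed by $\|\varphi\|_{C^k_E(X)}+[D^k_E\varphi]_{C^\sigma_E}$. Fix $0\le s<t\le T$ and assume (16) $U(t,s)(E)\subseteq\mathcal H_{t,s}:=Q(t,s)^{1/2}(X)$ and $U(t,s)|_E\in\mathcal L(E,\mathcal H_{t,s})$, where $\|h\|_{\mathcal H_{t,s}}=\|Q(t,s)^{-1/2}h\|_X$ and $Q(t,s)^{-1/2}$ is the pseudo-inverse of $Q(t,s)^{1/2}$; (17)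 $U(t,s)(E)\subseteq E$, $U(t,s)|_E\in\mathcal L(E)$ and $\|U(t,s)|_E\|_{\mathcal L(E)}\le M$ for some $M>0$. Put $\Lambda(t,s)=Q(t,s)^{-1/2}U(t,s)$, which is bounded from $E$ to $X$. For $h\in\mathcal H_{t,s}$ let $\widehat h$ be the $L^2(X,\mathcal N_{0,Q(t,s)})$-limit of $\langle x_n,\cdot\rangle$ for any sequence $(x_n)$ in $X$ with $Q(t,s)^{1/2}x_n\to Q(t,s)^{-1/2}h$; equivalently, $\widehat h(y)=\sum_{\lambda_k\ne0}\lambda_k^{-1}\langle y,e_k\rangle\langle h,e_k\rangle$ for an orthonormal basis $(e_k)$ with $Q(t,s)e_k=\lambda_ke_k$. Set $$I_n(t,s)(y)(h_1,\dots,h_n)=\sum_{j=0}^{\lfloor n/2\rfloor}(-1)^j\sum\ \prod_{i=1}^j\langle\Lambda(t,s)h_{a_i},\Lambda(t,s)h_{b_i}\rangle\prod_{m\notin\{a_1,b_1,\dots,a_j,b_j\}}\widehat{U(t,s)h_m}(y),$$ where the inner sum runs over all pairwise distinct indices $a_1,b_1,\dots,a_j,b_j\in\{1,\dots,n\}$ with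 $a_i<b_i$ and $a_1<\dots<a_j$ (so $I_0=1$, $I_1=\widehat{U(t,s)h_1}$). Then: (i) For all $k,n\in\mathbb N\cup\{0\}$ with $k+n\ge1$ and all $\varphi\in C_E^k(X)$, one has $P_{s,t}\varphi\in C_E^{k+n}(X)$, and for all $x\in X$, $h_1,\dots,h_{k+n}\in E$, $$D_E^{k+n}(P_{s,t}\varphi)(x)(h_1,\dots,h_{k+n})=\int_XD_E^k\varphi(m^x(t,s)+y)(U(t,s)h_1,\dots,U(t,s)h_k)\,I_n(t,s)(y)(h_{k+1},\dots,h_{k+n})\,\mathcal N_{0,Q(t,s)}(dy),$$ the integrand being integrable. (ii) For all $\alpha_2\ge\alpha_1\ge0$ there is a constant $C>0$, depending only on $\alpha_1,\alpha_2$ and $M$, such that for every $\varphi\in C_E^{\alpha_1}(X)$ one has $P_{s,t}\varphi\in C_E^{\alpha_2}(X)$ and $$\|P_{s,t}\varphi\|_{C_E^{\alpha_2}(X)}\le C\bigl(\|\Lambda(t,s)\|_{\mathcal L(E;X)}^{\alpha_2-\alpha_1}+1\bigr)\|\varphi\|_{C_E^{\alpha_1}(X)}.$$ -/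

import Mathlib

open MeasureTheory Filter Topology
open scoped ENNReal RealInnerProductSpace

universe u v w

namespace OUEvolution

noncomputable section

/-! ### Differentiability and Hölder spaces along a continuously embedded normed space

The normed space `E ⊆ X` is given by its (injective, continuous, linear) inclusion
`ι : E →L[ℝ] X`. -/

section Directional

variable {X : Type u} [NormedAddCommGroup X] [NormedSpace ℝ X]
variable {E : Type v} [NormedAddCommGroup E] [NormedSpace ℝ E]
variable {G : Type*} [NormedAddCommGroup G] [NormedSpace ℝ G]

/-- `F` is `E`-Fréchet differentiable at `x`: for some `T ∈ L(E, G)`,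
`F (x + h) - F x - T h = o(‖h‖_E)` as `‖h‖_E → 0`, `h ∈ E`. -/
def EDifferentiableAt (ι : E →L[ℝ] X) (F : X → G) (x : X) : Prop :=
  DifferentiableAt ℝ (fun h : E => F (x + ι h)) 0

/-- The `E`-Fréchet differential of `F` at `x`. -/
def eDeriv (ι : E →L[ℝ] X) (F : X → G) (x : X) : E →L[ℝ] G :=
  fderiv ℝ (fun h : E => F (x + ι h)) 0

/-- The differential `D_E^k f : X → L^k(E)` of order `k`, with
`D_E^0 f = f` and `D_E^(k+1) f x (h₀, …, h_k) = (T h₀) (h₁, …, h_k)`, where `T` is the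
`E`-Fréchet differential of `D_E^k f` at `x`. -/
def eDerivIter (ι : E →L[ℝ] X) (f : X → ℝ) :
    (k : ℕ) → X → ContinuousMultilinearMap ℝ (fun _ : Fin k => E) ℝ
  | 0 => fun x => ContinuousMultilinearMap.constOfIsEmpty ℝ (fun _ : Fin 0 => E) (f x)
  | k + 1 => fun x => (eDeriv ι (eDerivIter ι f k) x).uncurryLeft

/-- `f ∈ C_E^k(X)`: `f` is continuous and bounded, `k` times `E`-Fréchet differentiable at every
point, and `D_E^j f : X → L^j(E)` is continuous and bounded for `j ≤ k`.
For `k = 0` this is `C_b(X)`. -/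
structure MemCk (ι : E →L[ℝ] X) (k : ℕ) (f : X → ℝ) : Prop where
  continuous : Continuous f
  bounded : ∃ K : ℝ, ∀ x, ‖f x‖ ≤ K
  differentiable : ∀ j < k, ∀ x, EDifferentiableAt ι (eDerivIter ι f j) x
  continuous_deriv : ∀ j ≤ k, Continuous (eDerivIter ι f j)
  bounded_deriv : ∀ j ≤ k, ∃ K : ℝ, ∀ x, ‖eDerivIter ι f j x‖ ≤ K

/-- The Hölder seminorm `[F]_{C_E^σ(X; G)}`, with values in `[0, ∞]`. -/
def holderSeminorm (ι : E →L[ℝ] X) (σ : ℝ) (F : X → G) : ℝ≥0∞ :=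
  ⨆ (x : X) (h : E) (_ : h ≠ 0), ENNReal.ofReal (‖F (x + ι h) - F x‖ / ‖h‖ ^ σ)

/-- `‖f‖_{C_E^k(X)} = ‖f‖_∞ + ∑_{j=1}^k sup_x ‖D_E^j f x‖`, with values in `[0, ∞]`. -/
def ckNorm (ι : E →L[ℝ] X) (k : ℕ) (f : X → ℝ) : ℝ≥0∞ :=
  (⨆ x, ‖f x‖ₑ) + ∑ j ∈ Finset.Icc 1 k, ⨆ x, ‖eDerivIter ι f j x‖ₑ

/-- `f ∈ C_E^α(X)` for real `α ≥ 0`. If `α` is an integer this is `f ∈ C_E^k(X)` with `k = α`;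
if `α = n + σ` with `n` an integer and `0 < σ < 1`, then in addition `[D_E^n f]_{C_E^σ} < ∞`. -/
def MemHolderAlong (ι : E →L[ℝ] X) (α : ℝ) (f : X → ℝ) : Prop :=
  MemCk ι ⌊α⌋₊ f ∧
    (Int.fract α ≠ 0 → holderSeminorm ι (Int.fract α) (eDerivIter ι f ⌊α⌋₊) < ∞)

open Classical in
/-- The norm of `C_E^α(X)` for real `α ≥ 0`: the norm of `C_E^n(X)`, `n = ⌊α⌋`, plus
`[D_E^n f]_{C_E^σ}` with `σ = α - n` if `α` is not an integer. -/
def holderNorm (ι : E →L[ℝ] X) (α : ℝ) (f : X → ℝ) : ℝ≥0∞ :=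
  ckNorm ι ⌊α⌋₊ f +
    if Int.fract α = 0 then 0 else holderSeminorm ι (Int.fract α) (eDerivIter ι f ⌊α⌋₊)

end Directional

/-! ### Operators on a Hilbert space, Gaussian measures, the Cameron–Martin space -/

section Hilbert

variable {X : Type u} [NormedAddCommGroup X] [InnerProductSpace ℝ X]

open Classical in
/-- The strong integral `x ↦ ∫_a^b F(r) x dr` of an operator-valued function. -/
def strongIntegral (F : ℝ → X →L[ℝ] X) (a b : ℝ) : X →L[ℝ] X :=
  if h : ∃ S : X →L[ℝ] X, ∀ x, S x = ∫ r in a..b, F r x then h.choose else 0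

/-- The strong integral of a bounded, strongly integrable operator-valued function is what it
should be. -/
theorem strongIntegral_apply [CompleteSpace X] {F : ℝ → X →L[ℝ] X} {a b C : ℝ}
    (hF : ∀ x, IntervalIntegrable (fun r => F r x) volume a b)
    (hC : ∀ r ∈ Set.uIoc a b, ‖F r‖ ≤ C) (x : X) :
    strongIntegral F a b x = ∫ r in a..b, F r x := by
  have h : ∃ S : X →L[ℝ] X, ∀ x, S x = ∫ r in a..b, F r x := by
    refine ⟨LinearMap.mkContinuous
      { toFun := fun x => ∫ r in a..b, F r x
        map_add' := fun x y => by
          simp only [map_add]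
          exact intervalIntegral.integral_add (hF x) (hF y)
        map_smul' := fun c x => by
          simp only [map_smul, RingHom.id_apply]
          exact intervalIntegral.integral_smul c _ } (C * |b - a|) ?_, fun x => rfl⟩
    intro x
    have := intervalIntegral.norm_integral_le_of_norm_le_const (a := a) (b := b)
      (f := fun r => F r x) (C := C * ‖x‖)
      (fun r hr => (F r).le_of_opNorm_le (hC r hr) x)
    calc _ ≤ C * ‖x‖ * |b - a| := this
      _ = C * |b - a| * ‖x‖ := by ring
  unfold strongIntegral
  rw [dif_pos h]
  exact h.choose_spec x

open Classical in
/-- The square root `Q^{1/2}` of a nonnegative self-adjoint operator `Q`: the (unique)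
nonnegative self-adjoint operator whose square is `Q`. -/
def opSqrt (Q : X →L[ℝ] X) : X →L[ℝ] X :=
  if h : ∃ R : X →L[ℝ] X, R.IsPositive ∧ R ∘L R = Q then h.choose else 0

open Classical in
/-- The pseudo-inverse of `R` at a point `y` of the range of `R`: the (unique) `x ∈ (ker R)ᗮ`, i.e.
the `x` of minimal norm, such that `R x = y`. -/
def pseudoInv (R : X →L[ℝ] X) (y : X) : X :=
  if h : ∃ x : X, x ∈ (LinearMap.ker (R : X →ₗ[ℝ] X))ᗮ ∧ R x = y then h.choose else 0

/-- `Q` has finite trace: `∑ ⟪Q eᵢ, eᵢ⟫ < ∞` for some orthonormal basis `(eᵢ)` of `X`. -/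
def FiniteTrace (Q : X →L[ℝ] X) : Prop :=
  ∃ (I : Type) (e : HilbertBasis I ℝ X), Summable fun i => ⟪Q (e i), e i⟫

variable [MeasurableSpace X]

open Classical in
/-- The Gaussian measure `N_{0,Q}` with mean `0` and covariance operator `Q`: the (unique)
probability measure on `X` with characteristic function `ξ ↦ exp (-⟪Q ξ, ξ⟫ / 2)`. -/
def gaussianMeasure (Q : X →L[ℝ] X) : Measure X :=
  if h : ∃ μ : Measure X, IsProbabilityMeasure μ ∧
      ∀ ξ : X, charFun μ ξ = Complex.exp (-((⟪Q ξ, ξ⟫ / 2 : ℝ) : ℂ))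
  then h.choose else 0

/-- `f` is a version of the function `ĥ` associated with a vector `h` of the Cameron–Martin space
`Q^{1/2}(X)` of `N_{0,Q}`: the limit in `L²(X, N_{0,Q})` of the functions `y ↦ ⟪xₙ, y⟫` for a
sequence with `Q^{1/2} xₙ → Q^{-1/2} h`. If `(e_k)` is an orthonormal basis with `Q e_k = λ_k e_k`,
the choice `xₙ = ∑_{k ≤ n, λ_k ≠ 0} λ_k⁻¹ h_k e_k` gives the series
`ĥ(y) = ∑_{λ_k ≠ 0} y_k h_k λ_k⁻¹`. The limit does not depend on the sequence, since
`‖⟪x, ·⟫‖_{L²} = ‖Q^{1/2} x‖`. -/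
def IsCameronMartinFunction (Q : X →L[ℝ] X) (h : X) (f : X → ℝ) : Prop :=
  Measurable f ∧ ∃ x : ℕ → X,
    Tendsto (fun n => opSqrt Q (x n)) atTop (𝓝 (pseudoInv (opSqrt Q) h)) ∧
    Tendsto (fun n => eLpNorm (fun y => f y - ⟪x n, y⟫) 2 (gaussianMeasure Q)) atTop (𝓝 0)

open Classical in
/-- The function `ĥ` with respect to `N_{0,Q}` (unique up to null sets). -/
def cameronMartinFunction (Q : X →L[ℝ] X) (h : X) : X → ℝ :=
  if H : ∃ f : X → ℝ, IsCameronMartinFunction Q h f then H.choose else 0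

end Hilbert

/-! ### The Ornstein–Uhlenbeck evolution operator -/

section Evolution

variable {X : Type u} [NormedAddCommGroup X] [InnerProductSpace ℝ X] [CompleteSpace X]
variable {Y : Type w} [NormedAddCommGroup Y] [InnerProductSpace ℝ Y] [CompleteSpace Y]

/-- `Q(t,s) = ∫_s^t U(t,r) B(r) B(r)* U(t,r)* dr`. -/
def covOp (U : ℝ → ℝ → X →L[ℝ] X) (B : ℝ → Y →L[ℝ] X) (t s : ℝ) : X →L[ℝ] X :=
  strongIntegral (fun r => U t r ∘L (B r ∘L ContinuousLinearMap.adjoint (B r)) ∘L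
    ContinuousLinearMap.adjoint (U t r)) s t

/-- `m^x(t,s) = U(t,s) x + ∫_s^t U(t,r) f(r) dr`. -/
def meanVec (U : ℝ → ℝ → X →L[ℝ] X) (f : ℝ → X) (t s : ℝ) (x : X) : X :=
  U t s x + ∫ r in s..t, U t r (f r)

variable [MeasurableSpace X]

/-- The standing assumptions on the evolution operator `U(t,s)`, the operators `B(t)`
and the function `f`. Measurability on `[0,T]` is with respect to Lebesgue measurable sets, which
includes Borel measurability. -/
structure StandingAssumptions (T : ℝ) (U : ℝ → ℝ → X →L[ℝ] X) (B : ℝ → Y →L[ℝ] X)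
    (f : ℝ → X) : Prop where
  continuous_evolution : ∀ x : X, ContinuousOn (fun p : ℝ × ℝ => U p.2 p.1 x)
    {p | 0 ≤ p.1 ∧ p.1 ≤ p.2 ∧ p.2 ≤ T}
  evolution_self : ∀ t ∈ Set.Icc 0 T, U t t = ContinuousLinearMap.id ℝ X
  evolution_comp : ∀ s r t : ℝ, 0 ≤ s → s ≤ r → r ≤ t → t ≤ T → U t r ∘L U r s = U t s
  bounded_noise : ∃ K : ℝ, ∀ t ∈ Set.Icc 0 T, ‖B t‖ ≤ K
  measurable_noise : ∀ y : Y, AEMeasurable (fun t => B t y) (volume.restrict (Set.Icc 0 T))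
  bounded_drift : ∃ K : ℝ, ∀ t ∈ Set.Icc 0 T, ‖f t‖ ≤ K
  measurable_drift : AEMeasurable f (volume.restrict (Set.Icc 0 T))
  finite_trace : ∀ s t : ℝ, 0 ≤ s → s < t → t ≤ T → FiniteTrace (covOp U B t s)

/-- `P_{s,t} φ (x) = ∫ φ(y + m^x(t,s)) N_{0,Q(t,s)}(dy)`. -/
def evolutionOp (U : ℝ → ℝ → X →L[ℝ] X) (B : ℝ → Y →L[ℝ] X) (f : ℝ → X) (s t : ℝ)
    (φ : X → ℝ) (x : X) : ℝ :=
  ∫ y, φ (y + meanVec U f t s x) ∂(gaussianMeasure (covOp U B t s))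

variable {E : Type v} [NormedAddCommGroup E] [NormedSpace ℝ E]

/-- `Λ(t,s) = Q(t,s)^{-1/2} U(t,s)` as a map from `E` to `X`. -/
def lambdaOp (ι : E →L[ℝ] X) (U : ℝ → ℝ → X →L[ℝ] X) (B : ℝ → Y →L[ℝ] X) (t s : ℝ)
    (h : E) : X :=
  pseudoInv (opSqrt (covOp U B t s)) (U t s (ι h))

/-- The operator norm `‖Λ(t,s)‖_{L(E;X)}`. -/
def lambdaNorm (ι : E →L[ℝ] X) (U : ℝ → ℝ → X →L[ℝ] X) (B : ℝ → Y →L[ℝ] X) (t s : ℝ) : ℝ :=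
  sInf {c : ℝ | 0 ≤ c ∧ ∀ h : E, ‖lambdaOp ι U B t s h‖ ≤ c * ‖h‖}

/-- `U(t,s)` maps `E` boundedly into the Cameron–Martin space `H_{t,s} = Q(t,s)^{1/2}(X)`, whose
norm is `‖k‖_{H_{t,s}} = ‖Q(t,s)^{-1/2} k‖_X`. -/
def MapsIntoCameronMartin (ι : E →L[ℝ] X) (U : ℝ → ℝ → X →L[ℝ] X) (B : ℝ → Y →L[ℝ] X)
    (t s : ℝ) : Prop :=
  (∀ h : E, U t s (ι h) ∈ Set.range (opSqrt (covOp U B t s))) ∧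
    ∃ c : ℝ, ∀ h : E, ‖pseudoInv (opSqrt (covOp U B t s)) (U t s (ι h))‖ ≤ c * ‖h‖

open Classical in
/-- `I_n(t,s)(y)(h_1, …, h_n)`: the sum over `j = 0, …, ⌊n/2⌋` of `(-1)^j` times the sum over all
choices of pairwise distinct indices `a_1, b_1, …, a_j, b_j` with `a_i < b_i`, `a_i < a_{i+1}` of
`∏_i ⟪Λ h_{a_i}, Λ h_{b_i}⟫` times the product of the functions associated with `U(t,s) h_m` over
the remaining indices `m`. The term `j = 0` is the product over all indices. -/
def wickPolynomial (ι : E →L[ℝ] X) (U : ℝ → ℝ → X →L[ℝ] X) (B : ℝ → Y →L[ℝ] X) (t s : ℝ)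
    (n : ℕ) (y : X) (h : Fin n → E) : ℝ :=
  ∑ j ∈ Finset.range (n / 2 + 1), (-1 : ℝ) ^ j *
    ∑ p : (Fin j → Fin n) × (Fin j → Fin n) with
        StrictMono p.1 ∧ (∀ i, p.1 i < p.2 i) ∧ Function.Injective (Sum.elim p.1 p.2),
      (∏ i, ⟪lambdaOp ι U B t s (h (p.1 i)), lambdaOp ι U B t s (h (p.2 i))⟫) *
        ∏ m with m ∉ Set.range (Sum.elim p.1 p.2),
          cameronMartinFunction (covOp U B t s) (U t s (ι (h m))) y

end Evolution

end

end OUEvolution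

open OUEvolution

/-!
For fixed `s < t`, the operator `P_{s,t}` is a Gaussian smoothing operator
`φ ↦ ∫ φ (V x + b + y) μ(dy)`, where `V = U(t,s)`, `b` is the integral of the drift and `μ` is the
centred Gaussian measure with covariance `Q(t,s) = R²`. A derivative of it along `E` can be taken in
two ways.

* It can fall on `φ` (`hasDerivAt_wickPairing`), as `V` maps `E` to `E`.
* It can fall on `μ`: the increment `V h` is `R (Λ h)`, so by the Cameron–Martin theorem
  (`IsWhiteNoise.map_add_eq_withDensity`) the translation of `μ` by `θ V h` has the density
  `exp (θ w - θ² ‖Λ h‖² / 2)`, where `w` is the Gaussian function of `Λ h`, and this density is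
  smooth in `θ`. By the recursion `wickPoly_succ` for the polynomials `I_n`, differentiating at
  `θ = 0` turns the pairing with `I_n` into the pairing with `I_(n+1)`
  (`hasDerivAt_integral_mul_wickProduct`).

If `φ ∈ C_E^k`, taking the first `n` derivatives on `μ` and the next `k` on `φ` gives the formula for
the derivatives along lines. The pairings are bounded, and continuous in `x` in operator norm, because
`I_n` is bounded in `L²(μ)` by a constant times the product of the norms `‖Λ h_i‖`
(`eLpNorm_wickProduct_le`); this yields Fréchet differentiability (`MemCk.succ_of_line_deriv`,
`eDerivIter_smoothing`). The measure `μ` and the Gaussian functions are constructed beforehand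
(`gaussianMeasure_spec`, `exists_isWhiteNoise`), so that the default values in the definitions play no
role.

For the estimate between `C_E^α₁` and `C_E^α₂`, let `α₁ = n + σ` and `L = ‖Λ‖`. The derivative of
`P_{s,t} φ` of order `j` is bounded by a constant if `j ≤ n`, and by a multiple of `L ^ (j - α₁)` if
`j > n` (`HasHolderBound.norm_eDerivIter_smoothing_le_rpow`). For `σ = 0` this is the `L²` bound of
`I_(j - n)`. For `σ > 0` one factor `L` is improved to `L ^ (1 - σ)`:

* for one derivative, the reflection of `μ` in the direction of `Λ h` changes the sign of the Gaussian
  function, so that only an increment of the Hölder continuous function matters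
  (`abs_integral_mul_whiteNoise_le`);
* for more derivatives, `μ` is the law of `(y + z) / √2` with independent `y` and `z` of law `μ`; one
  derivative falls on `z` and gains the factor, the others fall on `y`
  (`integral_mul_wickProduct_succ`).

The Hölder seminorm of the derivative of order `⌊α₂⌋` follows by interpolating its increments between
the bounds of the derivatives of the orders `⌊α₂⌋` and `⌊α₂⌋ + 1` (`le_rpow_mul_rpow_of_le`). If
`⌊α₂⌋ = ⌊α₁⌋`, the first bound is replaced by the Hölder bound that is inherited from `φ`.
-/

set_option linter.unusedSectionVars false

namespace OUEvolution

/-! ### Square roots and pseudo-inverses of positive operators -/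

section Sqrt

variable {X : Type u} [NormedAddCommGroup X] [InnerProductSpace ℝ X]

/-- A positive operator `A ≤ 1` has norm at most `1`, as `‖A x‖² ≤ ⟪A x, x⟫`. -/
theorem norm_le_one_of_isPositive {A : X →L[ℝ] X} (hA : A.IsPositive)
    (hA' : (1 - A).IsPositive) : ‖A‖ ≤ 1 := by
  refine A.opNorm_le_bound zero_le_one fun x => ?_
  have key : ‖A x‖ ^ 2 ≤ ⟪A x, x⟫ := by
    have h1 := hA'.inner_nonneg_left (A x)
    have h2 := hA.inner_nonneg_left (x - A x)
    have h3 := hA.inner_left_eq_inner_right (A x) x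
    have h4 := hA.inner_left_eq_inner_right (A x) (A x)
    simp only [sub_apply, one_apply_eq_self, map_sub,
      inner_sub_left, inner_sub_right, real_inner_self_eq_norm_sq] at h1 h2 h3 h4
    linarith
  have h5 := real_inner_le_norm (A x) x
  rcases (norm_nonneg (A x)).eq_or_lt with h | h
  · rw [← h]; simp
  · have : ‖A x‖ * ‖A x‖ ≤ ‖A x‖ * ‖x‖ := by nlinarith
    rw [one_mul]; exact le_of_mul_le_mul_left this h

/-- The iteration `Y ↦ (A + Y²) / 2`, whose fixed point `Y` satisfies `(1 - Y)² = 1 - A`. -/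
noncomputable def sqrtIter (A : X →L[ℝ] X) : ℕ → (X →L[ℝ] X)
  | 0 => 0
  | n + 1 => (1 / 2 : ℝ) • (A + sqrtIter A n * sqrtIter A n)

/-- The scalar iteration `y ↦ (1 + y²) / 2` that majorizes `sqrtIter A` for `‖A‖ ≤ 1`. -/
noncomputable def scalarSqrtIter : ℕ → ℝ
  | 0 => 0
  | n + 1 => (1 / 2 : ℝ) * (1 + scalarSqrtIter n * scalarSqrtIter n)

theorem scalarSqrtIter_mem (n : ℕ) : 0 ≤ scalarSqrtIter n ∧ scalarSqrtIter n ≤ 1 := by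
  induction n with
  | zero => simp [scalarSqrtIter]
  | succ n ih => simp only [scalarSqrtIter]; constructor <;> nlinarith [ih.1, ih.2]

theorem commute_sqrtIter (A : X →L[ℝ] X) (n : ℕ) : Commute A (sqrtIter A n) := by
  induction n with
  | zero => exact Commute.zero_right A
  | succ n ih => exact ((Commute.refl A).add_right (ih.mul_right ih)).smul_right _

/-- The iterates of `sqrtIter A` and their increments are majorized by those of the bounded increasing
sequence `scalarSqrtIter`. -/
theorem norm_sqrtIter_le {A : X →L[ℝ] X} (hA : ‖A‖ ≤ 1) (n : ℕ) :
    ‖sqrtIter A n‖ ≤ scalarSqrtIter n ∧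
      ‖sqrtIter A (n + 1) - sqrtIter A n‖ ≤ scalarSqrtIter (n + 1) - scalarSqrtIter n := by
  induction n with
  | zero =>
    simp only [sqrtIter, scalarSqrtIter, norm_zero, le_refl, true_and, mul_zero, add_zero, sub_zero,
      norm_smul]
    norm_num
    linarith
  | succ n ih =>
    have hb : ‖sqrtIter A (n + 1)‖ ≤ scalarSqrtIter (n + 1) := by
      calc _ = ‖sqrtIter A n + (sqrtIter A (n + 1) - sqrtIter A n)‖ := by congr 1; abel
        _ ≤ _ := (norm_add_le _ _).trans (by linarith [ih.1, ih.2])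
    refine ⟨hb, ?_⟩
    have hc : Commute (sqrtIter A (n + 1)) (sqrtIter A n) := by
      have h := commute_sqrtIter A n
      exact (h.add_left ((Commute.refl _).mul_left (Commute.refl _))).smul_left _
    have e : sqrtIter A (n + 2) - sqrtIter A (n + 1) = (1 / 2 : ℝ) •
        ((sqrtIter A (n + 1) + sqrtIter A n) * (sqrtIter A (n + 1) - sqrtIter A n)) := by
      rw [hc.mul_self_sub_mul_self_eq.symm]
      conv_lhs => rw [sqrtIter, sqrtIter.eq_2 A n]
      rw [← smul_sub]
      congr 1
      rw [add_sub_add_left_eq_sub, ← sqrtIter.eq_2 A n]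
    have e' : scalarSqrtIter (n + 2) - scalarSqrtIter (n + 1) = (1 / 2 : ℝ) *
        ((scalarSqrtIter (n + 1) + scalarSqrtIter n) *
          (scalarSqrtIter (n + 1) - scalarSqrtIter n)) := by
      have h1 : scalarSqrtIter (n + 2) =
        (1 / 2 : ℝ) * (1 + scalarSqrtIter (n + 1) * scalarSqrtIter (n + 1)) := rfl
      have h2 : scalarSqrtIter (n + 1) =
        (1 / 2 : ℝ) * (1 + scalarSqrtIter n * scalarSqrtIter n) := rfl
      linear_combination h1 - h2
    rw [e, e', norm_smul]
    have h3 : ‖sqrtIter A (n + 1) + sqrtIter A n‖ ≤ scalarSqrtIter (n + 1) + scalarSqrtIter n :=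
      (norm_add_le _ _).trans (add_le_add hb ih.1)
    have : ‖(1 / 2 : ℝ)‖ = 1 / 2 := by norm_num
    rw [this]
    refine mul_le_mul_of_nonneg_left ((norm_mul_le _ _).trans ?_) (by norm_num)
    exact mul_le_mul h3 ih.2 (norm_nonneg _) ((norm_nonneg _).trans h3)

variable [CompleteSpace X]

theorem isSelfAdjoint_sqrtIter {A : X →L[ℝ] X} (hA : IsSelfAdjoint A) (n : ℕ) :
    IsSelfAdjoint (sqrtIter A n) := by
  induction n with
  | zero => exact IsSelfAdjoint.zero _
  | succ n ih =>
    refine IsSelfAdjoint.smul (by simp [IsSelfAdjoint]) (hA.add ?_)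
    exact (isSelfAdjoint_iff.1 ih ▸ IsSelfAdjoint.star_mul_self (sqrtIter A n) : )

/-- Every positive operator on a real Hilbert space has a positive square root. If `Q` has norm `1`
and `A = 1 - Q`, it is `1 - Y`, where `Y` is the limit of the iteration `sqrtIter A`. -/
theorem exists_isPositive_sqrt {Q : X →L[ℝ] X} (hQ : Q.IsPositive) :
    ∃ R : X →L[ℝ] X, R.IsPositive ∧ R ∘L R = Q := by
  by_cases h0 : Q = 0
  · exact ⟨0, ContinuousLinearMap.isPositive_zero, by simp [h0]⟩
  have hc : 0 < ‖Q‖ := norm_pos_iff.2 h0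
  set A : X →L[ℝ] X := 1 - ‖Q‖⁻¹ • Q with hAdef
  have hQ' : (1 - A).IsPositive := by
    rw [hAdef, sub_sub_cancel]
    exact hQ.smul_of_nonneg (by positivity)
  have hA : A.IsPositive := by
    rw [ContinuousLinearMap.isPositive_def']
    refine ⟨(IsSelfAdjoint.one _).sub ((hQ.smul_of_nonneg (c := ‖Q‖⁻¹)
      (by positivity)).isSelfAdjoint), fun x => ?_⟩
    have h1 := real_inner_le_norm (Q x) x
    have h2 := Q.le_opNorm x
    simp only [ContinuousLinearMap.reApplyInnerSelf_apply, hAdef, sub_apply,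
      one_apply_eq_self, smul_apply, inner_sub_left,
      real_inner_smul_left, real_inner_self_eq_norm_sq, RCLike.re_to_real]
    have : ‖Q‖⁻¹ * ⟪Q x, x⟫ ≤ ‖x‖ ^ 2 := by
      rw [inv_mul_le_iff₀ hc]
      nlinarith [norm_nonneg x]
    linarith
  have hA1 := norm_le_one_of_isPositive hA hQ'
  have hs : Summable fun n => scalarSqrtIter (n + 1) - scalarSqrtIter n := by
    refine summable_of_sum_range_le (c := 1)
      (fun n => (norm_nonneg _).trans (norm_sqrtIter_le hA1 n).2) fun n => ?_
    rw [Finset.sum_range_sub]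
    simpa [scalarSqrtIter] using (scalarSqrtIter_mem n).2
  have hcau : CauchySeq (sqrtIter A) :=
    cauchySeq_of_dist_le_of_summable _
      (fun n => by rw [dist_comm, dist_eq_norm]; exact (norm_sqrtIter_le hA1 n).2) hs
  obtain ⟨Y, hY⟩ := cauchySeq_tendsto_of_complete hcau
  have hY1 : ‖Y‖ ≤ 1 :=
    le_of_tendsto hY.norm (Eventually.of_forall fun n =>
      (norm_sqrtIter_le hA1 n).1.trans (scalarSqrtIter_mem n).2)
  have hYsa : IsSelfAdjoint Y := by
    have h1 : Tendsto (fun n => star (sqrtIter A n)) atTop (𝓝 (star Y)) :=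
      (continuous_star.tendsto Y).comp hY
    simp only [fun n => (isSelfAdjoint_sqrtIter hA.isSelfAdjoint n).star_eq] at h1
    exact tendsto_nhds_unique h1 hY
  have hfix : Y = (1 / 2 : ℝ) • (A + Y * Y) := by
    have h1 : Tendsto (fun n => sqrtIter A (n + 1)) atTop (𝓝 ((1 / 2 : ℝ) • (A + Y * Y))) :=
      ((hY.mul hY).const_add A).const_smul (1 / 2 : ℝ)
    exact tendsto_nhds_unique ((tendsto_add_atTop_iff_nat 1).2 hY) h1
  have hsq : (1 - Y) * (1 - Y) = 1 - A := by
    have : (2 : ℝ) • Y = A + Y * Y := by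
      conv_lhs => rw [hfix, smul_smul]
      norm_num
    rw [two_smul] at this
    calc (1 - Y) * (1 - Y) = 1 - ((Y + Y) - Y * Y) := by noncomm_ring
      _ = 1 - A := by rw [this]; abel
  have hpos : (1 - Y).IsPositive := by
    rw [ContinuousLinearMap.isPositive_def']
    refine ⟨(IsSelfAdjoint.one _).sub hYsa, fun x => ?_⟩
    have h1 := real_inner_le_norm (Y x) x
    have h2 := Y.le_of_opNorm_le hY1 x
    simp only [ContinuousLinearMap.reApplyInnerSelf_apply, sub_apply,
      one_apply_eq_self, inner_sub_left,
      real_inner_self_eq_norm_sq, RCLike.re_to_real]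
    nlinarith [norm_nonneg x]
  refine ⟨Real.sqrt ‖Q‖ • (1 - Y), hpos.smul_of_nonneg (Real.sqrt_nonneg _), ?_⟩
  change (Real.sqrt ‖Q‖ • (1 - Y)) * (Real.sqrt ‖Q‖ • (1 - Y)) = Q
  rw [smul_mul_smul_comm, hsq, Real.mul_self_sqrt hc.le, hAdef, sub_sub_cancel, smul_smul,
    mul_inv_cancel₀ hc.ne', one_smul]

theorem opSqrt_spec {Q : X →L[ℝ] X} (hQ : Q.IsPositive) :
    (opSqrt Q).IsPositive ∧ opSqrt Q ∘L opSqrt Q = Q := by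
  have h := exists_isPositive_sqrt hQ
  unfold opSqrt
  rw [dif_pos h]
  exact h.choose_spec

theorem inner_eq_inner_opSqrt {Q : X →L[ℝ] X} (hQ : Q.IsPositive) (x y : X) :
    ⟪Q x, y⟫ = ⟪opSqrt Q x, opSqrt Q y⟫ := by
  obtain ⟨h1, h2⟩ := opSqrt_spec hQ
  conv_lhs => rw [← h2]
  exact h1.inner_left_eq_inner_right _ _

theorem pseudoInv_spec {R : X →L[ℝ] X} {y : X} (hy : y ∈ Set.range R) :
    pseudoInv R y ∈ (LinearMap.ker (R : X →ₗ[ℝ] X))ᗮ ∧ R (pseudoInv R y) = y := by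
  have h : ∃ x : X, x ∈ (LinearMap.ker (R : X →ₗ[ℝ] X))ᗮ ∧ R x = y := by
    obtain ⟨x, rfl⟩ := hy
    have : CompleteSpace (LinearMap.ker (R : X →ₗ[ℝ] X)) := R.isClosed_ker.completeSpace_coe
    obtain ⟨a, ha, b, hb, hab⟩ :=
      (LinearMap.ker (R : X →ₗ[ℝ] X)).exists_add_mem_mem_orthogonal x
    refine ⟨b, hb, ?_⟩
    rw [hab, map_add, show R a = 0 from ha, zero_add]
  unfold pseudoInv
  rw [dif_pos h]
  exact h.choose_spec

theorem pseudoInv_unique {R : X →L[ℝ] X} {x : X}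
    (hx : x ∈ (LinearMap.ker (R : X →ₗ[ℝ] X))ᗮ) : pseudoInv R (R x) = x := by
  obtain ⟨h1, h2⟩ := pseudoInv_spec (R := R) ⟨x, rfl⟩
  have h3 : pseudoInv R (R x) - x ∈ LinearMap.ker (R : X →ₗ[ℝ] X) := by
    simp [h2]
  have h4 := Submodule.sub_mem _ h1 hx
  have := h4 _ h3
  exact sub_eq_zero.1 (inner_self_eq_zero.1 this)

theorem pseudoInv_add {R : X →L[ℝ] X} {y z : X} (hy : y ∈ Set.range R) (hz : z ∈ Set.range R) :
    pseudoInv R (y + z) = pseudoInv R y + pseudoInv R z := by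
  obtain ⟨h1, h2⟩ := pseudoInv_spec hy
  obtain ⟨h3, h4⟩ := pseudoInv_spec hz
  rw [← pseudoInv_unique (Submodule.add_mem _ h1 h3), map_add, h2, h4]

theorem pseudoInv_smul {R : X →L[ℝ] X} {y : X} (c : ℝ) (hy : y ∈ Set.range R) :
    pseudoInv R (c • y) = c • pseudoInv R y := by
  obtain ⟨h1, h2⟩ := pseudoInv_spec hy
  rw [← pseudoInv_unique (Submodule.smul_mem _ c h1), map_smul, h2]

/-- The pseudo-inverse of a symmetric operator takes values in the closure of its range. -/
theorem exists_seq_tendsto_pseudoInv {R : X →L[ℝ] X} (hR : R.IsPositive) {y : X}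
    (hy : y ∈ Set.range R) : ∃ x : ℕ → X, Tendsto (fun n => R (x n)) atTop (𝓝 (pseudoInv R y)) := by
  have h1 := (pseudoInv_spec hy).1
  have h2 : (LinearMap.ker (R : X →ₗ[ℝ] X))ᗮ =
      (LinearMap.range (R : X →ₗ[ℝ] X)).topologicalClosure := by
    have := ContinuousLinearMap.orthogonal_ker R
    rw [← ContinuousLinearMap.star_eq_adjoint, hR.isSelfAdjoint.star_eq] at this
    exact this
  rw [h2, ← SetLike.mem_coe, Submodule.topologicalClosure_coe] at h1
  obtain ⟨z, hz, hz'⟩ := mem_closure_iff_seq_limit.1 h1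
  choose x hx using hz
  exact ⟨x, by simpa only [show ∀ n, R (x n) = z n from hx] using hz'⟩

end Sqrt

/-! ### The covariance operator of the Ornstein–Uhlenbeck process -/

section CovarianceOperator

variable {X : Type u} [NormedAddCommGroup X] [InnerProductSpace ℝ X]

theorem HilbertBasis.countable_index {I : Type*} [TopologicalSpace.SeparableSpace X]
    (e : HilbertBasis I ℝ X) : Countable I := by
  refine Pairwise.countable_of_isOpen_disjoint (s := fun i => Metric.ball (e i) (1 / 2))
    (fun i j hij => Metric.ball_disjoint_ball ?_) (fun i => Metric.isOpen_ball)
    (fun i => ⟨e i, Metric.mem_ball_self (by norm_num)⟩)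
  have h1 : ‖e i - e j‖ ^ 2 = 2 := by
    rw [norm_sub_sq_real, e.orthonormal.1 i, e.orthonormal.1 j, e.orthonormal.2 hij]
    norm_num
  rw [dist_eq_norm]
  nlinarith [norm_nonneg (e i - e j)]

/-- A weakly measurable function with values in a separable Hilbert space is strongly measurable
(the Hilbert space case of the Pettis theorem). -/
theorem aestronglyMeasurable_of_inner [CompleteSpace X] [TopologicalSpace.SeparableSpace X]
    {α : Type*} [MeasurableSpace α] {μ : Measure α} {g : α → X}
    (hg : ∀ y : X, AEMeasurable (fun a => ⟪y, g a⟫) μ) : AEStronglyMeasurable g μ := by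
  obtain ⟨I, e, -⟩ := exists_hilbertBasis ℝ X
  have := HilbertBasis.countable_index e
  refine aestronglyMeasurable_of_tendsto_ae (atTop : Filter (Finset I))
    (f := fun F a => ∑ i ∈ F, ⟪e i, g a⟫ • e i) (fun F => ?_) (ae_of_all _ fun a => ?_)
  · exact Finset.aestronglyMeasurable_fun_sum F fun i _ =>
      (hg (e i)).aestronglyMeasurable.smul_const (e i)
  · have := e.hasSum_repr (g a)
    simp only [e.repr_apply_apply] at this
    exact this

variable {Y : Type w} [NormedAddCommGroup Y] [InnerProductSpace ℝ Y]

/-- A strongly measurable operator-valued function applied to a strongly measurable vector-valued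
function is strongly measurable. -/
theorem aestronglyMeasurable_apply {α : Type*} [MeasurableSpace α] {μ : Measure α}
    {A : α → Y →L[ℝ] X} (hA : ∀ y, AEStronglyMeasurable (fun a => A a y) μ) {g : α → Y}
    (hg : AEStronglyMeasurable g μ) : AEStronglyMeasurable (fun a => A a (g a)) μ := by
  obtain ⟨g', hg', hgg'⟩ := hg
  suffices h : AEStronglyMeasurable (fun a => A a (g' a)) μ by
    refine h.congr ?_
    filter_upwards [hgg'] with a ha
    rw [ha]
  refine aestronglyMeasurable_of_tendsto_ae atTop
    (f := fun n a => A a (hg'.approx n a)) (fun n => ?_)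
    (ae_of_all _ fun a => ((A a).continuous.tendsto _).comp (hg'.tendsto_approx a))
  set s := hg'.approx n
  have : (fun a => A a (s a)) =
      fun a => ∑ c ∈ s.range, (s ⁻¹' {c}).indicator (fun a => A a c) a := by
    funext a
    rw [Finset.sum_eq_single (s a)]
    · simp
    · intro c _ hc
      exact Set.indicator_of_notMem (fun h => hc (by simpa using h.symm)) _
    · intro h
      exact absurd (SimpleFunc.mem_range_self s a) h
  rw [this]
  exact Finset.aestronglyMeasurable_fun_sum _ fun c _ =>
    (hA c).indicator (s.measurableSet_fiber c)

variable [CompleteSpace X] [CompleteSpace Y] [MeasurableSpace X] [BorelSpace X]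
  [TopologicalSpace.SeparableSpace X] [TopologicalSpace.SeparableSpace Y]

/-- `Q(t,s)` is positive: it is the strong integral of the positive operators
`U(t,r) B(r) B(r)* U(t,r)*`, which are strongly measurable and bounded on `[s, t]`. -/
theorem covOp_isPositive {T : ℝ} {U : ℝ → ℝ → X →L[ℝ] X} {B : ℝ → Y →L[ℝ] X} {f : ℝ → X}
    (hS : StandingAssumptions T U B f) {s t : ℝ} (hs : 0 ≤ s) (hst : s < t) (ht : t ≤ T) :
    (covOp U B t s).IsPositive := by
  have : SecondCountableTopology X := UniformSpace.secondCountable_of_separable X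
  have hsub : Set.Icc s t ⊆ Set.Icc 0 T := Set.Icc_subset_Icc hs ht
  have hUc : ∀ x, ContinuousOn (fun r => U t r x) (Set.Icc s t) := fun x =>
    (hS.continuous_evolution x).comp (f := fun r => (r, t)) (by fun_prop)
      fun r hr => ⟨hs.trans hr.1, hr.2, ht⟩
  -- `U(t, ·)` is bounded in norm by the uniform boundedness principle
  obtain ⟨CU, hCU⟩ : ∃ C, ∀ r : Set.Icc s t, ‖U t r‖ ≤ C := by
    refine banach_steinhaus fun x => ?_
    obtain ⟨C, hC⟩ := isCompact_Icc.exists_bound_of_continuousOn (hUc x)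
    exact ⟨C, fun r => hC r r.2⟩
  obtain ⟨CB, hCB⟩ := hS.bounded_noise
  set ν := volume.restrict (Set.Icc s t) with hν
  have hU : ∀ x, AEStronglyMeasurable (fun r => U t r x) ν := fun x =>
    (hUc x).aestronglyMeasurable measurableSet_Icc
  have hB : ∀ y, AEStronglyMeasurable (fun r => B r y) ν := fun y =>
    ((hS.measurable_noise y).mono_measure (Measure.restrict_mono hsub le_rfl)).aestronglyMeasurable
  let F : ℝ → X →L[ℝ] X := fun r => U t r ∘L (B r ∘L ContinuousLinearMap.adjoint (B r)) ∘L
    ContinuousLinearMap.adjoint (U t r)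
  have hF : ∀ x, AEStronglyMeasurable (fun r => F r x) ν := by
    intro x
    refine aestronglyMeasurable_apply hU (aestronglyMeasurable_apply hB
      (g := fun r => ContinuousLinearMap.adjoint (B r) (ContinuousLinearMap.adjoint (U t r) x)) ?_)
    refine aestronglyMeasurable_of_inner fun y =>
      (((aestronglyMeasurable_apply hU (hB y)).aemeasurable.inner_const (c := x)).congr
        (ae_of_all _ fun r => ?_))
    simp only [ContinuousLinearMap.adjoint_inner_right]
  have hFb : ∀ r ∈ Set.Icc s t, ‖F r‖ ≤ CU * (CB * CB * CU) := by
    intro r hr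
    have h1 := hCU ⟨r, hr⟩
    have h2 := hCB r (hsub hr)
    have h3 := norm_nonneg (U t r)
    have h4 := norm_nonneg (B r)
    have h5 : 0 ≤ CU := h3.trans h1
    have h6 : 0 ≤ CB := h4.trans h2
    refine (ContinuousLinearMap.opNorm_comp_le _ _).trans
      (mul_le_mul h1 ((ContinuousLinearMap.opNorm_comp_le _ _).trans
      (mul_le_mul ((ContinuousLinearMap.opNorm_comp_le _ _).trans
        (mul_le_mul h2 ?_ (norm_nonneg _) h6)) ?_ (norm_nonneg _) (by positivity)))
        (norm_nonneg _) h5)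
    · rwa [LinearIsometryEquiv.norm_map]
    · rwa [LinearIsometryEquiv.norm_map]
  have hFi : ∀ x, IntervalIntegrable (fun r => F r x) volume s t := by
    intro x
    rw [intervalIntegrable_iff_integrableOn_Icc_of_le hst.le]
    refine Integrable.of_bound (hF x) (CU * (CB * CB * CU) * ‖x‖) ?_
    filter_upwards [ae_restrict_mem measurableSet_Icc] with r hr
    exact (F r).le_of_opNorm_le (hFb r hr) x
  have hQ : ∀ x, covOp U B t s x = ∫ r in s..t, F r x := fun x =>
    strongIntegral_apply hFi (fun r hr => hFb r (by
      rw [Set.uIoc_of_le hst.le] at hr; exact Set.Ioc_subset_Icc_self hr)) x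
  have hFs : ∀ r, (F r).IsPositive := fun r => by
    have := ContinuousLinearMap.isPositive_self_comp_adjoint (U t r ∘L B r)
    rw [ContinuousLinearMap.adjoint_comp] at this
    exact this
  have hin : ∀ x y, ⟪covOp U B t s x, y⟫ = ∫ r in s..t, ⟪F r x, y⟫ := by
    intro x y
    rw [hQ, real_inner_comm, ← innerSL_apply_apply ℝ,
      ← ContinuousLinearMap.intervalIntegral_comp_comm _ (hFi x)]
    simp only [innerSL_apply_apply, real_inner_comm]
  rw [ContinuousLinearMap.isPositive_iff]
  refine ⟨fun x y => ?_, fun x => ?_⟩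
  · change ⟪covOp U B t s x, y⟫ = ⟪x, covOp U B t s y⟫
    rw [real_inner_comm _ x, hin, hin]
    simp only [fun r => (hFs r).inner_left_eq_inner_right x y, real_inner_comm]
  · rw [hin]
    exact intervalIntegral.integral_nonneg hst.le fun r _ => (hFs r).inner_nonneg_left x

end CovarianceOperator

/-! ### Existence of Gaussian measures on a Hilbert space -/

section GaussianExistence

open ProbabilityTheory

/-- The characteristic functions of two random variables at `1` differ by at most the `L²` distance
of the variables. -/
theorem enorm_integral_cexp_sub_le {Ω : Type*} [MeasurableSpace Ω] {P : Measure Ω}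
    [IsProbabilityMeasure P] {a b : Ω → ℝ} (ha : AEStronglyMeasurable a P)
    (hb : AEStronglyMeasurable b P) :
    ‖(∫ ω, Complex.exp (a ω * Complex.I) ∂P) - ∫ ω, Complex.exp (b ω * Complex.I) ∂P‖ₑ ≤
      eLpNorm (fun ω => a ω - b ω) 2 P := by
  have hm : ∀ c : Ω → ℝ, AEStronglyMeasurable c P →
      Integrable (fun ω => Complex.exp (c ω * Complex.I)) P := fun c hc => by
    refine Integrable.of_bound (C := 1) ?_ (ae_of_all _ fun ω => ?_)
    · exact (show Continuous fun x : ℝ => Complex.exp (x * Complex.I) by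
        fun_prop).comp_aestronglyMeasurable hc
    · rw [Complex.norm_exp_ofReal_mul_I]
  rw [← integral_sub (hm a ha) (hm b hb)]
  calc _ ≤ ∫⁻ ω, ‖Complex.exp (a ω * Complex.I) - Complex.exp (b ω * Complex.I)‖ₑ ∂P :=
        enorm_integral_le_lintegral_enorm _
    _ ≤ ∫⁻ ω, ‖a ω - b ω‖ₑ ∂P := by
        refine lintegral_mono fun ω => ?_
        have : Complex.exp (a ω * Complex.I) - Complex.exp (b ω * Complex.I) =
            Complex.exp (b ω * Complex.I) *
              (Complex.exp (Complex.I * ((a ω - b ω : ℝ) : ℂ)) - 1) := by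
          rw [mul_sub, ← Complex.exp_add, mul_one]
          congr 2
          push_cast
          ring
        rw [this, enorm_mul, ← ofReal_norm, Complex.norm_exp_ofReal_mul_I]
        simpa using Real.enorm_exp_I_mul_ofReal_sub_one_le (x := a ω - b ω)
    _ = eLpNorm (fun ω => a ω - b ω) 1 P := eLpNorm_one_eq_lintegral_enorm.symm
    _ ≤ _ := eLpNorm_le_eLpNorm_of_exponent_le (by norm_num) (ha.sub hb)

theorem tendsto_integral_cexp {Ω : Type*} [MeasurableSpace Ω] {P : Measure Ω}
    [IsProbabilityMeasure P] {κ : Type*} {l : Filter κ} {a : κ → Ω → ℝ} {b : Ω → ℝ}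
    (ha : ∀ k, AEStronglyMeasurable (a k) P) (hb : AEStronglyMeasurable b P)
    (h : Tendsto (fun k => eLpNorm (fun ω => a k ω - b ω) 2 P) l (𝓝 0)) :
    Tendsto (fun k => ∫ ω, Complex.exp (a k ω * Complex.I) ∂P) l
      (𝓝 (∫ ω, Complex.exp (b ω * Complex.I) ∂P)) := by
  rw [tendsto_iff_edist_tendsto_0]
  refine tendsto_of_tendsto_of_tendsto_of_le_of_le tendsto_const_nhds h
    (fun _ => zero_le) fun k => ?_
  simp only [edist_eq_enorm_sub]
  exact enorm_integral_cexp_sub_le (ha k) hb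

variable {X : Type u} [NormedAddCommGroup X] [InnerProductSpace ℝ X] [CompleteSpace X]
  [TopologicalSpace.SeparableSpace X] [MeasurableSpace X] [BorelSpace X]

/-- If `R` is a symmetric Hilbert–Schmidt operator, the series `∑ ξᵢ R eᵢ` with independent standard
Gaussian coefficients converges in `L²(X)`; its sum has law `N_{0,R²}`. -/
theorem exists_gaussianMeasure_of_hilbertSchmidt {R : X →L[ℝ] X} (hR : R.IsPositive) {I : Type*}
    (e : HilbertBasis I ℝ X) (hs : Summable fun i => ‖R (e i)‖ ^ 2) :
    ∃ μ : Measure X, IsProbabilityMeasure μ ∧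
      ∀ ξ : X, charFun μ ξ = Complex.exp (-((‖R ξ‖ ^ 2 / 2 : ℝ) : ℂ)) := by
  have : SecondCountableTopology X := UniformSpace.secondCountable_of_separable X
  let P : Measure (I → ℝ) := Measure.infinitePi fun _ : I => gaussianReal 0 1
  have hmp : ∀ i, MeasurePreserving (Function.eval i) P (gaussianReal 0 1) :=
    measurePreserving_eval_infinitePi _
  have hme : ∀ (c : ℝ) (i : I), Measurable fun ω : I → ℝ => c * ω i := fun c i => by fun_prop
  have hind : iIndepFun (fun (i : I) (ω : I → ℝ) => ω i) P :=
    iIndepFun_infinitePi (X := fun _ x => x) fun _ => measurable_id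
  have hL : ∀ i, MemLp (fun ω : I → ℝ => ω i) 2 P := fun i =>
    (memLp_id_gaussianReal 2).comp_measurePreserving (hmp i)
  have hLX : ∀ i, MemLp (fun ω : I → ℝ => ω i • R (e i)) 2 P := fun i =>
    (memLp_top_const (R (e i))).smul (hL i)
  let v : I → Lp X 2 P := fun i => (hLX i).toLp
  have hmean : ∀ i, ∫ ω, ω i ∂P = 0 := fun i => by
    have h := integral_map (μ := P) (measurable_pi_apply i).aemeasurable
      (f := fun x : ℝ => x) (by fun_prop)
    rw [← h]
    change ∫ x, x ∂(P.map (Function.eval i)) = 0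
    rw [(hmp i).map_eq, integral_id_gaussianReal]
  -- the terms `ξᵢ R eᵢ` are orthogonal in `L²(X)`, with summable squared norms
  have horth : Pairwise fun i j => ⟪v i, v j⟫ = 0 := by
    intro i j hij
    rw [L2.inner_def]
    have h1 : ∫ ω, ⟪v i ω, v j ω⟫ ∂P = ∫ ω, (ω i * ω j) * ⟪R (e i), R (e j)⟫ ∂P := by
      refine integral_congr_ae ?_
      filter_upwards [(hLX i).coeFn_toLp, (hLX j).coeFn_toLp] with ω h1 h2
      simp only [v]
      rw [h1, h2, real_inner_smul_left, real_inner_smul_right]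
      ring
    rw [h1, integral_mul_const]
    have h2 := (hind.indepFun hij).integral_fun_mul_eq_mul_integral
      (hL i).aestronglyMeasurable (hL j).aestronglyMeasurable
    rw [h2, hmean, zero_mul, zero_mul]
  have hsum : Summable v := by
    have hof : OrthogonalFamily ℝ (fun i => (ℝ ∙ v i : Submodule ℝ (Lp X 2 P)))
        (fun i => (ℝ ∙ v i : Submodule ℝ (Lp X 2 P)).subtypeₗᵢ) := by
      refine OrthogonalFamily.of_pairwise fun i j hij => ?_
      rw [Function.onFun, Submodule.isOrtho_span]
      rintro a rfl b rfl
      exact horth hij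
    have h2 := (hof.summable_iff_norm_sq_summable
      (fun i => ⟨v i, Submodule.mem_span_singleton_self _⟩)).2
    refine h2 ?_
    set K : ℝ≥0∞ := eLpNorm (fun x : ℝ => x) 2 (gaussianReal 0 1)
    have hK : K ≠ ∞ := (memLp_id_gaussianReal 2).eLpNorm_ne_top
    refine Summable.of_nonneg_of_le (fun i => sq_nonneg _) (fun i => ?_)
      (hs.mul_left (K.toReal ^ 2))
    rw [← mul_pow]
    refine pow_le_pow_left₀ (norm_nonneg _) ?_ 2
    change ‖v i‖ ≤ _
    rw [Lp.norm_toLp]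
    have h3 : eLpNorm (fun ω : I → ℝ => ω i • R (e i)) 2 P ≤ ENNReal.ofReal ‖R (e i)‖ * K := by
      have h4 : eLpNorm (fun ω : I → ℝ => ω i) 2 P = K :=
        eLpNorm_comp_measurePreserving (g := fun x : ℝ => x) (by fun_prop) (hmp i)
      rw [← h4]
      refine eLpNorm_le_mul_eLpNorm_of_ae_le_mul (ae_of_all _ fun ω => ?_) 2
      rw [norm_smul, mul_comm]
    have h5 := ENNReal.toReal_mono (ENNReal.mul_ne_top ENNReal.ofReal_ne_top hK) h3
    rwa [ENNReal.toReal_mul, ENNReal.toReal_ofReal (norm_nonneg _), mul_comm] at h5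
  obtain ⟨W, hW⟩ := hsum
  have hWm : AEMeasurable W P := (Lp.aestronglyMeasurable W).aemeasurable
  refine ⟨P.map W, Measure.isProbabilityMeasure_map hWm, fun ξ => ?_⟩
  have e1 : charFun (P.map W) ξ = ∫ ω, Complex.exp ((⟪W ω, ξ⟫ : ℝ) * Complex.I) ∂P := by
    rw [charFun_apply, integral_map hWm (by fun_prop)]
  have hS : Tendsto (fun F : Finset I =>
      ∫ ω, Complex.exp ((⟪(∑ i ∈ F, v i : Lp X 2 P) ω, ξ⟫ : ℝ) * Complex.I) ∂P) atTop
      (𝓝 (charFun (P.map W) ξ)) := by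
    rw [e1]
    refine tendsto_integral_cexp
      (fun F => (Lp.aestronglyMeasurable _).inner_const)
      ((Lp.aestronglyMeasurable _).inner_const) ?_
    have h1 : Tendsto (fun F : Finset I => ENNReal.ofReal ‖ξ‖ * ‖(∑ i ∈ F, v i) - W‖ₑ) atTop
        (𝓝 0) := by
      have h2 : Tendsto (fun F : Finset I => ‖(∑ i ∈ F, v i) - W‖ₑ) atTop (𝓝 0) := by
        have := tendsto_iff_edist_tendsto_0.1 hW
        simpa only [edist_eq_enorm_sub, SummationFilter.unconditional_filter] using this
      simpa only [mul_zero] using ENNReal.Tendsto.const_mul h2 (Or.inr ENNReal.ofReal_ne_top)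
    refine tendsto_of_tendsto_of_tendsto_of_le_of_le tendsto_const_nhds h1
      (fun _ => zero_le) fun F => ?_
    rw [Lp.enorm_def]
    refine eLpNorm_le_mul_eLpNorm_of_ae_le_mul ?_ 2
    filter_upwards [Lp.coeFn_sub (∑ i ∈ F, v i) W] with ω hω
    rw [hω, Pi.sub_apply, ← inner_sub_left, mul_comm]
    exact norm_inner_le_norm _ _
  -- the characteristic functions of the partial sums
  have hF : ∀ F : Finset I,
      ∫ ω, Complex.exp ((⟪(∑ i ∈ F, v i : Lp X 2 P) ω, ξ⟫ : ℝ) * Complex.I) ∂P =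
        Complex.exp (-((∑ i ∈ F, ⟪e i, R ξ⟫ ^ 2 / 2 : ℝ) : ℂ)) := by
    intro F
    have h1 := iIndepFun.charFun_map_fun_finsetSum_eq_prod (P := P) (s := F)
      (X := fun (i : I) (ω : I → ℝ) => ⟪e i, R ξ⟫ * ω i)
      (fun i _ => (hme _ i).aemeasurable)
      ((hind.comp (fun i x => ⟪e i, R ξ⟫ * x) fun i => by fun_prop).restrict F)
    have h2 := congrFun h1 1
    rw [charFun_apply, integral_map
      (Finset.measurable_fun_sum _ fun i _ => hme _ i).aemeasurable (by fun_prop),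
      Finset.prod_apply] at h2
    have h3 : ∀ i ∈ F, charFun (P.map fun ω : I → ℝ => ⟪e i, R ξ⟫ * ω i) 1 =
        Complex.exp (-((⟪e i, R ξ⟫ ^ 2 / 2 : ℝ) : ℂ)) := by
      intro i _
      rw [charFun_map_mul_comp (measurable_pi_apply i).aemeasurable]
      have : (P.map fun ω : I → ℝ => ω i) = gaussianReal 0 1 := (hmp i).map_eq
      rw [this, charFun_gaussianReal]
      congr 1
      push_cast
      ring
    rw [Finset.prod_congr rfl h3, ← Complex.exp_sum] at h2
    have h4 : ∑ i ∈ F, -((⟪e i, R ξ⟫ ^ 2 / 2 : ℝ) : ℂ) =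
        -((∑ i ∈ F, ⟪e i, R ξ⟫ ^ 2 / 2 : ℝ) : ℂ) := by
      push_cast
      rw [Finset.sum_neg_distrib]
    rw [← h4, ← h2]
    refine integral_congr_ae ?_
    have h5 : ∀ᵐ ω ∂P, ∀ i ∈ F, v i ω = ω i • R (e i) :=
      (ae_ball_iff F.countable_toSet).2 fun i _ => (hLX i).coeFn_toLp
    filter_upwards [Lp.coeFn_finsetSum F v, h5] with ω h6 h7
    rw [h6, Finset.sum_apply, Finset.sum_congr rfl h7, sum_inner]
    simp only [real_inner_smul_left, RCLike.inner_apply, conj_trivial]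
    congr 3
    rw [one_mul]
    refine Finset.sum_congr rfl fun i _ => ?_
    rw [hR.inner_left_eq_inner_right, mul_comm]
  simp only [hF] at hS
  refine tendsto_nhds_unique hS ?_
  have h8 : HasSum (fun i => ⟪e i, R ξ⟫ ^ 2 / 2) (‖R ξ‖ ^ 2 / 2) := by
    have := e.hasSum_inner_mul_inner (R ξ) (R ξ)
    rw [real_inner_self_eq_norm_sq] at this
    refine (this.div_const 2).congr_fun ?_ |> fun h => h
    intro i
    rw [sq, real_inner_comm (e i) (R ξ)]
  exact (Complex.continuous_exp.tendsto _).comp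
    ((Complex.continuous_ofReal.tendsto _).comp h8).neg

theorem gaussianMeasure_spec {Q : X →L[ℝ] X} (hQ : Q.IsPositive) (hT : FiniteTrace Q) :
    IsProbabilityMeasure (gaussianMeasure Q) ∧
      ∀ ξ : X, charFun (gaussianMeasure Q) ξ =
        Complex.exp (-((‖opSqrt Q ξ‖ ^ 2 / 2 : ℝ) : ℂ)) := by
  have hin : ∀ ξ, ⟪Q ξ, ξ⟫ = ‖opSqrt Q ξ‖ ^ 2 := fun ξ => by
    rw [inner_eq_inner_opSqrt hQ, real_inner_self_eq_norm_sq]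
  have h : ∃ μ : Measure X, IsProbabilityMeasure μ ∧
      ∀ ξ : X, charFun μ ξ = Complex.exp (-((⟪Q ξ, ξ⟫ / 2 : ℝ) : ℂ)) := by
    obtain ⟨I, e, he⟩ := hT
    simp only [hin] at he ⊢
    exact exists_gaussianMeasure_of_hilbertSchmidt (opSqrt_spec hQ).1 e he
  unfold gaussianMeasure
  rw [dif_pos h]
  simpa only [hin] using h.choose_spec

end GaussianExistence

/-! ### White noise functions and transformations of a Gaussian measure -/

section WhiteNoise

open ProbabilityTheory

variable {X : Type u} [NormedAddCommGroup X] [InnerProductSpace ℝ X] [MeasurableSpace X]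

/-- `μ` is the centred Gaussian measure with covariance `R²`, where `R` is a positive operator. -/
structure IsGaussianWithRoot (R : X →L[ℝ] X) (μ : Measure X) : Prop where
  isPositive : R.IsPositive
  isProbabilityMeasure : IsProbabilityMeasure μ
  charFun_eq : ∀ ξ : X, charFun μ ξ = Complex.exp (-((‖R ξ‖ ^ 2 / 2 : ℝ) : ℂ))

/-- `w` is a version of the white noise function of `g`: the `L²(μ)`-limit of `⟪xₙ, ·⟫` for some
sequence with `R xₙ → g`. If `R = Q^{1/2}`, `μ = N_{0,Q}` and `g = Q^{-1/2} h`, this unfolds to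
`IsCameronMartinFunction Q h w`. -/
def IsWhiteNoise (R : X →L[ℝ] X) (μ : Measure X) (g : X) (w : X → ℝ) : Prop :=
  Measurable w ∧ ∃ x : ℕ → X, Tendsto (fun n => R (x n)) atTop (𝓝 g) ∧
    Tendsto (fun n => eLpNorm (fun y => w y - ⟪x n, y⟫) 2 μ) atTop (𝓝 0)

variable [BorelSpace X] {R : X →L[ℝ] X} {μ : Measure X} {g g' : X} {w w' : X → ℝ}

theorem measurable_const_inner (x : X) : Measurable fun y : X => ⟪x, y⟫ :=
  (innerSL ℝ x).continuous.measurable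

theorem isWhiteNoise_inner (R : X →L[ℝ] X) (μ : Measure X) (x : X) :
    IsWhiteNoise R μ (R x) fun y => ⟪x, y⟫ :=
  ⟨measurable_const_inner x, fun _ => x, tendsto_const_nhds, by simp⟩

theorem integrable_exp_mul_abs_gaussianReal (c : ℝ) :
    Integrable (fun z => Real.exp (c * |z|)) (gaussianReal 0 1) := by
  refine Integrable.mono' ((integrable_exp_mul_gaussianReal c).add
    (integrable_exp_mul_gaussianReal (-c))) (by fun_prop) (ae_of_all _ fun z => ?_)
  rw [Real.norm_eq_abs, Real.abs_exp]
  rcases abs_cases z with ⟨hz, _⟩ | ⟨hz, _⟩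
  · rw [hz]
    exact le_add_of_nonneg_right (Real.exp_pos _).le
  · rw [hz, show c * -z = -c * z by ring]
    exact le_add_of_nonneg_left (Real.exp_pos _).le

namespace IsWhiteNoise

theorem add (h : IsWhiteNoise R μ g w) (h' : IsWhiteNoise R μ g' w') :
    IsWhiteNoise R μ (g + g') fun y => w y + w' y := by
  obtain ⟨hw, x, hx, hxw⟩ := h
  obtain ⟨hw', x', hx', hxw'⟩ := h'
  refine ⟨hw.add hw', fun n => x n + x' n, by simpa using hx.add hx', ?_⟩
  have h0 := hxw.add hxw'
  rw [add_zero] at h0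
  refine tendsto_of_tendsto_of_tendsto_of_le_of_le tendsto_const_nhds h0
    (fun _ => zero_le) fun n => ?_
  have e : (fun y => w y + w' y - ⟪x n + x' n, y⟫) =
      (fun y => w y - ⟪x n, y⟫) + fun y => w' y - ⟪x' n, y⟫ := by
    funext y; simp only [inner_add_left, Pi.add_apply]; ring
  rw [e]
  exact eLpNorm_add_le (hw.sub (measurable_const_inner _)).aestronglyMeasurable
    (hw'.sub (measurable_const_inner _)).aestronglyMeasurable (by norm_num)

theorem smul (h : IsWhiteNoise R μ g w) (c : ℝ) :
    IsWhiteNoise R μ (c • g) fun y => c * w y := by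
  obtain ⟨hw, x, hx, hxw⟩ := h
  refine ⟨hw.const_mul c, fun n => c • x n, by simpa using hx.const_smul c, ?_⟩
  have e : ∀ n, eLpNorm (fun y => c * w y - ⟪c • x n, y⟫) 2 μ =
      ‖c‖ₑ * eLpNorm (fun y => w y - ⟪x n, y⟫) 2 μ := fun n => by
    rw [← eLpNorm_const_smul]
    congr 1
    funext y
    simp only [real_inner_smul_left, Pi.smul_apply, smul_eq_mul]
    ring
  simp only [e]
  simpa only [mul_zero] using ENNReal.Tendsto.const_mul hxw (Or.inr enorm_ne_top)

theorem sub (h : IsWhiteNoise R μ g w) (h' : IsWhiteNoise R μ g' w') :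
    IsWhiteNoise R μ (g - g') fun y => w y - w' y := by
  have := h.add (h'.smul (-1))
  simpa only [neg_smul, one_smul, neg_mul, one_mul, ← sub_eq_add_neg] using this

theorem integral_cexp (h : IsWhiteNoise R μ g w) (hG : IsGaussianWithRoot R μ) :
    ∫ y, Complex.exp (w y * Complex.I) ∂μ = Complex.exp (-((‖g‖ ^ 2 / 2 : ℝ) : ℂ)) := by
  have := hG.isProbabilityMeasure
  obtain ⟨hw, x, hx, hxw⟩ := h
  have h1 := tendsto_integral_cexp (P := μ) (l := atTop) (a := fun n y => ⟪x n, y⟫) (b := w)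
    (fun n => (measurable_const_inner _).aestronglyMeasurable) hw.aestronglyMeasurable
    (by
      refine hxw.congr fun n => ?_
      rw [← eLpNorm_neg]
      congr 1
      funext y
      simp)
  have h2 : ∀ n, ∫ y, Complex.exp ((⟪x n, y⟫ : ℝ) * Complex.I) ∂μ =
      Complex.exp (-((‖R (x n)‖ ^ 2 / 2 : ℝ) : ℂ)) := fun n => by
    rw [← hG.charFun_eq, charFun_apply]
    simp only [real_inner_comm]
  simp only [h2] at h1
  refine tendsto_nhds_unique h1 ?_
  exact (Complex.continuous_exp.tendsto _).comp
    ((Complex.continuous_ofReal.tendsto _).comp ((hx.norm.pow 2).div_const 2)).neg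

/-- The law of the white noise function of `g` is `N(0, ‖g‖²)`. -/
theorem map_eq (h : IsWhiteNoise R μ g w) (hG : IsGaussianWithRoot R μ) :
    μ.map w = gaussianReal 0 (‖g‖₊ ^ 2) := by
  have := hG.isProbabilityMeasure
  have := Measure.isProbabilityMeasure_map (μ := μ) h.1.aemeasurable
  refine Measure.ext_of_charFun (funext fun t => ?_)
  rw [charFun_gaussianReal, charFun_apply, integral_map h.1.aemeasurable (by fun_prop)]
  have := (h.smul t).integral_cexp hG
  simp only [RCLike.inner_apply, conj_trivial] at this ⊢
  rw [this, norm_smul, mul_pow, Real.norm_eq_abs, sq_abs]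
  congr 1
  push_cast
  ring

theorem map_eq_map_std (h : IsWhiteNoise R μ g w) (hG : IsGaussianWithRoot R μ) :
    μ.map w = (gaussianReal 0 1).map (‖g‖ * ·) := by
  rw [h.map_eq hG, gaussianReal_map_const_mul, mul_zero, mul_one]
  congr 1

theorem lintegral_comp (h : IsWhiteNoise R μ g w) (hG : IsGaussianWithRoot R μ) {F : ℝ → ℝ≥0∞}
    (hF : Measurable F) : ∫⁻ y, F (w y) ∂μ = ∫⁻ z, F (‖g‖ * z) ∂(gaussianReal 0 1) := by
  rw [← lintegral_map hF h.1, h.map_eq_map_std hG, lintegral_map hF (by fun_prop)]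

theorem integral_comp (h : IsWhiteNoise R μ g w) (hG : IsGaussianWithRoot R μ) {F : ℝ → ℝ}
    (hF : Measurable F) : ∫ y, F (w y) ∂μ = ∫ z, F (‖g‖ * z) ∂(gaussianReal 0 1) := by
  rw [← integral_map h.1.aemeasurable hF.aestronglyMeasurable, h.map_eq_map_std hG,
    integral_map (by fun_prop) hF.aestronglyMeasurable]

theorem integrable_comp (h : IsWhiteNoise R μ g w) (hG : IsGaussianWithRoot R μ) {F : ℝ → ℝ}
    (hF : Measurable F) :
    Integrable (fun y => F (w y)) μ ↔ Integrable (fun z => F (‖g‖ * z)) (gaussianReal 0 1) := by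
  have h1 := integrable_map_measure (μ := μ) (f := w) (g := F) hF.aestronglyMeasurable
    h.1.aemeasurable
  have h2 := integrable_map_measure (μ := gaussianReal 0 1) (f := (‖g‖ * ·)) (g := F)
    hF.aestronglyMeasurable (by fun_prop)
  rw [h.map_eq_map_std hG] at h1
  exact h1.symm.trans h2

theorem eLpNorm_eq (h : IsWhiteNoise R μ g w) (hG : IsGaussianWithRoot R μ) (p : ℝ≥0∞) :
    eLpNorm w p μ = ‖g‖ₑ * eLpNorm (fun z : ℝ => z) p (gaussianReal 0 1) := by
  have h1 := eLpNorm_map_measure (μ := μ) (f := w) (g := fun z : ℝ => z) (p := p)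
    (by fun_prop) h.1.aemeasurable
  have h2 := eLpNorm_map_measure (μ := gaussianReal 0 1) (f := (‖g‖ * ·)) (g := fun z : ℝ => z)
    (p := p) (by fun_prop) (by fun_prop)
  rw [h.map_eq_map_std hG, h2] at h1
  rw [show w = (fun z : ℝ => z) ∘ w from rfl, ← h1, ← enorm_norm g, ← eLpNorm_const_smul]
  rfl

theorem memLp (h : IsWhiteNoise R μ g w) (hG : IsGaussianWithRoot R μ) {p : ℝ≥0∞} (hp : p ≠ ∞) :
    MemLp w p μ := by
  refine ⟨h.1.aestronglyMeasurable, ?_⟩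
  rw [h.eLpNorm_eq hG]
  exact ENNReal.mul_lt_top (by simp) (memLp_id_gaussianReal' p hp).eLpNorm_lt_top

/-- The white noise function of `g` is unique up to null sets. -/
theorem ae_eq (h : IsWhiteNoise R μ g w) (h' : IsWhiteNoise R μ g w')
    (hG : IsGaussianWithRoot R μ) : w =ᵐ[μ] w' := by
  have h1 := (h.sub h').eLpNorm_eq hG 2
  rw [sub_self, enorm_zero, zero_mul, eLpNorm_eq_zero_iff (f := fun y => w y - w' y)
    (h.1.sub h'.1).aestronglyMeasurable (by norm_num)] at h1
  filter_upwards [h1] with y hy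
  exact sub_eq_zero.1 hy

theorem ae_eq_zero (h : IsWhiteNoise R μ 0 w) (hG : IsGaussianWithRoot R μ) :
    w =ᵐ[μ] 0 := by
  have := h.smul 0
  rw [smul_zero] at this
  filter_upwards [h.ae_eq this hG] with y hy
  simpa using hy

theorem integrable_exp_mul_abs (h : IsWhiteNoise R μ g w) (hG : IsGaussianWithRoot R μ) (c : ℝ) :
    Integrable (fun y => Real.exp (c * |w y|)) μ := by
  rw [h.integrable_comp hG (F := fun z => Real.exp (c * |z|)) (by fun_prop)]
  simpa only [abs_mul, abs_norm, mul_assoc] using integrable_exp_mul_abs_gaussianReal (c * ‖g‖)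

/-- White noise functions of orthogonal vectors are independent. -/
theorem indepFun (h : IsWhiteNoise R μ g w) (h' : IsWhiteNoise R μ g' w')
    (hG : IsGaussianWithRoot R μ) (ho : ⟪g, g'⟫ = 0) : IndepFun w w' μ := by
  have := hG.isProbabilityMeasure
  rw [indepFun_iff_charFun_prod h.1.aemeasurable h'.1.aemeasurable]
  intro t
  have hm : Measurable fun y => WithLp.toLp 2 (w y, w' y) :=
    (WithLp.measurable_toLp 2 (ℝ × ℝ)).comp (h.1.prodMk h'.1)
  have h1 := ((h.smul t.fst).add (h'.smul t.snd)).integral_cexp hG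
  have h2 := (h.smul t.fst).integral_cexp hG
  have h3 := (h'.smul t.snd).integral_cexp hG
  rw [charFun_apply, charFun_apply, charFun_apply, integral_map hm.aemeasurable (by fun_prop),
    integral_map h.1.aemeasurable (by fun_prop), integral_map h'.1.aemeasurable (by fun_prop)]
  simp only [WithLp.prod_inner_apply, RCLike.inner_apply, conj_trivial]
  simp only [WithLp.fst, WithLp.snd] at h1 h2 h3
  rw [h1, h2, h3, ← Complex.exp_add]
  congr 1
  have : ‖t.ofLp.1 • g + t.ofLp.2 • g'‖ ^ 2 = ‖t.ofLp.1 • g‖ ^ 2 + ‖t.ofLp.2 • g'‖ ^ 2 := by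
    rw [norm_add_sq_real, real_inner_smul_left, real_inner_smul_right, ho]
    ring
  rw [this]
  push_cast
  ring

/-- The joint exponential moment `E[exp (i a + b)]` of two white noise functions. -/
theorem integral_cexp_add (h : IsWhiteNoise R μ g w) (h' : IsWhiteNoise R μ g' w')
    (hG : IsGaussianWithRoot R μ) :
    ∫ y, Complex.exp (w y * Complex.I + w' y) ∂μ =
      Complex.exp (-(‖g‖ ^ 2 / 2 : ℝ) + (⟪g, g'⟫ : ℝ) * Complex.I + (‖g'‖ ^ 2 / 2 : ℝ)) := by
  have := hG.isProbabilityMeasure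
  -- decompose `g' = c g + v` with `v` orthogonal to `g`
  set c : ℝ := ⟪g, g'⟫ / ‖g‖ ^ 2 with hc
  have hcg : c * ‖g‖ ^ 2 = ⟪g, g'⟫ := by
    by_cases h0 : g = 0
    · simp [h0]
    · rw [hc]; field_simp [norm_ne_zero_iff.2 h0]
  have hv := h'.sub (h.smul c)
  have ho : ⟪g, g' - c • g⟫ = 0 := by
    rw [inner_sub_right, real_inner_smul_right, real_inner_self_eq_norm_sq, hcg, sub_self]
  have hind := (h.indepFun hv hG ho).comp
    (φ := fun x : ℝ => Complex.exp ((Complex.I + c) * x)) (ψ := fun x : ℝ => Complex.exp (1 * x))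
    (by fun_prop) (by fun_prop)
  have e := hind.integral_fun_mul_eq_mul_integral
    (Measurable.aestronglyMeasurable ((by fun_prop : Measurable fun x : ℝ =>
      Complex.exp ((Complex.I + c) * x)).comp h.1))
    (Measurable.aestronglyMeasurable ((by fun_prop : Measurable fun x : ℝ =>
      Complex.exp (1 * x)).comp hv.1))
  have e1 := complexMGF_gaussianReal (h.map_eq hG) (Complex.I + c)
  have e2 := complexMGF_gaussianReal (hv.map_eq hG) 1
  rw [complexMGF] at e1 e2
  simp only [Function.comp_apply] at e
  rw [e1, e2, ← Complex.exp_add] at e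
  have hn : ‖g' - c • g‖ ^ 2 = ‖g'‖ ^ 2 - c * ⟪g, g'⟫ := by
    rw [norm_sub_sq_real, real_inner_smul_right, norm_smul, mul_pow, Real.norm_eq_abs, sq_abs,
      real_inner_comm]
    linear_combination c * hcg
  calc _ = ∫ y, Complex.exp ((Complex.I + c) * w y) *
        Complex.exp (1 * ((w' y - c * w y : ℝ) : ℂ)) ∂μ := by
        congr 1
        funext y
        rw [← Complex.exp_add]
        congr 1
        push_cast
        ring
    _ = _ := by
        rw [e]
        congr 1
        have h1 : ((‖g' - c • g‖₊ ^ 2 : NNReal) : ℂ) = ‖g'‖ ^ 2 - c * (⟪g, g'⟫ : ℝ) := by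
          have := congrArg (fun x : ℝ => (x : ℂ)) hn
          push_cast at this ⊢
          exact this
        have h2 : ((c : ℂ)) * (‖g‖ : ℂ) ^ 2 = (⟪g, g'⟫ : ℝ) := by
          have := congrArg (fun x : ℝ => (x : ℂ)) hcg
          push_cast at this
          exact this
        have h3 : ((‖g‖₊ ^ 2 : NNReal) : ℂ) = (‖g‖ : ℂ) ^ 2 := by push_cast; rfl
        rw [h1, h3]
        push_cast
        linear_combination (Complex.I + (c : ℂ) / 2) * h2 + (‖g‖ : ℂ) ^ 2 / 2 * Complex.I_sq

end IsWhiteNoise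

/-- White noise functions exist on the closure of the range of `R`, by completeness of `L²(μ)`:
the norm of `⟪x, ·⟫` in `L²(μ)` is `‖R x‖` up to a constant factor. -/
theorem exists_isWhiteNoise (hG : IsGaussianWithRoot R μ) {x : ℕ → X}
    (hx : Tendsto (fun n => R (x n)) atTop (𝓝 g)) : ∃ w, IsWhiteNoise R μ g w := by
  have hm : ∀ n, MemLp (fun y => ⟪x n, y⟫) 2 μ := fun n =>
    (isWhiteNoise_inner R μ (x n)).memLp hG (by norm_num)
  set K : ℝ≥0∞ := eLpNorm (fun z : ℝ => z) 2 (gaussianReal 0 1)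
  have hK : K ≠ ∞ := (memLp_id_gaussianReal 2).eLpNorm_ne_top
  let f : ℕ → Lp ℝ 2 μ := fun n => (hm n).toLp
  have hd : ∀ m n, dist (f m) (f n) = dist (R (x m)) (R (x n)) * K.toReal := fun m n => by
    rw [dist_eq_norm, ← MemLp.toLp_sub, Lp.norm_toLp]
    have : ((fun y => ⟪x m, y⟫) - fun y => ⟪x n, y⟫) = fun y => ⟪x m - x n, y⟫ := by
      funext y; simp [inner_sub_left]
    rw [this, (isWhiteNoise_inner R μ (x m - x n)).eLpNorm_eq hG 2, ENNReal.toReal_mul,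
      toReal_enorm, map_sub, dist_eq_norm]
  have hc : CauchySeq f := by
    rw [Metric.cauchySeq_iff]
    intro ε hε
    have hpos : 0 < K.toReal + 1 := by positivity
    obtain ⟨N, hN⟩ := Metric.cauchySeq_iff.1 hx.cauchySeq (ε / (K.toReal + 1)) (by positivity)
    refine ⟨N, fun m hm n hn => ?_⟩
    rw [hd]
    calc _ ≤ dist (R (x m)) (R (x n)) * (K.toReal + 1) := by gcongr; linarith
      _ < _ := (lt_div_iff₀ hpos).1 (hN m hm n hn)
  obtain ⟨F, hF⟩ := cauchySeq_tendsto_of_complete hc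
  refine ⟨F, (Lp.stronglyMeasurable F).measurable, x, hx, ?_⟩
  have h1 := tendsto_iff_edist_tendsto_0.1 hF
  refine h1.congr fun n => ?_
  rw [edist_comm, Lp.edist_def]
  refine eLpNorm_congr_ae ?_
  filter_upwards [(hm n).coeFn_toLp] with y hy
  simp only [Pi.sub_apply, f, hy]

theorem measurable_translation (v : X) : Measurable fun y : X => y + v :=
  (continuous_id.add continuous_const).measurable

/-- If `S z = z + c(z) R v` does not charge null sets, then `w ∘ S = w + c ⟪g, v⟫` almost
everywhere. -/
theorem IsWhiteNoise.comp_ae_eq (h : IsWhiteNoise R μ g w) (hG : IsGaussianWithRoot R μ)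
    {S : X → X} (hS : Measure.QuasiMeasurePreserving S μ μ) {c : X → ℝ} {v : X}
    (hSv : ∀ z, S z = z + c z • R v) : ∀ᵐ z ∂μ, w (S z) = w z + c z * ⟪g, v⟫ := by
  obtain ⟨hw, x, hx, hxw⟩ := h
  have h1 : TendstoInMeasure μ (fun n y => ⟪x n, y⟫) atTop w := by
    refine tendstoInMeasure_of_tendsto_eLpNorm_of_stronglyMeasurable (p := 2) (by norm_num)
      (by norm_num) (fun n => ((innerSL ℝ (x n)).continuous).stronglyMeasurable)
      hw.stronglyMeasurable ?_
    refine hxw.congr fun n => ?_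
    rw [← eLpNorm_neg]
    congr 1
    funext y
    simp
  -- along a subsequence `⟪xₙ, ·⟫` converges to `w` at almost every `z` and at almost every `S z`
  obtain ⟨ns, hns, hae⟩ := h1.exists_seq_tendsto_ae
  filter_upwards [hae, hS.ae hae] with z hz hSz
  refine tendsto_nhds_unique hSz ?_
  have h2 : ∀ n, ⟪x (ns n), S z⟫ = ⟪x (ns n), z⟫ + c z * ⟪R (x (ns n)), v⟫ := fun n => by
    rw [hSv, inner_add_right, real_inner_smul_right, hG.isPositive.inner_left_eq_inner_right]
  simp only [h2]
  exact hz.add (((hx.comp hns.tendsto_atTop).inner tendsto_const_nhds).const_mul _)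

variable [CompleteSpace X] [SecondCountableTopology X]

/-- The reflection `z ↦ z - 2 w(z) R g` across the hyperplane orthogonal to a unit vector `g`
preserves the Gaussian measure. -/
theorem measurePreserving_reflection (h : IsWhiteNoise R μ g w) (hG : IsGaussianWithRoot R μ)
    (hg : ‖g‖ = 1) : MeasurePreserving (fun z => z + (-2 * w z) • R g) μ μ := by
  have := hG.isProbabilityMeasure
  have hm : Measurable fun z => z + (-2 * w z) • R g :=
    measurable_id.add ((h.1.const_mul _).smul_const _)
  refine ⟨hm, ?_⟩
  have := Measure.isProbabilityMeasure_map (μ := μ) hm.aemeasurable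
  refine Measure.ext_of_charFun (funext fun ξ => ?_)
  rw [hG.charFun_eq, charFun_apply, integral_map hm.aemeasurable (by fun_prop)]
  have h1 := ((isWhiteNoise_inner R μ ξ).add (h.smul (-2 * ⟪R ξ, g⟫))).integral_cexp hG
  have h2 : ‖R ξ + (-2 * ⟪R ξ, g⟫) • g‖ ^ 2 = ‖R ξ‖ ^ 2 := by
    rw [norm_add_sq_real, real_inner_smul_right, norm_smul, hg, mul_one, Real.norm_eq_abs, sq_abs]
    ring
  rw [h2] at h1
  rw [← h1]
  congr 1
  funext z
  congr 3
  rw [inner_add_left, real_inner_smul_left, real_inner_comm,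
    hG.isPositive.inner_left_eq_inner_right, real_inner_comm (R ξ) g]
  ring

/-- If `y` and `z` are independent with law `μ`, then `(y + z) / √2` has law `μ`. -/
theorem map_rotation (hG : IsGaussianWithRoot R μ) :
    (μ.prod μ).map (fun p : X × X => (Real.sqrt 2)⁻¹ • (p.1 + p.2)) = μ := by
  have := hG.isProbabilityMeasure
  have hm : Measurable fun p : X × X => (Real.sqrt 2)⁻¹ • (p.1 + p.2) := by fun_prop
  have := Measure.isProbabilityMeasure_map (μ := μ.prod μ) hm.aemeasurable
  refine Measure.ext_of_charFun (funext fun ξ => ?_)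
  rw [charFun_map_smul_comp (by fun_prop), charFun_map_add_prod_eq_mul, Pi.mul_apply,
    hG.charFun_eq, hG.charFun_eq, ← Complex.exp_add, map_smul, norm_smul, mul_pow, norm_inv,
    inv_pow, Real.norm_eq_abs, sq_abs, Real.sq_sqrt (by norm_num)]
  congr 1
  push_cast
  ring

/-- The density of the translation of the Gaussian measure by `R g`. -/
noncomputable def cameronMartinDensity (g : X) (w : X → ℝ) (y : X) : ℝ :=
  Real.exp (w y - ‖g‖ ^ 2 / 2)

theorem IsWhiteNoise.measurable_density (h : IsWhiteNoise R μ g w) :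
    Measurable (cameronMartinDensity g w) :=
  (h.1.sub_const _).exp

theorem IsWhiteNoise.integrable_density (h : IsWhiteNoise R μ g w) (hG : IsGaussianWithRoot R μ) :
    Integrable (cameronMartinDensity g w) μ := by
  refine Integrable.mono' (h.integrable_exp_mul_abs hG 1)
    h.measurable_density.aestronglyMeasurable (ae_of_all _ fun y => ?_)
  rw [cameronMartinDensity, Real.norm_eq_abs, Real.abs_exp, Real.exp_le_exp]
  nlinarith [le_abs_self (w y), sq_nonneg ‖g‖]

/-- The Cameron–Martin theorem: the image of `μ` under `y ↦ y + R g` has density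
`exp (w - ‖g‖² / 2)`. -/
theorem IsWhiteNoise.map_add_eq_withDensity (h : IsWhiteNoise R μ g w)
    (hG : IsGaussianWithRoot R μ) : μ.map (fun y => y + R g) =
      μ.withDensity fun y => ENNReal.ofReal (cameronMartinDensity g w y) := by
  have := hG.isProbabilityMeasure
  have hm := measurable_translation (R g)
  have := Measure.isProbabilityMeasure_map (μ := μ) hm.aemeasurable
  have := isFiniteMeasure_withDensity_ofReal (h.integrable_density hG).2
  refine Measure.ext_of_charFun (funext fun ξ => ?_)
  rw [charFun_map_add_const, hG.charFun_eq, charFun_apply,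
    integral_withDensity_eq_integral_toReal_smul h.measurable_density.ennreal_ofReal
      (ae_of_all _ fun _ => ENNReal.ofReal_lt_top)]
  have h1 := (isWhiteNoise_inner R μ ξ).integral_cexp_add h hG
  have h2 : ∀ y, (ENNReal.ofReal (cameronMartinDensity g w y)).toReal •
      Complex.exp ((⟪y, ξ⟫ : ℝ) * Complex.I) = Complex.exp (-(‖g‖ ^ 2 / 2 : ℝ)) *
        Complex.exp ((⟪ξ, y⟫ : ℝ) * Complex.I + w y) := fun y => by
    rw [cameronMartinDensity, ENNReal.toReal_ofReal (Real.exp_pos _).le, Complex.real_smul,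
      Complex.ofReal_exp, ← Complex.exp_add, ← Complex.exp_add, real_inner_comm]
    congr 1
    push_cast
    ring
  simp only [h2]
  rw [integral_const_mul, h1, ← Complex.exp_add, ← Complex.exp_add,
    hG.isPositive.inner_left_eq_inner_right, real_inner_comm (R ξ) g]
  congr 1
  push_cast
  ring

theorem IsWhiteNoise.integral_translate (h : IsWhiteNoise R μ g w) (hG : IsGaussianWithRoot R μ)
    {F : X → ℝ} (hF : Measurable F) :
    ∫ y, F (y + R g) ∂μ = ∫ y, F y * cameronMartinDensity g w y ∂μ := by
  rw [← integral_map (φ := fun y => y + R g) (measurable_translation _).aemeasurable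
    hF.aestronglyMeasurable, h.map_add_eq_withDensity hG,
    integral_withDensity_eq_integral_toReal_smul h.measurable_density.ennreal_ofReal
      (ae_of_all _ fun _ => ENNReal.ofReal_lt_top)]
  congr 1
  funext y
  rw [cameronMartinDensity, ENNReal.toReal_ofReal (Real.exp_pos _).le, smul_eq_mul, mul_comm]

theorem IsWhiteNoise.quasiMeasurePreserving_translate (h : IsWhiteNoise R μ g w)
    (hG : IsGaussianWithRoot R μ) : Measure.QuasiMeasurePreserving (fun y => y + R g) μ μ := by
  refine ⟨measurable_translation _, ?_⟩
  rw [h.map_add_eq_withDensity hG]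
  exact withDensity_absolutelyContinuous _ _

end WhiteNoise

/-! ### Wick polynomials -/

section WickPolynomials

open Classical in
/-- The pairs `p = (a, b)` encoding sets of `j` disjoint pairs `{aᵢ, bᵢ}` in `Fin n`, listed with
`aᵢ < bᵢ` and `a₀ < a₁ < …`. -/
noncomputable def matchings (j n : ℕ) : Finset ((Fin j → Fin n) × (Fin j → Fin n)) :=
  Finset.univ.filter fun p =>
    StrictMono p.1 ∧ (∀ i, p.1 i < p.2 i) ∧ Function.Injective (Sum.elim p.1 p.2)

open Classical in
/-- The indices not covered by the pairs of `p`. -/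
noncomputable def unmatched {j n : ℕ} (p : (Fin j → Fin n) × (Fin j → Fin n)) : Finset (Fin n) :=
  Finset.univ.filter fun m => m ∉ Set.range (Sum.elim p.1 p.2)

theorem mem_matchings {j n : ℕ} {p : (Fin j → Fin n) × (Fin j → Fin n)} :
    p ∈ matchings j n ↔ StrictMono p.1 ∧ (∀ i, p.1 i < p.2 i) ∧
      Function.Injective (Sum.elim p.1 p.2) := by
  simp [matchings]

theorem mem_unmatched {j n : ℕ} {p : (Fin j → Fin n) × (Fin j → Fin n)} {m : Fin n} :
    m ∈ unmatched p ↔ (∀ i, p.1 i ≠ m) ∧ ∀ i, p.2 i ≠ m := by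
  simp [unmatched, not_or]

/-- The Wick polynomial in the variables `w` with covariances `a`. The terms with `j > n / 2` would
vanish. -/
noncomputable def wickPoly (n : ℕ) (a : Fin n → Fin n → ℝ) (w : Fin n → ℝ) : ℝ :=
  ∑ j ∈ Finset.range (n / 2 + 1), (-1 : ℝ) ^ j * ∑ p ∈ matchings j n,
    (∏ i, a (p.1 i) (p.2 i)) * ∏ m ∈ unmatched p, w m

/-- The derivative of the Wick polynomial of degree `n` in the direction `c`, at `w`. -/
noncomputable def wickDeriv (n : ℕ) (a : Fin n → Fin n → ℝ) (w c : Fin n → ℝ) : ℝ :=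
  ∑ j ∈ Finset.range (n / 2 + 1), (-1 : ℝ) ^ j * ∑ p ∈ matchings j n,
    (∏ i, a (p.1 i) (p.2 i)) * ∑ i ∈ unmatched p, (∏ m ∈ (unmatched p).erase i, w m) * c i

theorem matchings_eq_empty {j n : ℕ} (h : n < 2 * j) : matchings j n = ∅ := by
  refine Finset.eq_empty_of_forall_notMem fun p hp => ?_
  have h1 := Fintype.card_le_of_injective _ (mem_matchings.1 hp).2.2
  simp only [Fintype.card_sum, Fintype.card_fin] at h1
  omega

theorem wickPoly_eq_sum_range {n N : ℕ} (hN : n / 2 + 1 ≤ N) (a : Fin n → Fin n → ℝ)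
    (w : Fin n → ℝ) : wickPoly n a w = ∑ j ∈ Finset.range N, (-1 : ℝ) ^ j *
      ∑ p ∈ matchings j n, (∏ i, a (p.1 i) (p.2 i)) * ∏ m ∈ unmatched p, w m := by
  refine Finset.sum_subset (Finset.range_mono hN) fun j _ hj => ?_
  rw [matchings_eq_empty (by rw [Finset.mem_range] at hj; omega), Finset.sum_empty, mul_zero]

theorem wickDeriv_eq_sum_range {n N : ℕ} (hN : n / 2 + 1 ≤ N) (a : Fin n → Fin n → ℝ)
    (w c : Fin n → ℝ) : wickDeriv n a w c = ∑ j ∈ Finset.range N, (-1 : ℝ) ^ j *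
      ∑ p ∈ matchings j n, (∏ i, a (p.1 i) (p.2 i)) *
        ∑ i ∈ unmatched p, (∏ m ∈ (unmatched p).erase i, w m) * c i := by
  refine Finset.sum_subset (Finset.range_mono hN) fun j _ hj => ?_
  rw [matchings_eq_empty (by rw [Finset.mem_range] at hj; omega), Finset.sum_empty, mul_zero]

theorem hasDerivAt_wickPoly (n : ℕ) (a : Fin n → Fin n → ℝ) (w c : Fin n → ℝ) (θ : ℝ) :
    HasDerivAt (fun θ : ℝ => wickPoly n a fun i => w i - θ * c i)
      (-wickDeriv n a (fun i => w i - θ * c i) c) θ := by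
  have h1 : ∀ m, HasDerivAt (fun θ : ℝ => w m - θ * c m) (-c m) θ := fun m => by
    simpa using ((hasDerivAt_id θ).mul_const (c m)).const_sub (w m)
  have h2 : ∀ u : Finset (Fin n), HasDerivAt (fun θ : ℝ => ∏ m ∈ u, (w m - θ * c m))
      (-∑ i ∈ u, (∏ m ∈ u.erase i, (w m - θ * c m)) * c i) θ := fun u => by
    have := HasDerivAt.fun_finsetProd (u := u) fun i _ => h1 i
    simpa [Finset.sum_neg_distrib] using this
  have h3 := HasDerivAt.fun_sum (u := Finset.range (n / 2 + 1)) fun j _ =>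
    (HasDerivAt.fun_sum (u := matchings j n) fun p _ =>
      (h2 (unmatched p)).const_mul (∏ i, a (p.1 i) (p.2 i))).const_mul ((-1 : ℝ) ^ j)
  refine h3.congr_deriv ?_
  simp only [wickDeriv, mul_neg, Finset.sum_neg_distrib]

/-- The number of terms of the Wick polynomial of degree `n`. -/
noncomputable def wickCount (n : ℕ) : ℝ :=
  ∑ j ∈ Finset.range (n / 2 + 1), ((matchings j n).card : ℝ)

theorem wickCount_nonneg (n : ℕ) : 0 ≤ wickCount n :=
  Finset.sum_nonneg fun _ _ => Nat.cast_nonneg _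

/-- Every term of the Wick polynomial contains each index exactly once, so it is bounded by the
product of the `B i`. -/
theorem abs_wickPoly_le {n : ℕ} {a : Fin n → Fin n → ℝ} {w B : Fin n → ℝ}
    (ha : ∀ i k, |a i k| ≤ B i * B k) (hw : ∀ i, |w i| ≤ B i) :
    |wickPoly n a w| ≤ wickCount n * ∏ i, B i := by
  classical
  have hB : ∀ i, 0 ≤ B i := fun i => (abs_nonneg _).trans (hw i)
  rw [wickPoly, wickCount, Finset.sum_mul]
  refine (Finset.abs_sum_le_sum_abs _ _).trans (Finset.sum_le_sum fun j _ => ?_)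
  rw [abs_mul, abs_pow, abs_neg, abs_one, one_pow, one_mul, ← nsmul_eq_mul]
  refine (Finset.abs_sum_le_sum_abs _ _).trans (Finset.sum_le_card_nsmul _ _ _ fun p hp => ?_)
  rw [abs_mul, Finset.abs_prod, Finset.abs_prod]
  have h1 : ∏ i, |a (p.1 i) (p.2 i)| ≤
      ∏ m ∈ Finset.univ.filter (fun m => m ∈ Set.range (Sum.elim p.1 p.2)), B m := by
    have e : Finset.univ.filter (fun m => m ∈ Set.range (Sum.elim p.1 p.2)) =
        Finset.univ.image (Sum.elim p.1 p.2) := by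
      ext m; simp
    rw [e, Finset.prod_image ((mem_matchings.1 hp).2.2.injOn), Fintype.prod_sum_type,
      ← Finset.prod_mul_distrib]
    exact Finset.prod_le_prod (fun _ _ => abs_nonneg _) fun i _ => ha _ _
  have h2 : ∏ m ∈ unmatched p, |w m| ≤ ∏ m ∈ unmatched p, B m :=
    Finset.prod_le_prod (fun _ _ => abs_nonneg _) fun i _ => hw _
  calc _ ≤ (∏ m ∈ Finset.univ.filter (fun m => m ∈ Set.range (Sum.elim p.1 p.2)), B m) *
        ∏ m ∈ unmatched p, B m :=
        mul_le_mul h1 h2 (Finset.prod_nonneg fun _ _ => abs_nonneg _)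
          (Finset.prod_nonneg fun _ _ => hB _)
    _ = _ := by
        rw [unmatched]
        convert Finset.prod_filter_mul_prod_filter_not Finset.univ
          (fun m => m ∈ Set.range (Sum.elim p.1 p.2)) B

/-- The matching of `Fin (n + 1)` obtained from one of `Fin n` by leaving `0` unmatched. -/
def succMatching {j n : ℕ} (p : (Fin j → Fin n) × (Fin j → Fin n)) :
    (Fin j → Fin (n + 1)) × (Fin j → Fin (n + 1)) :=
  (fun i => (p.1 i).succ, fun i => (p.2 i).succ)

/-- The matching of `Fin (n + 1)` obtained from one of `Fin n` by adding the pair `{0, m + 1}`. -/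
def consMatching {j n : ℕ} (p : (Fin j → Fin n) × (Fin j → Fin n)) (m : Fin n) :
    (Fin (j + 1) → Fin (n + 1)) × (Fin (j + 1) → Fin (n + 1)) :=
  (Fin.cons 0 fun i => (p.1 i).succ, Fin.cons m.succ fun i => (p.2 i).succ)

theorem mem_matchings' {j n : ℕ} {p : (Fin j → Fin n) × (Fin j → Fin n)} :
    p ∈ matchings j n ↔ StrictMono p.1 ∧ (∀ i, p.1 i < p.2 i) ∧
      Function.Injective p.2 ∧ ∀ i k, p.1 i ≠ p.2 k := by
  rw [mem_matchings]
  constructor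
  · rintro ⟨h1, h2, h3⟩
    exact ⟨h1, h2, (Sum.elim_injective.1 h3).2.1, (Sum.elim_injective.1 h3).2.2⟩
  · rintro ⟨h1, h2, h3, h4⟩
    exact ⟨h1, h2, Sum.elim_injective.2 ⟨h1.injective, h3, h4⟩⟩

theorem succMatching_mem {j n : ℕ} {p : (Fin j → Fin n) × (Fin j → Fin n)} :
    succMatching p ∈ matchings j (n + 1) ↔ p ∈ matchings j n := by
  simp only [mem_matchings', succMatching, StrictMono, Fin.succ_lt_succ_iff, Function.Injective,
    Fin.succ_inj, ne_eq]

theorem consMatching_mem {j n : ℕ} {p : (Fin j → Fin n) × (Fin j → Fin n)} {m : Fin n}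
    (hp : p ∈ matchings j n) (hm : m ∈ unmatched p) :
    consMatching p m ∈ matchings (j + 1) (n + 1) := by
  rw [mem_matchings'] at hp ⊢
  rw [mem_unmatched] at hm
  obtain ⟨h1, h2, h3, h4⟩ := hp
  refine ⟨?_, ?_, ?_, ?_⟩
  · intro i k
    refine Fin.cases ?_ (fun i => ?_) i <;> refine Fin.cases ?_ (fun k => ?_) k
    · simp
    · simp [consMatching]
    · simp
    · intro h
      simpa [consMatching] using h1 (Fin.succ_lt_succ_iff.1 h)
  · refine Fin.cases ?_ fun i => ?_
    · simp [consMatching]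
    · simpa [consMatching] using h2 i
  · intro i k
    refine Fin.cases ?_ (fun i => ?_) i <;> refine Fin.cases ?_ (fun k => ?_) k
    · simp
    · intro h
      exact absurd (by simpa [consMatching] using h.symm) (hm.2 k)
    · intro h
      exact absurd (by simpa [consMatching] using h) (hm.2 i)
    · intro h
      rw [h3 (by simpa [consMatching] using h : p.2 i = p.2 k)]
  · refine Fin.cases ?_ fun i => ?_
    · refine Fin.cases ?_ fun k => ?_
      · simpa [consMatching] using (Fin.succ_ne_zero m).symm
      · simpa [consMatching] using (Fin.succ_ne_zero _).symm
    · refine Fin.cases ?_ fun k => ?_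
      · simpa [consMatching] using hm.1 i
      · simpa [consMatching] using h4 i k

theorem succMatching_injective {j n : ℕ} :
    Function.Injective (succMatching : (Fin j → Fin n) × (Fin j → Fin n) → _) := by
  intro p q h
  simp only [succMatching, Prod.mk.injEq, funext_iff, Fin.succ_inj] at h
  exact Prod.ext (funext h.1) (funext h.2)

theorem consMatching_injective {j n : ℕ} {p q : (Fin j → Fin n) × (Fin j → Fin n)} {m l : Fin n}
    (h : consMatching p m = consMatching q l) : p = q ∧ m = l := by
  simp only [consMatching, Prod.mk.injEq, Fin.cons_inj, Fin.succ_inj] at h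
  obtain ⟨⟨-, h1⟩, h2, h3⟩ := h
  refine ⟨Prod.ext (funext fun i => ?_) (funext fun i => ?_), h2⟩
  · simpa using congrFun h1 i
  · simpa using congrFun h3 i

theorem exists_succMatching_of_unmatched {j n : ℕ}
    {p : (Fin j → Fin (n + 1)) × (Fin j → Fin (n + 1))} (h : 0 ∈ unmatched p) :
    ∃ q, succMatching q = p := by
  rw [mem_unmatched] at h
  choose a ha using fun i => Fin.exists_succ_eq.2 (h.1 i)
  choose b hb using fun i => Fin.exists_succ_eq.2 (h.2 i)
  exact ⟨(a, b), Prod.ext (funext ha) (funext hb)⟩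

theorem exists_consMatching_of_matched {j n : ℕ}
    {p : (Fin (j + 1) → Fin (n + 1)) × (Fin (j + 1) → Fin (n + 1))}
    (hp : p ∈ matchings (j + 1) (n + 1)) (h : 0 ∉ unmatched p) :
    ∃ q ∈ matchings j n, ∃ m ∈ unmatched q, consMatching q m = p := by
  rw [mem_matchings'] at hp
  obtain ⟨h1, h2, h3, h4⟩ := hp
  have hb0 : ∀ i, p.2 i ≠ 0 := fun i => ((Fin.zero_le _).trans_lt (h2 i)).ne'
  have ha0 : p.1 0 = 0 := by
    rw [mem_unmatched] at h
    by_contra h0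
    refine h ⟨fun i => ?_, hb0⟩
    have h5 : p.1 0 ≤ p.1 i := h1.monotone (Fin.zero_le i)
    exact ((Fin.pos_iff_ne_zero.2 h0).trans_le h5).ne'
  have has : ∀ i : Fin j, p.1 i.succ ≠ 0 := fun i =>
    ((Fin.zero_le _).trans_lt (h1 (Fin.succ_pos i))).ne'
  choose a ha using fun i => Fin.exists_succ_eq.2 (has i)
  choose b hb using fun i : Fin (j + 1) => Fin.exists_succ_eq.2 (hb0 i)
  have e : consMatching (a, fun i => b i.succ) (b 0) = p := by
    refine Prod.ext (funext fun i => ?_) (funext fun i => ?_)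
    · refine Fin.cases ?_ (fun i => ?_) i
      · simp [consMatching, ha0]
      · simp [consMatching, ha]
    · refine Fin.cases ?_ (fun i => ?_) i
      · simp [consMatching, hb]
      · simp [consMatching, hb]
  refine ⟨(a, fun i => b i.succ), ?_, b 0, ?_, e⟩
  · rw [mem_matchings']
    refine ⟨fun i k hik => ?_, fun i => ?_, fun i k hik => ?_, fun i k => ?_⟩
    · rw [← Fin.succ_lt_succ_iff, ha, ha]
      exact h1 (Fin.succ_lt_succ_iff.2 hik)
    · rw [← Fin.succ_lt_succ_iff, ha, hb]
      exact h2 _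
    · have : p.2 i.succ = p.2 k.succ := by rw [← hb, ← hb]; exact congrArg Fin.succ hik
      exact Fin.succ_inj.1 (h3 this)
    · intro hik
      refine h4 i.succ k.succ ?_
      rw [← ha, ← hb]
      exact congrArg Fin.succ hik
  · rw [mem_unmatched]
    refine ⟨fun i hi => h4 i.succ 0 ?_, fun i hi => ?_⟩
    · rw [← ha, ← hb]
      exact congrArg Fin.succ hi
    · have : p.2 i.succ = p.2 0 := by rw [← hb, ← hb]; exact congrArg Fin.succ hi
      exact Fin.succ_ne_zero i (h3 this)

theorem unmatched_succMatching {j n : ℕ} (p : (Fin j → Fin n) × (Fin j → Fin n)) :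
    unmatched (succMatching p) =
      Finset.cons 0 ((unmatched p).map (Fin.succEmb n)) (by simp [Fin.succ_ne_zero]) := by
  ext m
  refine Fin.cases ?_ (fun m => ?_) m
  · simp [mem_unmatched, succMatching, Fin.succ_ne_zero]
  · simp [mem_unmatched, succMatching, Fin.succ_ne_zero]

theorem unmatched_consMatching {j n : ℕ} (p : (Fin j → Fin n) × (Fin j → Fin n)) (l : Fin n) :
    unmatched (consMatching p l) = ((unmatched p).erase l).map (Fin.succEmb n) := by
  ext m
  refine Fin.cases ?_ (fun m => ?_) m
  · simp only [mem_unmatched, consMatching, Finset.mem_map, Fin.coe_succEmb]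
    constructor
    · intro h
      exact absurd (Fin.cons_zero _ _) (h.1 0)
    · rintro ⟨x, -, hx⟩
      exact absurd hx (Fin.succ_ne_zero x)
  · simp only [mem_unmatched, consMatching, Finset.mem_map, Fin.coe_succEmb, Fin.succ_inj,
      exists_eq_right, Finset.mem_erase, Fin.forall_fin_succ, Fin.cons_zero, Fin.cons_succ, ne_eq,
      (Fin.succ_ne_zero m).symm, not_false_eq_true, true_and]
    tauto

/-- The contribution of the matchings that leave `0` unmatched. -/
theorem sum_matchings_succ (j n : ℕ) (a : Fin (n + 1) → Fin (n + 1) → ℝ) (w : Fin (n + 1) → ℝ) :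
    ∑ p ∈ (matchings j (n + 1)).filter (fun p => 0 ∈ unmatched p),
        (∏ i, a (p.1 i) (p.2 i)) * ∏ m ∈ unmatched p, w m =
      w 0 * ∑ p ∈ matchings j n, (∏ i, a (p.1 i).succ (p.2 i).succ) *
        ∏ m ∈ unmatched p, w m.succ := by
  rw [Finset.mul_sum]
  symm
  refine Finset.sum_bij (fun p _ => succMatching p) (fun p hp => ?_)
    (fun p _ q _ h => succMatching_injective h) (fun p hp => ?_) (fun p _ => ?_)
  · rw [Finset.mem_filter, succMatching_mem, unmatched_succMatching]
    exact ⟨hp, by simp⟩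
  · rw [Finset.mem_filter] at hp
    obtain ⟨q, rfl⟩ := exists_succMatching_of_unmatched hp.2
    exact ⟨q, succMatching_mem.1 hp.1, rfl⟩
  · rw [unmatched_succMatching, Finset.prod_cons, Finset.prod_map]
    simp only [succMatching, Fin.coe_succEmb]
    ring

/-- The contribution of the matchings that pair `0` with another index. -/
theorem sum_matchings_cons (j n : ℕ) (a : Fin (n + 1) → Fin (n + 1) → ℝ) (w : Fin (n + 1) → ℝ) :
    ∑ p ∈ (matchings (j + 1) (n + 1)).filter (fun p => ¬ 0 ∈ unmatched p),
        (∏ i, a (p.1 i) (p.2 i)) * ∏ m ∈ unmatched p, w m =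
      ∑ p ∈ matchings j n, (∏ i, a (p.1 i).succ (p.2 i).succ) *
        ∑ i ∈ unmatched p, (∏ m ∈ (unmatched p).erase i, w m.succ) * a 0 i.succ := by
  simp only [Finset.mul_sum]
  rw [Finset.sum_sigma']
  symm
  refine Finset.sum_bij (fun x _ => consMatching x.1 x.2) (fun x hx => ?_)
    (fun x _ y _ h => ?_) (fun p hp => ?_) (fun x _ => ?_)
  · rw [Finset.mem_sigma] at hx
    rw [Finset.mem_filter, unmatched_consMatching]
    exact ⟨consMatching_mem hx.1 hx.2, by simp [Fin.succ_ne_zero]⟩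
  · obtain ⟨h1, h2⟩ := consMatching_injective h
    exact Sigma.ext h1 (heq_of_eq h2)
  · rw [Finset.mem_filter] at hp
    obtain ⟨q, hq, m, hm, rfl⟩ := exists_consMatching_of_matched hp.1 hp.2
    exact ⟨⟨q, m⟩, Finset.mem_sigma.2 ⟨hq, hm⟩, rfl⟩
  · rw [unmatched_consMatching, Finset.prod_map, Fin.prod_univ_succ]
    simp only [consMatching, Fin.coe_succEmb, Fin.cons_zero, Fin.cons_succ]
    ring

/-- The recursion for Wick polynomials: in a matching of `Fin (n + 1)`, either the index `0` is
unmatched, or it is paired with some `i + 1`, where `i` is unmatched in the matching of the other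
indices. -/
theorem wickPoly_succ (n : ℕ) (a : Fin (n + 1) → Fin (n + 1) → ℝ) (w : Fin (n + 1) → ℝ) :
    wickPoly (n + 1) a w = w 0 * wickPoly n (fun i k => a i.succ k.succ) (fun i => w i.succ) -
      wickDeriv n (fun i k => a i.succ k.succ) (fun i => w i.succ) fun i => a 0 i.succ := by
  rw [wickPoly_eq_sum_range (N := n + 3) (by omega), wickPoly_eq_sum_range (N := n + 3) (by omega),
    wickDeriv_eq_sum_range (N := n + 2) (by omega)]
  have h0 : ∀ j, ∑ p ∈ matchings j (n + 1), (∏ i, a (p.1 i) (p.2 i)) * ∏ m ∈ unmatched p, w m =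
      (w 0 * ∑ p ∈ matchings j n, (∏ i, a (p.1 i).succ (p.2 i).succ) *
        ∏ m ∈ unmatched p, w m.succ) +
      ∑ p ∈ (matchings j (n + 1)).filter (fun p => ¬ 0 ∈ unmatched p),
        (∏ i, a (p.1 i) (p.2 i)) * ∏ m ∈ unmatched p, w m := fun j => by
    rw [← sum_matchings_succ, Finset.sum_filter_add_sum_filter_not]
  simp only [h0, mul_add, Finset.sum_add_distrib]
  rw [sub_eq_add_neg]
  congr 1
  · rw [Finset.mul_sum]
    refine Finset.sum_congr rfl fun j _ => ?_
    ring
  · rw [Finset.sum_range_succ' _ (n + 2)]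
    simp only [sum_matchings_cons, pow_succ]
    have : (matchings 0 (n + 1)).filter (fun p => ¬ 0 ∈ unmatched p) = ∅ := by
      refine Finset.filter_eq_empty_iff.2 fun p _ => ?_
      rw [not_not, mem_unmatched]
      exact ⟨fun i => i.elim0, fun i => i.elim0⟩
    rw [this, Finset.sum_empty, mul_zero, add_zero, ← Finset.sum_neg_distrib]
    refine Finset.sum_congr rfl fun j _ => ?_
    ring

theorem wickPoly_zero (a : Fin 0 → Fin 0 → ℝ) (w : Fin 0 → ℝ) : wickPoly 0 a w = 1 := by
  have h : matchings 0 0 = {(Fin.elim0, Fin.elim0)} := by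
    refine Finset.eq_singleton_iff_unique_mem.2 ⟨?_, fun p _ => ?_⟩
    · rw [mem_matchings']
      exact ⟨fun i => i.elim0, fun i => i.elim0, fun i => i.elim0, fun i => i.elim0⟩
    · exact Prod.ext (funext fun i => i.elim0) (funext fun i => i.elim0)
  simp [wickPoly, h, Finset.eq_empty_of_isEmpty (unmatched _)]

end WickPolynomials

/-! ### Wick products of white noise functions -/

section WickIntegrals

open ProbabilityTheory

theorem continuous_wickPoly {n : ℕ} (a : Fin n → Fin n → ℝ) : Continuous (wickPoly n a) := by
  unfold wickPoly
  fun_prop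

/-- The moment `E (1 + |Z|)^{2n}` of a standard Gaussian variable `Z`. -/
noncomputable def gaussianMoment (n : ℕ) : ℝ≥0∞ :=
  ∫⁻ z, ENNReal.ofReal (|z| + 1) ^ (2 * n) ∂(gaussianReal 0 1)

theorem gaussianMoment_ne_top (n : ℕ) : gaussianMoment n ≠ ∞ := by
  have h := (integrable_exp_mul_abs_gaussianReal (2 * n)).lintegral_lt_top
  refine (lt_of_le_of_lt (lintegral_mono fun z => ?_) h).ne
  rw [← ENNReal.ofReal_pow (by positivity)]
  refine ENNReal.ofReal_le_ofReal ?_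
  have : Real.exp (2 * n * |z|) = Real.exp |z| ^ (2 * n) := by
    rw [← Real.exp_nat_mul]; push_cast; rfl
  rw [this]
  exact pow_le_pow_left₀ (by positivity) (Real.add_one_le_exp _) _

/-- A bound for the `L²` norm of the Wick polynomial of degree `n` of normalized white noises. -/
noncomputable def wickConst (n : ℕ) : ℝ :=
  wickCount n * Real.sqrt (gaussianMoment n).toReal

theorem wickConst_nonneg (n : ℕ) : 0 ≤ wickConst n :=
  mul_nonneg (wickCount_nonneg n) (Real.sqrt_nonneg _)

variable {X : Type u} [NormedAddCommGroup X] [InnerProductSpace ℝ X]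

/-- The Wick product of white noise functions `W i` of the vectors `g i`. -/
noncomputable def wickProduct (n : ℕ) (g : Fin n → X) (W : Fin n → X → ℝ) (y : X) : ℝ :=
  wickPoly n (fun i k => ⟪g i, g k⟫) fun i => W i y

variable [MeasurableSpace X] [BorelSpace X] {R : X →L[ℝ] X} {μ : Measure X}

theorem measurable_wickProduct {n : ℕ} {g : Fin n → X} {W : Fin n → X → ℝ}
    (hW : ∀ i, IsWhiteNoise R μ (g i) (W i)) : Measurable (wickProduct n g W) :=
  (continuous_wickPoly _).measurable.comp (measurable_pi_lambda _ fun i => (hW i).1)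

/-- By Hölder's inequality with `n` exponents `n`; each factor has the law of `‖gᵢ‖ (|Z| + 1)` for a
standard Gaussian variable `Z`. -/
theorem lintegral_prod_sq_le {n : ℕ} {g : Fin n → X} {W : Fin n → X → ℝ}
    (hW : ∀ i, IsWhiteNoise R μ (g i) (W i)) (hG : IsGaussianWithRoot R μ) :
    ∫⁻ y, (∏ i, ENNReal.ofReal (|W i y| + ‖g i‖)) ^ 2 ∂μ ≤
      (∏ i, ‖g i‖ₑ) ^ 2 * gaussianMoment n := by
  have := hG.isProbabilityMeasure
  rcases Nat.eq_zero_or_pos n with rfl | hn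
  · simp [gaussianMoment]
  have hn' : (n : ℝ) ≠ 0 := by positivity
  have h1 : ∀ i, ∫⁻ y, ENNReal.ofReal (|W i y| + ‖g i‖) ^ (2 * n) ∂μ =
      ‖g i‖ₑ ^ (2 * n) * gaussianMoment n := fun i => by
    rw [(hW i).lintegral_comp hG (F := fun x => ENNReal.ofReal (|x| + ‖g i‖) ^ (2 * n))
      (by fun_prop), gaussianMoment, ← lintegral_const_mul _ (by fun_prop)]
    refine lintegral_congr fun z => ?_
    rw [← mul_pow, ← ofReal_norm, ← ENNReal.ofReal_mul (norm_nonneg _), abs_mul, abs_norm,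
      mul_add, mul_one]
  have h2 : ∀ y, (∏ i, ENNReal.ofReal (|W i y| + ‖g i‖)) ^ 2 =
      ∏ i, (ENNReal.ofReal (|W i y| + ‖g i‖) ^ (2 * n)) ^ (1 / n : ℝ) := fun y => by
    rw [← Finset.prod_pow]
    refine Finset.prod_congr rfl fun i _ => ?_
    rw [pow_mul, ← ENNReal.rpow_natCast (_ ^ 2), ← ENNReal.rpow_mul, mul_one_div_cancel hn',
      ENNReal.rpow_one]
  simp only [h2]
  refine (ENNReal.lintegral_prod_norm_pow_le Finset.univ (fun i _ => ?_) ?_ ?_).trans ?_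
  · exact ((((hW i).1.abs).add_const _).ennreal_ofReal.pow_const _).aemeasurable
  · simp [hn']
  · intro i _; positivity
  · simp only [h1]
    refine le_of_eq ?_
    have h3 : ∀ i, (‖g i‖ₑ ^ (2 * n) * gaussianMoment n) ^ (1 / n : ℝ) =
        ‖g i‖ₑ ^ 2 * gaussianMoment n ^ (1 / n : ℝ) := fun i => by
      rw [ENNReal.mul_rpow_of_nonneg _ _ (by positivity), pow_mul,
        ← ENNReal.rpow_natCast (_ ^ 2), ← ENNReal.rpow_mul, mul_one_div_cancel hn',
        ENNReal.rpow_one]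
    simp only [h3]
    rw [Finset.prod_mul_distrib, Finset.prod_pow, Finset.prod_const, Finset.card_univ,
      Fintype.card_fin, ← ENNReal.rpow_natCast (_ ^ (1 / n : ℝ)), ← ENNReal.rpow_mul,
      one_div_mul_cancel hn', ENNReal.rpow_one]

theorem eLpNorm_wickProduct_le {n : ℕ} {g : Fin n → X} {W : Fin n → X → ℝ}
    (hW : ∀ i, IsWhiteNoise R μ (g i) (W i)) (hG : IsGaussianWithRoot R μ) :
    eLpNorm (wickProduct n g W) 2 μ ≤ ENNReal.ofReal (wickConst n * ∏ i, ‖g i‖) := by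
  have h1 : eLpNorm (wickProduct n g W) 2 μ ≤
      ENNReal.ofReal (wickCount n) * eLpNorm (fun y => ∏ i, (|W i y| + ‖g i‖)) 2 μ := by
    refine eLpNorm_le_mul_eLpNorm_of_ae_le_mul (ae_of_all _ fun y => ?_) 2
    have hB : 0 ≤ ∏ i, (|W i y| + ‖g i‖) := Finset.prod_nonneg fun i _ => by positivity
    rw [Real.norm_eq_abs, Real.norm_eq_abs, abs_of_nonneg hB]
    refine abs_wickPoly_le (B := fun i => |W i y| + ‖g i‖) (fun i k => ?_) fun i =>
      le_add_of_nonneg_right (norm_nonneg _)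
    refine (abs_real_inner_le_norm _ _).trans (mul_le_mul ?_ ?_ (norm_nonneg _) (by positivity))
    · exact le_add_of_nonneg_left (abs_nonneg _)
    · exact le_add_of_nonneg_left (abs_nonneg _)
  refine h1.trans ?_
  have h2 : eLpNorm (fun y => ∏ i, (|W i y| + ‖g i‖)) 2 μ ≤
      ENNReal.ofReal (Real.sqrt (gaussianMoment n).toReal * ∏ i, ‖g i‖) := by
    rw [eLpNorm_eq_lintegral_rpow_enorm_toReal (by norm_num) (by norm_num)]
    have e : ∀ y, ‖∏ i, (|W i y| + ‖g i‖)‖ₑ ^ (2 : ℝ≥0∞).toReal =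
        (∏ i, ENNReal.ofReal (|W i y| + ‖g i‖)) ^ 2 := fun y => by
      rw [ENNReal.toReal_ofNat, ENNReal.rpow_ofNat, ← ENNReal.ofReal_prod_of_nonneg
        (fun i _ => by positivity), Real.enorm_of_nonneg
        (Finset.prod_nonneg fun i _ => by positivity)]
    simp only [e]
    refine (ENNReal.rpow_le_rpow (lintegral_prod_sq_le hW hG) (by positivity)).trans ?_
    have e2 : (∏ i, ‖g i‖ₑ) ^ 2 * gaussianMoment n =
        ENNReal.ofReal (Real.sqrt (gaussianMoment n).toReal * ∏ i, ‖g i‖) ^ 2 := by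
      rw [ENNReal.ofReal_mul (Real.sqrt_nonneg _), mul_pow,
        ← ENNReal.ofReal_pow (Real.sqrt_nonneg _), Real.sq_sqrt ENNReal.toReal_nonneg,
        ENNReal.ofReal_toReal (gaussianMoment_ne_top n), mul_comm,
        ENNReal.ofReal_prod_of_nonneg (fun i _ => norm_nonneg _)]
      simp only [ofReal_norm]
    rw [e2, ENNReal.toReal_ofNat, ← ENNReal.rpow_ofNat, ← ENNReal.rpow_mul]
    norm_num
  refine (mul_le_mul_right h2 _).trans (le_of_eq ?_)
  rw [← ENNReal.ofReal_mul (wickCount_nonneg n), wickConst, mul_assoc]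

theorem memLp_wickProduct {n : ℕ} {g : Fin n → X} {W : Fin n → X → ℝ}
    (hW : ∀ i, IsWhiteNoise R μ (g i) (W i)) (hG : IsGaussianWithRoot R μ) :
    MemLp (wickProduct n g W) 2 μ :=
  ⟨(measurable_wickProduct hW).aestronglyMeasurable,
    (eLpNorm_wickProduct_le hW hG).trans_lt ENNReal.ofReal_lt_top⟩

/-- Hölder's inequality for the pairing of an `L²` function with a Wick product. -/
theorem enorm_integral_mul_wickProduct_le {n : ℕ} {g : Fin n → X} {W : Fin n → X → ℝ}
    (hW : ∀ i, IsWhiteNoise R μ (g i) (W i)) (hG : IsGaussianWithRoot R μ) {F : X → ℝ}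
    (hF : AEStronglyMeasurable F μ) :
    ‖∫ y, F y * wickProduct n g W y ∂μ‖ₑ ≤
      eLpNorm F 2 μ * ENNReal.ofReal (wickConst n * ∏ i, ‖g i‖) := by
  calc _ ≤ ∫⁻ y, ‖F y * wickProduct n g W y‖ₑ ∂μ := enorm_integral_le_lintegral_enorm _
    _ = eLpNorm (F • wickProduct n g W) 1 μ := by
        rw [eLpNorm_one_eq_lintegral_enorm]; rfl
    _ ≤ eLpNorm F 2 μ * eLpNorm (wickProduct n g W) 2 μ :=
        eLpNorm_smul_le_mul_eLpNorm (measurable_wickProduct hW).aestronglyMeasurable hF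
    _ ≤ _ := by gcongr; exact eLpNorm_wickProduct_le hW hG

theorem abs_integral_mul_wickProduct_le {n : ℕ} {g : Fin n → X} {W : Fin n → X → ℝ}
    (hW : ∀ i, IsWhiteNoise R μ (g i) (W i)) (hG : IsGaussianWithRoot R μ) {F : X → ℝ}
    (hF : AEStronglyMeasurable F μ) {K : ℝ} (hK : 0 ≤ K) (hb : eLpNorm F 2 μ ≤ ENNReal.ofReal K) :
    |∫ y, F y * wickProduct n g W y ∂μ| ≤ K * (wickConst n * ∏ i, ‖g i‖) := by
  have hp : 0 ≤ wickConst n * ∏ i, ‖g i‖ :=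
    mul_nonneg (wickConst_nonneg n) (Finset.prod_nonneg fun i _ => norm_nonneg _)
  have h := (enorm_integral_mul_wickProduct_le hW hG hF).trans (mul_le_mul_left hb _)
  rw [← ENNReal.ofReal_mul hK, ← ofReal_norm, ENNReal.ofReal_le_ofReal_iff (by positivity)] at h
  exact h

theorem eLpNorm_two_le_of_bound (hG : IsGaussianWithRoot R μ) {F : X → ℝ} {K : ℝ}
    (hb : ∀ y, |F y| ≤ K) : eLpNorm F 2 μ ≤ ENNReal.ofReal K := by
  have := hG.isProbabilityMeasure
  have := eLpNorm_le_of_ae_bound (p := 2) (μ := μ) (f := F) (C := K) (ae_of_all _ hb)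
  simpa using this

theorem integrable_mul_wickProduct {n : ℕ} {g : Fin n → X} {W : Fin n → X → ℝ}
    (hW : ∀ i, IsWhiteNoise R μ (g i) (W i)) (hG : IsGaussianWithRoot R μ) {F : X → ℝ}
    (hF : AEStronglyMeasurable F μ) {K : ℝ} (hb : ∀ y, |F y| ≤ K) :
    Integrable (fun y => F y * wickProduct n g W y) μ := by
  have := hG.isProbabilityMeasure
  exact ((memLp_wickProduct hW hG).integrable (by norm_num)).bdd_mul hF (ae_of_all _ hb)

theorem integrable_exp_sum_abs {m : ℕ} (hm : 0 < m) {g : Fin m → X} {W : Fin m → X → ℝ}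
    (hW : ∀ i, IsWhiteNoise R μ (g i) (W i)) (hG : IsGaussianWithRoot R μ) (c : ℝ) :
    Integrable (fun y => Real.exp (c * ∑ i, |W i y|)) μ := by
  have hm0 : (m : ℝ≥0∞) ≠ 0 := by exact_mod_cast hm.ne'
  have h1 : ∀ i ∈ (Finset.univ : Finset (Fin m)),
      MemLp (fun y => Real.exp (c * |W i y|)) (m : ℝ≥0∞) μ := fun i _ => by
    rw [← integrable_norm_rpow_iff
      (((hW i).1.abs.const_mul c).exp).aestronglyMeasurable hm0 (by simp)]
    refine ((hW i).integrable_exp_mul_abs hG (m * c)).congr (ae_of_all _ fun y => ?_)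
    simp only [ENNReal.toReal_natCast, Real.rpow_natCast, Real.norm_eq_abs, Real.abs_exp]
    rw [← Real.exp_nat_mul, mul_assoc]
  have h2 := MemLp.prod' h1
  rw [Finset.sum_const, Finset.card_univ, Fintype.card_fin, nsmul_eq_mul,
    ENNReal.mul_inv_cancel hm0 (by simp), inv_one, memLp_one_iff_integrable] at h2
  refine h2.congr (ae_of_all _ fun y => ?_)
  simp only [← Real.exp_sum, Finset.mul_sum]

variable [CompleteSpace X] [SecondCountableTopology X]

/-- Integration by parts: translating a bounded measurable `ψ` in the direction `R (g 0)` raises the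
degree of the Wick product. By the Cameron–Martin theorem the translation can be moved to the Wick
product and the density, which are smooth in the parameter. -/
theorem hasDerivAt_integral_mul_wickProduct {n : ℕ} {g : Fin (n + 1) → X} {W : Fin (n + 1) → X → ℝ}
    (hW : ∀ i, IsWhiteNoise R μ (g i) (W i)) (hG : IsGaussianWithRoot R μ) {ψ : X → ℝ}
    (hψ : Measurable ψ) {K : ℝ} (hK : ∀ y, |ψ y| ≤ K) :
    HasDerivAt (fun θ : ℝ => ∫ y, ψ (y + θ • R (g 0)) *
        wickProduct n (fun i => g i.succ) (fun i => W i.succ) y ∂μ)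
      (∫ y, ψ y * wickProduct (n + 1) g W y ∂μ) 0 := by
  have := hG.isProbabilityMeasure
  set a : Fin (n + 1) → Fin (n + 1) → ℝ := fun i k => ⟪g i, g k⟫ with ha
  set a' : Fin n → Fin n → ℝ := fun i k => a i.succ k.succ with ha'
  set c : Fin n → ℝ := fun i => a 0 i.succ with hc
  let ρ : ℝ → X → ℝ := fun θ y => Real.exp (θ * W 0 y - θ ^ 2 * (‖g 0‖ ^ 2 / 2))
  let F : ℝ → X → ℝ := fun θ y => ψ y * wickPoly n a' (fun i => W i.succ y - θ * c i) * ρ θ y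
  let F' : ℝ → X → ℝ := fun θ y => ψ y * wickPoly (n + 1) a (fun i => W i y - θ * a 0 i) * ρ θ y
  have hwm : ∀ θ : ℝ, Measurable fun y => wickPoly n a' (fun i => W i.succ y - θ * c i) :=
    fun θ => (continuous_wickPoly a').measurable.comp
      (measurable_pi_lambda _ fun i => (hW i.succ).1.sub_const _)
  have hρm : ∀ θ, Measurable (ρ θ) := fun θ => (((hW 0).1.const_mul θ).sub_const _).exp
  have hFm : ∀ θ, Measurable (F θ) := fun θ => (hψ.mul (hwm θ)).mul (hρm θ)
  have hF'm : ∀ θ, Measurable (F' θ) := fun θ =>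
    (hψ.mul ((continuous_wickPoly a).measurable.comp
      (measurable_pi_lambda _ fun i => (hW i).1.sub_const _))).mul (hρm θ)
  -- the translated integral in terms of the density
  have hint : ∀ θ : ℝ, ∫ y, ψ (y + θ • R (g 0)) *
      wickProduct n (fun i => g i.succ) (fun i => W i.succ) y ∂μ = ∫ y, F θ y ∂μ := by
    intro θ
    have h0 := (hW 0).smul θ
    have h1 := h0.integral_translate hG (hψ.mul (hwm θ))
    simp only [map_smul, Pi.mul_apply] at h1
    have h2 : ∀ y, cameronMartinDensity (θ • g 0) (fun y => θ * W 0 y) y = ρ θ y := fun y => by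
      simp only [cameronMartinDensity, ρ, norm_smul, mul_pow, Real.norm_eq_abs, sq_abs]
      congr 1
      ring
    simp only [h2] at h1
    rw [← h1]
    refine integral_congr_ae ?_
    have h3 : ∀ᵐ y ∂μ, ∀ i : Fin n, W i.succ (y + θ • R (g 0)) = W i.succ y + θ * c i := by
      rw [ae_all_iff]
      intro i
      have h4 := (hW i.succ).comp_ae_eq hG (h0.quasiMeasurePreserving_translate hG)
        (c := fun _ => θ) (v := g 0) (fun z => by rw [map_smul])
      simp only [map_smul] at h4
      filter_upwards [h4] with y hy
      rw [hy, hc, ha, real_inner_comm]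
    filter_upwards [h3] with y hy
    simp only [hy, add_sub_cancel_right]
    rfl
  simp only [hint]
  -- a bound for the derivative that does not depend on the parameter
  set L : ℝ := 1 + ∑ k, (‖g k‖ + |a 0 k|) with hL
  have hLk : ∀ k, ‖g k‖ + |a 0 k| ≤ L - 1 := fun k => by
    rw [hL, add_sub_cancel_left]
    exact Finset.single_le_sum (f := fun k => ‖g k‖ + |a 0 k|)
      (fun k _ => by positivity) (Finset.mem_univ k)
  have hL1 : 1 ≤ L := by
    rw [hL]; exact le_add_of_nonneg_right (Finset.sum_nonneg fun k _ => by positivity)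
  have hK0 : 0 ≤ K := (abs_nonneg _).trans (hK 0)
  have hbound : ∀ y, ∀ θ ∈ Metric.ball (0 : ℝ) 1, ‖F' θ y‖ ≤
      K * (wickCount (n + 1) * L ^ (n + 1)) * Real.exp (2 * ∑ i, |W i y|) := by
    intro y θ hθ
    have hθ1 : |θ| ≤ 1 := by simpa using (Metric.mem_ball.1 hθ).le
    have h1 : |wickPoly (n + 1) a (fun i => W i y - θ * a 0 i)| ≤
        wickCount (n + 1) * ∏ i, (|W i y| + L) := by
      refine abs_wickPoly_le (B := fun i => |W i y| + L) (fun i k => ?_) fun i => ?_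
      · refine (abs_real_inner_le_norm _ _).trans
          (mul_le_mul ?_ ?_ (norm_nonneg _) (by positivity))
        · linarith [hLk i, abs_nonneg (a 0 i), abs_nonneg (W i y)]
        · linarith [hLk k, abs_nonneg (a 0 k), abs_nonneg (W k y)]
      · refine (abs_sub _ _).trans ?_
        rw [abs_mul]
        nlinarith [hLk i, norm_nonneg (g i), abs_nonneg (a 0 i)]
    have h2 : ∏ i, (|W i y| + L) ≤ L ^ (n + 1) * Real.exp (∑ i, |W i y|) := by
      rw [Real.exp_sum]
      calc ∏ i, (|W i y| + L) ≤ ∏ i, (L * Real.exp |W i y|) := by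
            refine Finset.prod_le_prod (fun i _ => by positivity) fun i _ => ?_
            nlinarith [Real.add_one_le_exp |W i y|, abs_nonneg (W i y)]
        _ = _ := by simp [Finset.prod_mul_distrib]
    have h3 : ρ θ y ≤ Real.exp (∑ i, |W i y|) := by
      refine Real.exp_le_exp.2 ?_
      have h4 : |W 0 y| ≤ ∑ i, |W i y| :=
        Finset.single_le_sum (f := fun i => |W i y|) (fun i _ => abs_nonneg _) (Finset.mem_univ 0)
      have h5 : θ * W 0 y ≤ |W 0 y| := by
        refine (le_abs_self _).trans ?_
        rw [abs_mul]
        nlinarith [abs_nonneg (W 0 y)]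
      have h6 : 0 ≤ θ ^ 2 * (‖g 0‖ ^ 2 / 2) := by positivity
      linarith
    have h7 : 0 ≤ wickCount (n + 1) := wickCount_nonneg _
    rw [Real.norm_eq_abs, abs_mul, abs_mul, abs_of_pos (Real.exp_pos _)]
    calc |ψ y| * |wickPoly (n + 1) a (fun i => W i y - θ * a 0 i)| * ρ θ y
        ≤ K * (wickCount (n + 1) * (L ^ (n + 1) * Real.exp (∑ i, |W i y|))) *
          Real.exp (∑ i, |W i y|) := by
          refine mul_le_mul (mul_le_mul (hK y)
            (h1.trans (mul_le_mul_of_nonneg_left h2 h7)) (abs_nonneg _) hK0) h3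
            (Real.exp_pos _).le (by positivity)
      _ = _ := by rw [two_mul, Real.exp_add]; ring
  have hderiv : ∀ y, ∀ θ ∈ Metric.ball (0 : ℝ) 1, HasDerivAt (fun θ => F θ y) (F' θ y) θ := by
    intro y θ _
    have h1 := (hasDerivAt_wickPoly n a' (fun i => W i.succ y) c θ).const_mul (ψ y)
    have h2 : HasDerivAt (fun θ => ρ θ y) (ρ θ y * (W 0 y - θ * ‖g 0‖ ^ 2)) θ := by
      have h3 : HasDerivAt (fun θ : ℝ => θ * W 0 y - θ ^ 2 * (‖g 0‖ ^ 2 / 2))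
          (W 0 y - θ * ‖g 0‖ ^ 2) θ := by
        refine (((hasDerivAt_id θ).mul_const (W 0 y)).sub
          ((hasDerivAt_pow 2 θ).mul_const _)).congr_deriv ?_
        simp only [Nat.cast_ofNat, one_mul]
        ring
      exact h3.exp
    refine (h1.mul h2).congr_deriv ?_
    simp only [F']
    rw [wickPoly_succ n a]
    have h4 : a 0 0 = ‖g 0‖ ^ 2 := real_inner_self_eq_norm_sq _
    rw [h4]
    ring
  have hdom := hasDerivAt_integral_of_dominated_loc_of_deriv_le (μ := μ) (F := F) (F' := F')
    (x₀ := (0 : ℝ)) (bound := fun y => K * (wickCount (n + 1) * L ^ (n + 1)) *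
      Real.exp (2 * ∑ i, |W i y|)) (Metric.ball_mem_nhds 0 one_pos)
    (Eventually.of_forall fun θ => (hFm θ).aestronglyMeasurable) ?_
    (hF'm 0).aestronglyMeasurable (ae_of_all _ hbound)
    ((integrable_exp_sum_abs n.succ_pos hW hG 2).const_mul _) (ae_of_all _ hderiv)
  · refine hdom.2.congr_deriv (integral_congr_ae (ae_of_all _ fun y => ?_))
    simp [F', ρ, wickProduct, ha]
  · refine (integrable_mul_wickProduct (fun i : Fin n => hW i.succ) hG
      hψ.aestronglyMeasurable hK).congr (ae_of_all _ fun y => ?_)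
    simp [F, ρ, wickProduct, ha', ha]

end WickIntegrals

/-! ### Differentiation along `E` -/

section DirectionalCalculus

variable {X : Type u} [NormedAddCommGroup X] [NormedSpace ℝ X]
variable {E : Type v} [NormedAddCommGroup E] [NormedSpace ℝ E]
variable {G : Type*} [NormedAddCommGroup G] [NormedSpace ℝ G]
variable {ι : E →L[ℝ] X}

theorem EDifferentiableAt.hasDerivAt_line {F : X → G} {x : X} {h : E} {θ : ℝ}
    (hF : EDifferentiableAt ι F (x + θ • ι h)) :
    HasDerivAt (fun s : ℝ => F (x + s • ι h)) (eDeriv ι F (x + θ • ι h) h) θ := by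
  have h1 : HasFDerivAt (fun e : E => F (x + θ • ι h + ι e)) (eDeriv ι F (x + θ • ι h)) 0 :=
    hF.hasFDerivAt
  have h2 : HasDerivAt (fun s : ℝ => (s - θ) • h) h θ := by
    simpa using ((hasDerivAt_id θ).sub_const θ).smul_const h
  have h3 : HasFDerivAt (fun e : E => F (x + θ • ι h + ι e)) (eDeriv ι F (x + θ • ι h))
      ((θ - θ) • h) := by simpa using h1
  have h4 := h3.comp_hasDerivAt θ h2
  refine h4.congr_of_eventuallyEq (Eventually.of_forall fun s => ?_)
  simp only [Function.comp_apply, map_smul]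
  congr 1
  module

theorem eDerivIter_succ_apply (f : X → ℝ) (j : ℕ) (x : X) (h0 : E) (h : Fin j → E) :
    eDerivIter ι f (j + 1) x (Fin.cons h0 h : Fin (j + 1) → E) =
      eDeriv ι (eDerivIter ι f j) x h0 h := by
  change (eDeriv ι (eDerivIter ι f j) x).uncurryLeft (Fin.cons h0 h : Fin (j + 1) → E) = _
  rw [ContinuousLinearMap.uncurryLeft_apply, Fin.cons_zero, Fin.tail_cons]

theorem norm_eDerivIter_succ (f : X → ℝ) (j : ℕ) (x : X) :
    ‖eDerivIter ι f (j + 1) x‖ = ‖eDeriv ι (eDerivIter ι f j) x‖ :=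
  ContinuousLinearMap.uncurryLeft_norm _

/-- The mean value inequality along `E`. -/
theorem norm_eDerivIter_add_sub_le {f : X → ℝ} {j : ℕ} {K : ℝ}
    (hd : ∀ x, EDifferentiableAt ι (eDerivIter ι f j) x)
    (hK : ∀ x, ‖eDerivIter ι f (j + 1) x‖ ≤ K) (x : X) (h : E) :
    ‖eDerivIter ι f j (x + ι h) - eDerivIter ι f j x‖ ≤ K * ‖h‖ := by
  have h1 := norm_image_sub_le_of_norm_deriv_le_segment_01'
    (f := fun s : ℝ => eDerivIter ι f j (x + s • ι h)) (C := K * ‖h‖)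
    (fun s _ => (hd (x + s • ι h)).hasDerivAt_line.hasDerivWithinAt) (fun s _ => by
      refine (ContinuousLinearMap.le_opNorm _ _).trans ?_
      rw [← norm_eDerivIter_succ]
      exact mul_le_mul_of_nonneg_right (hK _) (norm_nonneg _))
  simpa using h1

theorem MemCk.mono {f : X → ℝ} {k m : ℕ} (hf : MemCk ι k f) (h : m ≤ k) : MemCk ι m f :=
  ⟨hf.continuous, hf.bounded, fun j hj => hf.differentiable j (hj.trans_le h),
    fun j hj => hf.continuous_deriv j (hj.trans h), fun j hj => hf.bounded_deriv j (hj.trans h)⟩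

theorem norm_eDerivIter_zero (f : X → ℝ) (x : X) : ‖eDerivIter ι f 0 x‖ = ‖f x‖ :=
  ContinuousMultilinearMap.norm_constOfIsEmpty ..

theorem memCk_zero {f : X → ℝ} (hc : Continuous f) (hb : ∃ K : ℝ, ∀ x, ‖f x‖ ≤ K) :
    MemCk ι 0 f := by
  refine ⟨hc, hb, fun j hj => absurd hj (Nat.not_lt_zero j), fun j hj => ?_, fun j hj => ?_⟩
  · obtain rfl : j = 0 := Nat.le_zero.1 hj
    have : LipschitzWith 1 fun c : ℝ =>
        ContinuousMultilinearMap.constOfIsEmpty ℝ (fun _ : Fin 0 => E) c := by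
      refine LipschitzWith.of_dist_le_mul fun a b => ?_
      have e : ContinuousMultilinearMap.constOfIsEmpty ℝ (fun _ : Fin 0 => E) a -
          ContinuousMultilinearMap.constOfIsEmpty ℝ (fun _ : Fin 0 => E) b =
          ContinuousMultilinearMap.constOfIsEmpty ℝ (fun _ : Fin 0 => E) (a - b) := rfl
      rw [dist_eq_norm, e, ContinuousMultilinearMap.norm_constOfIsEmpty, NNReal.coe_one, one_mul,
        dist_eq_norm]
    exact this.continuous.comp hc
  · obtain rfl : j = 0 := Nat.le_zero.1 hj
    simpa only [norm_eDerivIter_zero] using hb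

/-- A function whose derivative of order `m` has derivatives along lines that are bounded, and
continuous in operator norm, is Fréchet differentiable of order `m + 1` along `E`. Multilinearity of
the derivative in the last `m` arguments is inherited from the derivative of order `m`. -/
theorem MemCk.succ_of_line_deriv {f : X → ℝ} {m : ℕ} {F : X → (Fin m → E) → ℝ}
    {F' : X → (Fin (m + 1) → E) → ℝ} (hf : MemCk ι m f)
    (hF : ∀ x h, eDerivIter ι f m x h = F x h)
    (hder : ∀ x h0 h, HasDerivAt (fun θ : ℝ => F (x + θ • ι h0) h) (F' x (Fin.cons h0 h)) 0)
    (hadd : ∀ x h0 h0' h, F' x (Fin.cons (h0 + h0') h) =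
      F' x (Fin.cons h0 h) + F' x (Fin.cons h0' h))
    (hbd : ∃ K : ℝ, 0 ≤ K ∧ ∀ x h, |F' x h| ≤ K * ∏ i, ‖h i‖)
    (hcont : ∀ x, ∃ δ : X → ℝ, Tendsto δ (𝓝 x) (𝓝 0) ∧ (∀ x', 0 ≤ δ x') ∧
      ∀ x' h, |F' x' h - F' x h| ≤ δ x' * ∏ i, ‖h i‖) :
    MemCk ι (m + 1) f ∧ ∀ x h, eDerivIter ι f (m + 1) x h = F' x h := by
  obtain ⟨K, hK0, hK⟩ := hbd
  -- homogeneity in the first argument, by reparametrizing the line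
  have hsmul : ∀ x (c : ℝ) h0 h, F' x (Fin.cons (c • h0) h) = c * F' x (Fin.cons h0 h) := by
    intro x c h0 h
    have h1 : HasDerivAt (fun θ : ℝ => F (x + θ • ι h0) h) (F' x (Fin.cons h0 h)) (0 * c) := by
      simpa using hder x h0 h
    have h2 := h1.comp (0 : ℝ) ((hasDerivAt_id (0 : ℝ)).mul_const c)
    have h3 := hder x (c • h0) h
    simp only [map_smul, smul_smul] at h3
    rw [h3.unique h2, one_mul, mul_comm]
  -- the candidate for the derivative; derivatives of multilinear maps are multilinear
  have hml : ∀ x h0, ∃ S : ContinuousMultilinearMap ℝ (fun _ : Fin m => E) ℝ,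
      (∀ h, S h = F' x (Fin.cons h0 h)) ∧ ‖S‖ ≤ K * ‖h0‖ := by
    intro x h0
    let S : MultilinearMap ℝ (fun _ : Fin m => E) ℝ :=
      { toFun := fun h => F' x (Fin.cons h0 h)
        map_update_add' := fun {dec} h i u v => by
          have h1 := hder x h0 (Function.update h i (u + v))
          have h2 := (hder x h0 (Function.update h i u)).add (hder x h0 (Function.update h i v))
          refine h1.unique (h2.congr_of_eventuallyEq (Eventually.of_forall fun θ => ?_))
          simp only [Pi.add_apply, ← hF]
          exact (eDerivIter ι f m (x + θ • ι h0)).map_update_add h i u v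
        map_update_smul' := fun {dec} h i c u => by
          have h1 := hder x h0 (Function.update h i (c • u))
          have h2 := (hder x h0 (Function.update h i u)).const_mul c
          refine h1.unique (h2.congr_of_eventuallyEq (Eventually.of_forall fun θ => ?_))
          simp only [← hF]
          exact (eDerivIter ι f m (x + θ • ι h0)).map_update_smul h i c u }
    have hS : ∀ h, ‖S h‖ ≤ K * ‖h0‖ * ∏ i, ‖h i‖ := fun h => by
      have := hK x (Fin.cons h0 h)
      rw [Fin.prod_univ_succ] at this
      simp only [Fin.cons_zero, Fin.cons_succ, ← mul_assoc] at this
      exact this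
    exact ⟨S.mkContinuous _ hS, fun h => rfl, S.mkContinuous_norm_le (by positivity) hS⟩
  choose S hS hSn using hml
  have hT : ∀ x, ∃ T : E →L[ℝ] ContinuousMultilinearMap ℝ (fun _ : Fin m => E) ℝ,
      ∀ h0, T h0 = S x h0 := fun x =>
    ⟨LinearMap.mkContinuous
      { toFun := S x
        map_add' := fun a b => by
          ext h
          simp only [add_apply, hS, hadd]
        map_smul' := fun c a => by
          ext h
          simp only [smul_apply, hS, hsmul, smul_eq_mul,
            RingHom.id_apply] } K (hSn x), fun h0 => rfl⟩
  choose T hT using hT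
  have hTF : ∀ x h0 h, T x h0 h = F' x (Fin.cons h0 h) := fun x h0 h => by rw [hT, hS]
  have hTFsub : ∀ x x' h0 (h : Fin m → E), F' x' (Fin.cons h0 h) - F' x (Fin.cons h0 h) =
      (T x' - T x) h0 h := fun x x' h0 h => by
    rw [sub_apply, sub_apply, hTF, hTF]
  have hTle : ∀ x, ‖T x‖ ≤ K := fun x =>
    ContinuousLinearMap.opNorm_le_bound _ hK0 fun h0 => by rw [hT]; exact hSn x h0
  have hTsub : ∀ x x' (d : ℝ), 0 ≤ d → (∀ h, |F' x' h - F' x h| ≤ d * ∏ i, ‖h i‖) →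
      ‖T x' - T x‖ ≤ d := by
    intro x x' d hd h
    refine ContinuousLinearMap.opNorm_le_bound _ hd fun h0 =>
      ContinuousMultilinearMap.opNorm_le_bound (by positivity) fun e => ?_
    have := h (Fin.cons h0 e)
    rw [Fin.prod_univ_succ] at this
    simp only [Fin.cons_zero, Fin.cons_succ, ← mul_assoc] at this
    rw [sub_apply, sub_apply, hTF, hTF]
    exact this
  have hTc : Continuous T := by
    refine continuous_iff_continuousAt.2 fun x => ?_
    obtain ⟨δ, hδ, hδ0, hδF⟩ := hcont x
    refine (tendsto_iff_norm_sub_tendsto_zero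
      (E := E →L[ℝ] ContinuousMultilinearMap ℝ (fun _ : Fin m => E) ℝ)).2 ?_
    exact squeeze_zero (fun _ => ContinuousLinearMap.opNorm_nonneg _)
      (fun x' => hTsub x x' _ (hδ0 x') (hδF x')) hδ
  -- derivatives along lines at all parameters
  have hline : ∀ x h0 h (θ : ℝ), HasDerivAt (fun s : ℝ => F (x + s • ι h0) h)
      (F' (x + θ • ι h0) (Fin.cons h0 h)) θ := by
    intro x h0 h θ
    have h1 : HasDerivAt (fun s : ℝ => F (x + θ • ι h0 + s • ι h0) h)
        (F' (x + θ • ι h0) (Fin.cons h0 h)) (θ - θ) := by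
      rw [sub_self]; exact hder _ _ _
    refine (h1.comp_sub_const θ θ).congr_of_eventuallyEq (Eventually.of_forall fun s => ?_)
    simp only
    congr 1
    module
  -- on a ball where `T` varies by at most `ε`, the mean value inequality along the segment from `x`
  -- to `x + ι h0` bounds the remainder by `ε ‖h0‖`
  have hfd : ∀ x, HasFDerivAt (fun h : E => eDerivIter ι f m (x + ι h)) (T x) 0 := by
    intro x
    rw [hasFDerivAt_iff_isLittleO, Asymptotics.isLittleO_iff]
    intro ε hε
    obtain ⟨δ, hδ, hδ0, hδF⟩ := hcont x
    obtain ⟨η, hη, hηT⟩ := Metric.eventually_nhds_iff.1 (hδ.eventually_le_const hε)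
    have hnear : ∀ᶠ h in 𝓝 (0 : E), ‖ι h‖ < η := by
      have : Tendsto (fun h : E => ‖ι h‖) (𝓝 0) (𝓝 0) := by
        have := ι.continuous.norm.tendsto (0 : E)
        simpa using this
      exact this.eventually_lt_const hη
    filter_upwards [hnear] with h0 hh0
    rw [sub_zero, map_zero, add_zero]
    refine ContinuousMultilinearMap.opNorm_le_bound (by positivity) fun h => ?_
    have h1 := norm_image_sub_le_of_norm_deriv_le_segment_01'
      (f := fun s : ℝ => F (x + s • ι h0) h - s * F' x (Fin.cons h0 h))
      (C := ε * ‖h0‖ * ∏ i, ‖h i‖)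
      (fun s _ => ((hline x h0 h s).sub
        ((hasDerivAt_id s).mul_const (F' x (Fin.cons h0 h)))).hasDerivWithinAt)
      (fun s hs => by
        rw [one_mul, hTFsub]
        refine ContinuousMultilinearMap.le_of_opNorm_le
          (ContinuousLinearMap.le_of_opNorm_le _ ?_ h0) h
        have h2 : dist (x + s • ι h0) x < η := by
          rw [dist_eq_norm, add_sub_cancel_left, norm_smul, Real.norm_of_nonneg hs.1]
          have := hs.2.le
          nlinarith [norm_nonneg (ι h0), hs.1]
        exact (hTsub x _ _ (hδ0 _) (hδF _)).trans (hηT h2))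
    simp only [sub_apply, hF, hTF]
    have h3 : F (x + ι h0) h - F x h - F' x (Fin.cons h0 h) =
        F (x + (1 : ℝ) • ι h0) h - 1 * F' x (Fin.cons h0 h) -
          (F (x + (0 : ℝ) • ι h0) h - 0 * F' x (Fin.cons h0 h)) := by
      rw [one_smul, zero_smul, add_zero]; ring
    rw [h3]
    exact h1
  have hed : ∀ x, eDeriv ι (eDerivIter ι f m) x = T x := fun x => (hfd x).fderiv
  have hval : ∀ x h, eDerivIter ι f (m + 1) x h = F' x h := fun x h => by
    rw [← Fin.cons_self_tail h, eDerivIter_succ_apply, hed, hTF]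
  refine ⟨⟨hf.continuous, hf.bounded, fun j hj x => ?_, fun j hj => ?_, fun j hj => ?_⟩, hval⟩
  · rcases Nat.lt_succ_iff_lt_or_eq.1 hj with hj | rfl
    · exact hf.differentiable j hj x
    · exact (hfd x).differentiableAt
  · rcases Nat.le_succ_iff.1 hj with hj | rfl
    · exact hf.continuous_deriv j hj
    · have : eDerivIter ι f (m + 1) = fun x => (T x).uncurryLeft := by
        funext x
        ext h
        rw [hval, ContinuousLinearMap.uncurryLeft_apply, hTF, Fin.cons_self_tail]
      rw [this]
      exact (continuousMultilinearCurryLeftEquiv ℝ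
        (fun _ : Fin (m + 1) => E) ℝ).symm.continuous.comp hTc
  · rcases Nat.le_succ_iff.1 hj with hj | rfl
    · exact hf.bounded_deriv j hj
    · refine ⟨K, fun x => ?_⟩
      rw [norm_eDerivIter_succ, hed]
      exact hTle x

end DirectionalCalculus

/-! ### Derivatives of Gaussian smoothings -/

section Smoothing

variable {X : Type u} [NormedAddCommGroup X] [InnerProductSpace ℝ X] [CompleteSpace X]
  [SecondCountableTopology X] [MeasurableSpace X] [BorelSpace X]
variable {E : Type v} [NormedAddCommGroup E] [NormedSpace ℝ E]

/-- The data of a Gaussian smoothing operator `φ ↦ ∫ φ (V x + b + y) μ(dy)`: the operator `V` acts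
on `E` as `UE`, it maps `E` into the Cameron–Martin space `R X` of `μ` with `R ∘ Lam = V` on `E`, and
`W h` is a version of the white noise function of `Lam h`. -/
structure IsGaussianSmoothing (ι : E →L[ℝ] X) (R V : X →L[ℝ] X) (μ : Measure X) (UE : E →L[ℝ] E)
    (Lam : E →L[ℝ] X) (W : E → X → ℝ) : Prop where
  gaussian : IsGaussianWithRoot R μ
  map_incl : ∀ h, V (ι h) = ι (UE h)
  root_apply : ∀ h, R (Lam h) = ι (UE h)
  whiteNoise : ∀ h, IsWhiteNoise R μ (Lam h) (W h)

/-- The pairing of an `L^j(E)`-valued function, evaluated at the images `UE (e i)`, with a Wick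
product of degree `q`. -/
noncomputable def wickPairing (V : X →L[ℝ] X) (b : X) (μ : Measure X) (UE : E →L[ℝ] E)
    (Lam : E →L[ℝ] X) (W : E → X → ℝ) {j : ℕ}
    (H : X → ContinuousMultilinearMap ℝ (fun _ : Fin j => E) ℝ) {q : ℕ} (x : X)
    (e : Fin j → E) (h : Fin q → E) : ℝ :=
  ∫ y, H (V x + b + y) (fun i => UE (e i)) *
    wickProduct q (fun i => Lam (h i)) (fun i => W (h i)) y ∂μ

variable {ι : E →L[ℝ] X} {R V : X →L[ℝ] X} {μ : Measure X} {UE : E →L[ℝ] E} {Lam : E →L[ℝ] X}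
  {W : E → X → ℝ}

theorem prod_norm_apply_le {F : Type*} [NormedAddCommGroup F] [NormedSpace ℝ F] {j : ℕ}
    (A : E →L[ℝ] F) (e : Fin j → E) : ∏ i, ‖A (e i)‖ ≤ ‖A‖ ^ j * ∏ i, ‖e i‖ := by
  calc ∏ i, ‖A (e i)‖ ≤ ∏ i, (‖A‖ * ‖e i‖) :=
        Finset.prod_le_prod (fun _ _ => norm_nonneg _) fun i _ => A.le_opNorm _
    _ = _ := by simp [Finset.prod_mul_distrib]

theorem prod_norm_split {m j q : ℕ} (hm : m = j + q) (h : Fin m → E) :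
    (∏ i : Fin j, ‖h ⟨i, by omega⟩‖) * ∏ i : Fin q, ‖h ⟨j + i, by omega⟩‖ = ∏ i, ‖h i‖ := by
  subst hm
  rw [Fin.prod_univ_add]
  rfl

theorem continuous_translate (V : X →L[ℝ] X) (b : X) (x : X) : Continuous fun y => V x + b + y :=
  continuous_const.add continuous_id

theorem continuous_apply_multilinear {j : ℕ}
    {H : X → ContinuousMultilinearMap ℝ (fun _ : Fin j => E) ℝ} (hH : Continuous H)
    (e : Fin j → E) : Continuous fun x => H x e :=
  (ContinuousMultilinearMap.apply ℝ (fun _ : Fin j => E) ℝ e).continuous.comp hH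

theorem abs_wickPairing_le (hS : IsGaussianSmoothing ι R V μ UE Lam W) (b : X) {j : ℕ}
    {H : X → ContinuousMultilinearMap ℝ (fun _ : Fin j => E) ℝ} (hH : Continuous H) {K : ℝ}
    (hK0 : 0 ≤ K) (hK : ∀ x, ‖H x‖ ≤ K) {q : ℕ} (x : X) (e : Fin j → E) (h : Fin q → E) :
    |wickPairing V b μ UE Lam W H x e h| ≤
      K * ‖UE‖ ^ j * (wickConst q * ‖Lam‖ ^ q) * ((∏ i, ‖e i‖) * ∏ i, ‖h i‖) := by
  have h0 : ∀ y, |H (V x + b + y) fun i => UE (e i)| ≤ K * (‖UE‖ ^ j * ∏ i, ‖e i‖) := fun y =>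
    ((H (V x + b + y)).le_of_opNorm_le (hK _) _).trans
      (mul_le_mul_of_nonneg_left (prod_norm_apply_le UE e) hK0)
  have h1 : 0 ≤ ∏ i, ‖e i‖ := Finset.prod_nonneg fun _ _ => norm_nonneg _
  have h2 := abs_integral_mul_wickProduct_le (fun i => hS.whiteNoise (h i)) hS.gaussian
    (F := fun y => H (V x + b + y) fun i => UE (e i))
    ((continuous_apply_multilinear hH _).comp
      (continuous_translate V b x)).aestronglyMeasurable
    (K := K * (‖UE‖ ^ j * ∏ i, ‖e i‖)) (by positivity) (eLpNorm_two_le_of_bound hS.gaussian h0)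
  refine h2.trans ?_
  calc _ ≤ K * (‖UE‖ ^ j * ∏ i, ‖e i‖) * (wickConst q * (‖Lam‖ ^ q * ∏ i, ‖h i‖)) := by
        refine mul_le_mul_of_nonneg_left (mul_le_mul_of_nonneg_left (prod_norm_apply_le Lam h)
          (wickConst_nonneg q)) (by positivity)
    _ = _ := by ring

/-- The modulus of continuity of `x ↦ H (V x + b + ·)` as a map into `L²(μ)`. -/
noncomputable def shiftModulus (V : X →L[ℝ] X) (b : X) (μ : Measure X) {j : ℕ}
    (H : X → ContinuousMultilinearMap ℝ (fun _ : Fin j => E) ℝ) (x x' : X) : ℝ :=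
  Real.sqrt (∫ y, ‖H (V x' + b + y) - H (V x + b + y)‖ ^ 2 ∂μ)

theorem tendsto_shiftModulus [IsProbabilityMeasure μ] (b : X) {j : ℕ}
    {H : X → ContinuousMultilinearMap ℝ (fun _ : Fin j => E) ℝ} (hH : Continuous H) {K : ℝ}
    (hK : ∀ x, ‖H x‖ ≤ K) (x : X) :
    Tendsto (shiftModulus V b μ H x) (𝓝 x) (𝓝 0) := by
  have hc : ∀ x' : X, Continuous fun y => ‖H (V x' + b + y) - H (V x + b + y)‖ ^ 2 := fun x' =>
    ((hH.comp (continuous_translate V b x')).sub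
      (hH.comp (continuous_translate V b x))).norm.pow 2
  have h1 : Tendsto (fun x' => ∫ y, ‖H (V x' + b + y) - H (V x + b + y)‖ ^ 2 ∂μ) (𝓝 x)
      (𝓝 (∫ _, (0 : ℝ) ∂μ)) := by
    refine tendsto_integral_filter_of_dominated_convergence (fun _ => (2 * K) ^ 2)
      (Eventually.of_forall fun x' => (hc x').aestronglyMeasurable)
      (Eventually.of_forall fun x' => ae_of_all _ fun y => ?_) (integrable_const _)
      (ae_of_all _ fun y => ?_)
    · rw [Real.norm_of_nonneg (by positivity)]
      refine pow_le_pow_left₀ (norm_nonneg _) ((norm_sub_le _ _).trans ?_) 2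
      linarith [hK (V x' + b + y), hK (V x + b + y)]
    · have h2 : Continuous fun x' : X => ‖H (V x' + b + y) - H (V x + b + y)‖ ^ 2 :=
        ((hH.comp (by fun_prop)).sub continuous_const).norm.pow 2
      simpa using h2.tendsto x
  rw [integral_zero] at h1
  have h3 := (Real.continuous_sqrt.tendsto 0).comp h1
  rw [Real.sqrt_zero] at h3
  exact h3

theorem eLpNorm_shift_le [IsProbabilityMeasure μ] (b : X) {j : ℕ}
    {H : X → ContinuousMultilinearMap ℝ (fun _ : Fin j => E) ℝ} (hH : Continuous H) {K : ℝ}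
    (hK : ∀ x, ‖H x‖ ≤ K) (x x' : X) :
    eLpNorm (fun y => ‖H (V x' + b + y) - H (V x + b + y)‖) 2 μ ≤
      ENNReal.ofReal (shiftModulus V b μ H x x') := by
  have hc : Continuous fun y => ‖H (V x' + b + y) - H (V x + b + y)‖ :=
    ((hH.comp (continuous_translate V b x')).sub
      (hH.comp (continuous_translate V b x))).norm
  have hm : MemLp (fun y => ‖H (V x' + b + y) - H (V x + b + y)‖) 2 μ := by
    refine MemLp.of_bound hc.aestronglyMeasurable (2 * K) (ae_of_all _ fun y => ?_)
    rw [norm_norm]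
    refine (norm_sub_le _ _).trans ?_
    linarith [hK (V x' + b + y), hK (V x + b + y)]
  have h1 := hm.eLpNorm_eq_integral_rpow_norm (by norm_num) (by norm_num)
  rw [h1]
  refine ENNReal.ofReal_le_ofReal (le_of_eq ?_)
  rw [shiftModulus, Real.sqrt_eq_rpow]
  simp

theorem abs_wickPairing_sub_le (hS : IsGaussianSmoothing ι R V μ UE Lam W) (b : X) {j : ℕ}
    {H : X → ContinuousMultilinearMap ℝ (fun _ : Fin j => E) ℝ} (hH : Continuous H) {K : ℝ}
    (hK : ∀ x, ‖H x‖ ≤ K) {q : ℕ} (x x' : X) (e : Fin j → E) (h : Fin q → E) :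
    |wickPairing V b μ UE Lam W H x' e h - wickPairing V b μ UE Lam W H x e h| ≤
      shiftModulus V b μ H x x' * (‖UE‖ ^ j * (wickConst q * ‖Lam‖ ^ q)) *
        ((∏ i, ‖e i‖) * ∏ i, ‖h i‖) := by
  have := hS.gaussian.isProbabilityMeasure
  have h1 : 0 ≤ ∏ i, ‖e i‖ := Finset.prod_nonneg fun _ _ => norm_nonneg _
  have hd : 0 ≤ shiftModulus V b μ H x x' := Real.sqrt_nonneg _
  have hc : ∀ x, Continuous fun y => H (V x + b + y) fun i => UE (e i) := fun x =>
    (continuous_apply_multilinear hH _).comp (continuous_translate V b x)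
  have hb : ∀ x y, |H (V x + b + y) fun i => UE (e i)| ≤ K * ∏ i, ‖UE (e i)‖ := fun x y =>
    (H (V x + b + y)).le_of_opNorm_le (hK _) _
  have hi : ∀ x, Integrable (fun y => H (V x + b + y) (fun i => UE (e i)) *
      wickProduct q (fun i => Lam (h i)) (fun i => W (h i)) y) μ := fun x =>
    integrable_mul_wickProduct (fun i => hS.whiteNoise (h i)) hS.gaussian
      (hc x).aestronglyMeasurable (hb x)
  rw [wickPairing, wickPairing, ← integral_sub (hi x') (hi x)]
  simp only [← sub_mul]
  have h2 := abs_integral_mul_wickProduct_le (fun i => hS.whiteNoise (h i)) hS.gaussian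
    (F := fun y => H (V x' + b + y) (fun i => UE (e i)) - H (V x + b + y) fun i => UE (e i))
    ((hc x').sub (hc x)).aestronglyMeasurable
    (K := shiftModulus V b μ H x x' * (‖UE‖ ^ j * ∏ i, ‖e i‖)) (by positivity) ?_
  · refine h2.trans ?_
    calc _ ≤ shiftModulus V b μ H x x' * (‖UE‖ ^ j * ∏ i, ‖e i‖) *
          (wickConst q * (‖Lam‖ ^ q * ∏ i, ‖h i‖)) := by
          refine mul_le_mul_of_nonneg_left (mul_le_mul_of_nonneg_left (prod_norm_apply_le Lam h)
            (wickConst_nonneg q)) (by positivity)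
      _ = _ := by ring
  · rw [mul_comm, ENNReal.ofReal_mul (by positivity)]
    refine (eLpNorm_le_mul_eLpNorm_of_ae_le_mul (c := ‖UE‖ ^ j * ∏ i, ‖e i‖)
      (g := fun y => ‖H (V x' + b + y) - H (V x + b + y)‖) (ae_of_all _ fun y => ?_) 2).trans
      (mul_le_mul_right (eLpNorm_shift_le b hH hK x x') _)
    rw [← sub_apply, norm_norm, mul_comm]
    exact ((H (V x' + b + y) - H (V x + b + y)).le_opNorm _).trans
      (mul_le_mul_of_nonneg_left (prod_norm_apply_le UE e) (norm_nonneg _))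

theorem integrable_wickPairing (hS : IsGaussianSmoothing ι R V μ UE Lam W) (b : X) {j : ℕ}
    {H : X → ContinuousMultilinearMap ℝ (fun _ : Fin j => E) ℝ} (hH : Continuous H) {K : ℝ}
    (hK : ∀ x, ‖H x‖ ≤ K) {q : ℕ} (x : X) (e : Fin j → E) (h : Fin q → E) :
    Integrable (fun y => H (V x + b + y) (fun i => UE (e i)) *
      wickProduct q (fun i => Lam (h i)) (fun i => W (h i)) y) μ :=
  integrable_mul_wickProduct (fun i => hS.whiteNoise (h i)) hS.gaussian
    ((continuous_apply_multilinear hH _).comp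
      (continuous_translate V b x)).aestronglyMeasurable
    fun y => (H (V x + b + y)).le_of_opNorm_le (hK _) _

theorem wickDeriv_add (n : ℕ) (a : Fin n → Fin n → ℝ) (w c c' : Fin n → ℝ) :
    (wickDeriv n a w fun i => c i + c' i) = wickDeriv n a w c + wickDeriv n a w c' := by
  simp only [wickDeriv, mul_add, Finset.sum_add_distrib]

/-- The Wick product is additive in its first argument, almost everywhere. -/
theorem wickProduct_cons_add (hS : IsGaussianSmoothing ι R V μ UE Lam W) {q : ℕ} (h0 h0' : E)
    (h : Fin q → E) : ∀ᵐ y ∂μ,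
      wickProduct (q + 1) (fun i => Lam ((Fin.cons (h0 + h0') h : Fin (q + 1) → E) i))
        (fun i => W ((Fin.cons (h0 + h0') h : Fin (q + 1) → E) i)) y =
      wickProduct (q + 1) (fun i => Lam ((Fin.cons h0 h : Fin (q + 1) → E) i))
        (fun i => W ((Fin.cons h0 h : Fin (q + 1) → E) i)) y +
      wickProduct (q + 1) (fun i => Lam ((Fin.cons h0' h : Fin (q + 1) → E) i))
        (fun i => W ((Fin.cons h0' h : Fin (q + 1) → E) i)) y := by
  have h1 := (hS.whiteNoise h0).add (hS.whiteNoise h0')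
  rw [← map_add] at h1
  filter_upwards [(hS.whiteNoise (h0 + h0')).ae_eq h1 hS.gaussian] with y hy
  simp only [wickProduct, wickPoly_succ, Fin.cons_zero, Fin.cons_succ, hy, map_add,
    inner_add_left, wickDeriv_add]
  ring

/-- Moving `x` by `θ h` amounts to translating the noise by `θ UE h`. -/
theorem smoothing_shift (hS : IsGaussianSmoothing ι R V μ UE Lam W) (b x : X) (θ : ℝ) (h : E)
    (y : X) : V (x + θ • ι h) + b + y = V x + b + y + θ • ι (UE h) := by
  rw [map_add, map_smul, hS.map_incl]
  abel

/-- Moving the function `φ` in the direction `h0` raises the degree of the Wick product. -/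
theorem hasDerivAt_smoothing_wick (hS : IsGaussianSmoothing ι R V μ UE Lam W) (b : X) {φ : X → ℝ}
    (hφ : Measurable φ) {K : ℝ} (hK : ∀ x, |φ x| ≤ K) {q : ℕ} (x : X) (h0 : E) (h : Fin q → E) :
    HasDerivAt (fun θ : ℝ => ∫ y, φ (V (x + θ • ι h0) + b + y) *
        wickProduct q (fun i => Lam (h i)) (fun i => W (h i)) y ∂μ)
      (∫ y, φ (V x + b + y) * wickProduct (q + 1)
        (fun i => Lam ((Fin.cons h0 h : Fin (q + 1) → E) i))
        (fun i => W ((Fin.cons h0 h : Fin (q + 1) → E) i)) y ∂μ) 0 := by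
  have h1 := hasDerivAt_integral_mul_wickProduct
    (fun i => hS.whiteNoise ((Fin.cons h0 h : Fin (q + 1) → E) i)) hS.gaussian
    (ψ := fun y => φ (V x + b + y)) (hφ.comp (continuous_translate V b x).measurable)
    (fun y => hK _)
  simp only [Fin.cons_zero, Fin.cons_succ, hS.root_apply] at h1
  refine h1.congr_of_eventuallyEq (Eventually.of_forall fun θ => ?_)
  simp only [smoothing_shift hS, add_assoc]

/-- Moving the `L^j(E)`-valued function `H` along `E` differentiates it under the integral. -/
theorem hasDerivAt_wickPairing (hS : IsGaussianSmoothing ι R V μ UE Lam W) (b : X) {φ : X → ℝ}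
    {j : ℕ} (hφ : MemCk ι (j + 1) φ) {q : ℕ} (x : X) (h0 : E) (e : Fin j → E) (h : Fin q → E) :
    HasDerivAt (fun θ : ℝ => wickPairing V b μ UE Lam W (eDerivIter ι φ j) (x + θ • ι h0) e h)
      (wickPairing V b μ UE Lam W (eDerivIter ι φ (j + 1)) x
        (Fin.cons h0 e : Fin (j + 1) → E) h) 0 := by
  obtain ⟨K, hK⟩ := hφ.bounded_deriv j j.le_succ
  obtain ⟨K', hK'⟩ := hφ.bounded_deriv (j + 1) le_rfl
  have hc := hφ.continuous_deriv j j.le_succ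
  have hc' := hφ.continuous_deriv (j + 1) le_rfl
  have := hS.gaussian.isProbabilityMeasure
  let w : X → ℝ := wickProduct q (fun i => Lam (h i)) (fun i => W (h i))
  have hw : MemLp w 2 μ := memLp_wickProduct (fun i => hS.whiteNoise (h i)) hS.gaussian
  have e1 : (fun i => UE ((Fin.cons h0 e : Fin (j + 1) → E) i)) =
      (Fin.cons (UE h0) fun i => UE (e i) : Fin (j + 1) → E) := by
    funext i
    refine Fin.cases ?_ (fun i => ?_) i <;> simp
  have hdom := hasDerivAt_integral_of_dominated_loc_of_deriv_le (μ := μ) (x₀ := (0 : ℝ))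
    (F := fun (θ : ℝ) y => eDerivIter ι φ j (V (x + θ • ι h0) + b + y) (fun i => UE (e i)) * w y)
    (F' := fun (θ : ℝ) y => eDerivIter ι φ (j + 1) (V (x + θ • ι h0) + b + y)
      (fun i => UE ((Fin.cons h0 e : Fin (j + 1) → E) i)) * w y)
    (bound := fun y => K' * (∏ i, ‖UE ((Fin.cons h0 e : Fin (j + 1) → E) i)‖) * |w y|)
    (Metric.ball_mem_nhds 0 one_pos)
    (Eventually.of_forall fun θ =>
      (integrable_wickPairing hS b hc hK (x + θ • ι h0) e h).aestronglyMeasurable)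
    (integrable_wickPairing hS b hc hK _ e h)
    (integrable_wickPairing hS b hc' hK' _ _ h).aestronglyMeasurable
    (ae_of_all _ fun y θ _ => ?_)
    (((hw.integrable (by norm_num)).abs).const_mul _)
    (ae_of_all _ fun y θ _ => ?_)
  · refine hdom.2.congr_deriv ?_
    simp only [zero_smul, add_zero]
    rfl
  · rw [norm_mul, Real.norm_eq_abs (w y)]
    exact mul_le_mul_of_nonneg_right
      (ContinuousMultilinearMap.le_of_opNorm_le (hK' _) _) (abs_nonneg _)
  · refine HasDerivAt.mul_const ?_ (w y)
    rw [e1, eDerivIter_succ_apply]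
    simp only [smoothing_shift hS]
    have h1 := (hφ.differentiable j j.lt_succ_self
      (V x + b + y + θ • ι (UE h0))).hasDerivAt_line (h := UE h0)
    exact ((ContinuousMultilinearMap.apply ℝ (fun _ : Fin j => E) ℝ
      fun i => UE (e i)).hasFDerivAt.comp_hasDerivAt θ h1)

theorem memCk_zero_smoothing (hS : IsGaussianSmoothing ι R V μ UE Lam W) (b : X) {φ : X → ℝ}
    (hφ : Continuous φ) {K : ℝ} (hK : ∀ x, ‖φ x‖ ≤ K) :
    MemCk ι 0 fun x => ∫ y, φ (V x + b + y) ∂μ := by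
  have := hS.gaussian.isProbabilityMeasure
  refine memCk_zero ?_ ⟨K, fun x => ?_⟩
  · refine continuous_of_dominated (bound := fun _ => K)
      (fun x => (hφ.comp (continuous_translate V b x)).aestronglyMeasurable)
      (fun x => ae_of_all _ fun y => hK _) (integrable_const _) (ae_of_all _ fun y => ?_)
    exact hφ.comp (by fun_prop)
  · simpa using norm_integral_le_of_norm_le_const (μ := μ)
      (f := fun y => φ (V x + b + y)) (ae_of_all _ fun y => hK _)

/-- The derivatives of the smoothed function that fall on the Gaussian measure. -/
theorem eDerivIter_smoothing_wick (hS : IsGaussianSmoothing ι R V μ UE Lam W) (b : X) {φ : X → ℝ}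
    (hφ : MemCk ι 0 φ) (q : ℕ) : MemCk ι q (fun x => ∫ y, φ (V x + b + y) ∂μ) ∧
      ∀ x (h : Fin q → E), eDerivIter ι (fun x => ∫ y, φ (V x + b + y) ∂μ) q x h =
        ∫ y, φ (V x + b + y) * wickProduct q (fun i => Lam (h i)) (fun i => W (h i)) y ∂μ := by
  obtain ⟨K, hK⟩ := hφ.bounded
  have hK0 : 0 ≤ K := (norm_nonneg _).trans (hK 0)
  have := hS.gaussian.isProbabilityMeasure
  have hc := hφ.continuous_deriv 0 le_rfl
  have hb : ∀ x, ‖eDerivIter ι φ 0 x‖ ≤ K := fun x => by rw [norm_eDerivIter_zero]; exact hK x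
  induction q with
  | zero =>
    refine ⟨memCk_zero_smoothing hS b hφ.continuous hK, fun x h => ?_⟩
    simp only [wickProduct, wickPoly_zero, mul_one]
    rfl
  | succ q ih =>
    have hi : ∀ x (h : Fin (q + 1) → E), Integrable (fun y => φ (V x + b + y) *
        wickProduct (q + 1) (fun i => Lam (h i)) (fun i => W (h i)) y) μ := fun x h =>
      integrable_mul_wickProduct (fun i => hS.whiteNoise (h i)) hS.gaussian
        (hφ.continuous.comp (continuous_translate V b x)).aestronglyMeasurable (fun y => hK _)
    refine ih.1.succ_of_line_deriv ih.2 (fun x h0 h => hasDerivAt_smoothing_wick hS b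
      hφ.continuous.measurable hK x h0 h) (fun x h0 h0' h => ?_)
      ⟨K * (wickConst (q + 1) * ‖Lam‖ ^ (q + 1)), ?_, fun x h => ?_⟩
      (fun x => ⟨fun x' => shiftModulus V b μ (eDerivIter ι φ 0) x x' *
        (wickConst (q + 1) * ‖Lam‖ ^ (q + 1)), ?_, fun x' => ?_, fun x' h => ?_⟩)
    · rw [← integral_add (hi _ _) (hi _ _)]
      refine integral_congr_ae ?_
      filter_upwards [wickProduct_cons_add hS h0 h0' h] with y hy
      rw [hy, mul_add]
    · have := wickConst_nonneg (q + 1)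
      positivity
    · have := abs_wickPairing_le hS b hc hK0 hb x (Fin.elim0 : Fin 0 → E) h
      simp only [pow_zero, mul_one, Finset.univ_eq_empty, Finset.prod_empty, one_mul] at this
      exact this
    · simpa using (tendsto_shiftModulus (V := V) (μ := μ) b hc hb x).mul_const
        (wickConst (q + 1) * ‖Lam‖ ^ (q + 1))
    · have := wickConst_nonneg (q + 1)
      have h2 : 0 ≤ shiftModulus V b μ (eDerivIter ι φ 0) x x' := Real.sqrt_nonneg _
      positivity
    · have := abs_wickPairing_sub_le hS b hc hb x x' (Fin.elim0 : Fin 0 → E) h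
      simp only [pow_zero, Finset.univ_eq_empty, Finset.prod_empty, one_mul] at this
      exact this

/-- The derivatives of the smoothed function. The first `q` differentiations fall on the Gaussian
measure and the remaining `j` on the function; as each differentiation adds an argument in front, the
latter belong to the first `j` arguments. -/
theorem eDerivIter_smoothing (hS : IsGaussianSmoothing ι R V μ UE Lam W) (b : X) {φ : X → ℝ}
    (q j : ℕ) (hφ : MemCk ι j φ) (m : ℕ) (hm : m = j + q) :
    MemCk ι m (fun x => ∫ y, φ (V x + b + y) ∂μ) ∧
      ∀ x (h : Fin m → E), eDerivIter ι (fun x => ∫ y, φ (V x + b + y) ∂μ) m x h =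
        wickPairing V b μ UE Lam W (eDerivIter ι φ j) x (fun i : Fin j => h ⟨i, by omega⟩)
          (fun i : Fin q => h ⟨j + i, by omega⟩) := by
  have := hS.gaussian.isProbabilityMeasure
  induction j generalizing m with
  | zero =>
    obtain rfl : m = q := by omega
    refine ⟨(eDerivIter_smoothing_wick hS b hφ m).1, fun x h => ?_⟩
    rw [(eDerivIter_smoothing_wick hS b hφ m).2]
    simp only [Nat.zero_add]
    rfl
  | succ j ih =>
    obtain ⟨m, rfl⟩ : ∃ m', m = m' + 1 := ⟨m - 1, by omega⟩
    have ih' := ih (hφ.mono j.le_succ) m (by omega)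
    obtain ⟨K, hK⟩ := hφ.bounded_deriv (j + 1) le_rfl
    have hc := hφ.continuous_deriv (j + 1) le_rfl
    have hK0 : 0 ≤ K := (norm_nonneg _).trans (hK 0)
    have hw := wickConst_nonneg q
    have hcons : ∀ (h0 : E) (h : Fin m → E), (fun i : Fin (j + 1) =>
        (Fin.cons h0 h : Fin (m + 1) → E) ⟨i, by omega⟩) =
        (Fin.cons h0 fun i : Fin j => h ⟨i, by omega⟩ : Fin (j + 1) → E) := fun h0 h => by
      funext i
      refine Fin.cases rfl (fun i => rfl) i
    have htail : ∀ (h0 : E) (h : Fin m → E), (fun i : Fin q =>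
        (Fin.cons h0 h : Fin (m + 1) → E) ⟨j + 1 + i, by omega⟩) =
        fun i : Fin q => h ⟨j + i, by omega⟩ := fun h0 h => by
      funext i
      have : (⟨j + 1 + i, by omega⟩ : Fin (m + 1)) = Fin.succ ⟨j + i, by omega⟩ :=
        Fin.ext (by simp; omega)
      rw [this, Fin.cons_succ]
    have hprod : ∀ h : Fin (m + 1) → E, (∏ i : Fin (j + 1), ‖h ⟨i, by omega⟩‖) *
        ∏ i : Fin q, ‖h ⟨j + 1 + i, by omega⟩‖ = ∏ i, ‖h i‖ := prod_norm_split hm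
    refine ih'.1.succ_of_line_deriv (F' := fun x h => wickPairing V b μ UE Lam W
        (eDerivIter ι φ (j + 1)) x (fun i : Fin (j + 1) => h ⟨i, by omega⟩)
          (fun i : Fin q => h ⟨j + 1 + i, by omega⟩)) ih'.2 (fun x h0 h => ?_)
      (fun x h0 h0' h => ?_)
      ⟨K * ‖UE‖ ^ (j + 1) * (wickConst q * ‖Lam‖ ^ q), by positivity, fun x h => ?_⟩
      (fun x => ⟨fun x' => shiftModulus V b μ (eDerivIter ι φ (j + 1)) x x' *
        (‖UE‖ ^ (j + 1) * (wickConst q * ‖Lam‖ ^ q)), ?_, fun x' => ?_, fun x' h => ?_⟩)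
    · rw [hcons, htail]
      exact hasDerivAt_wickPairing hS b hφ x h0 _ _
    · rw [hcons, hcons, hcons, htail, htail, htail, wickPairing, wickPairing, wickPairing,
        ← integral_add (integrable_wickPairing hS b hc hK x _ _)
          (integrable_wickPairing hS b hc hK x _ _)]
      congr 1
      funext y
      have e1 : ∀ (h0 : E) (e : Fin j → E),
          (fun i => UE ((Fin.cons h0 e : Fin (j + 1) → E) i)) =
          (Fin.cons (UE h0) fun i => UE (e i) : Fin (j + 1) → E) := fun h0 e => by
        funext i
        refine Fin.cases ?_ (fun i => ?_) i <;> simp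
      rw [e1, e1, e1, map_add, ← add_mul]
      congr 1
      rw [eDerivIter_succ_apply, eDerivIter_succ_apply, eDerivIter_succ_apply, map_add, add_apply]
    · have := abs_wickPairing_le hS b hc hK0 hK x (fun i : Fin (j + 1) => h ⟨i, by omega⟩)
          (fun i : Fin q => h ⟨j + 1 + i, by omega⟩)
      rwa [hprod] at this
    · simpa using (tendsto_shiftModulus (V := V) (μ := μ) b hc hK x).mul_const
        (‖UE‖ ^ (j + 1) * (wickConst q * ‖Lam‖ ^ q))
    · have h2 : 0 ≤ shiftModulus V b μ (eDerivIter ι φ (j + 1)) x x' := Real.sqrt_nonneg _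
      positivity
    · have := abs_wickPairing_sub_le hS b hc hK x x' (fun i : Fin (j + 1) => h ⟨i, by omega⟩)
          (fun i : Fin q => h ⟨j + 1 + i, by omega⟩)
      rwa [hprod] at this

end Smoothing

/-! ### The Ornstein–Uhlenbeck evolution operator as a Gaussian smoothing -/

section Instantiation

variable {X : Type u} [NormedAddCommGroup X] [InnerProductSpace ℝ X] [CompleteSpace X]
  [TopologicalSpace.SeparableSpace X] [MeasurableSpace X] [BorelSpace X]
variable {Y : Type w} [NormedAddCommGroup Y] [InnerProductSpace ℝ Y] [CompleteSpace Y]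
  [TopologicalSpace.SeparableSpace Y]
variable {E : Type v} [NormedAddCommGroup E] [NormedSpace ℝ E]
variable {ι : E →L[ℝ] X} {T : ℝ} {U : ℝ → ℝ → X →L[ℝ] X} {B : ℝ → Y →L[ℝ] X} {f : ℝ → X}
  {s t : ℝ}

theorem isGaussianWithRoot_gaussianMeasure {Q : X →L[ℝ] X} (hQ : Q.IsPositive)
    (hT : FiniteTrace Q) : IsGaussianWithRoot (opSqrt Q) (gaussianMeasure Q) :=
  ⟨(opSqrt_spec hQ).1, (gaussianMeasure_spec hQ hT).1, (gaussianMeasure_spec hQ hT).2⟩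

theorem isCameronMartinFunction_cameronMartinFunction {Q : X →L[ℝ] X} (hQ : Q.IsPositive)
    (hT : FiniteTrace Q) {h : X} (hh : h ∈ Set.range (opSqrt Q)) :
    IsCameronMartinFunction Q h (cameronMartinFunction Q h) := by
  have := UniformSpace.secondCountable_of_separable X
  obtain ⟨x, hx⟩ := exists_seq_tendsto_pseudoInv (opSqrt_spec hQ).1 hh
  have H : ∃ f : X → ℝ, IsCameronMartinFunction Q h f :=
    exists_isWhiteNoise (isGaussianWithRoot_gaussianMeasure hQ hT) hx
  rw [cameronMartinFunction, dif_pos H]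
  exact H.choose_spec

/-- The operator `Λ(t,s) = Q(t,s)^{-1/2} U(t,s)`, as a bounded operator from `E` to `X`. -/
theorem exists_clm_eq_lambdaOp (hM : MapsIntoCameronMartin ι U B t s) :
    ∃ Lam : E →L[ℝ] X, (∀ h, Lam h = lambdaOp ι U B t s h) ∧ ‖Lam‖ = lambdaNorm ι U B t s := by
  obtain ⟨c, hc⟩ := hM.2
  let Lam : E →L[ℝ] X := LinearMap.mkContinuous
    { toFun := lambdaOp ι U B t s
      map_add' := fun x y => by
        rw [lambdaOp, map_add, map_add]
        exact pseudoInv_add (hM.1 x) (hM.1 y)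
      map_smul' := fun a x => by
        rw [lambdaOp, map_smul, map_smul]
        exact pseudoInv_smul a (hM.1 x) } c hc
  -- the operator norm is by definition the infimum in `lambdaNorm`
  exact ⟨Lam, fun h => rfl, rfl⟩

/-- The Ornstein–Uhlenbeck evolution operator is a Gaussian smoothing operator. -/
theorem isGaussianSmoothing_evolution (hS : StandingAssumptions T U B f) (hs : 0 ≤ s)
    (hst : s < t) (ht : t ≤ T) (hM : MapsIntoCameronMartin ι U B t s) {UE : E →L[ℝ] E}
    (hUE : ∀ h, ι (UE h) = U t s (ι h)) {Lam : E →L[ℝ] X}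
    (hLam : ∀ h, Lam h = lambdaOp ι U B t s h) :
    IsGaussianSmoothing ι (opSqrt (covOp U B t s)) (U t s) (gaussianMeasure (covOp U B t s)) UE Lam
      fun h => cameronMartinFunction (covOp U B t s) (U t s (ι h)) := by
  have hQ := covOp_isPositive hS hs hst ht
  have hT := hS.finite_trace s t hs hst ht
  refine ⟨isGaussianWithRoot_gaussianMeasure hQ hT, fun h => (hUE h).symm, fun h => ?_, fun h => ?_⟩
  · rw [hLam, hUE, lambdaOp]
    exact (pseudoInv_spec (hM.1 h)).2
  · rw [hLam]
    exact isCameronMartinFunction_cameronMartinFunction hQ hT (hM.1 h)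

theorem evolutionOp_eq (φ : X → ℝ) : evolutionOp U B f s t φ =
    fun x => ∫ y, φ (U t s x + (∫ r in s..t, U t r (f r)) + y) ∂gaussianMeasure (covOp U B t s) := by
  funext x
  simp only [evolutionOp, meanVec, add_comm]

theorem wickPolynomial_eq_wickProduct {Lam : E →L[ℝ] X} (hLam : ∀ h, Lam h = lambdaOp ι U B t s h)
    (n : ℕ) (y : X) (h : Fin n → E) : wickPolynomial ι U B t s n y h =
      wickProduct n (fun i => Lam (h i))
        (fun i => cameronMartinFunction (covOp U B t s) (U t s (ι (h i)))) y := by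
  simp only [wickPolynomial, wickProduct, wickPoly, matchings, unmatched, hLam]

/-- The formula for the derivatives of `P_{s,t} φ`. -/
theorem eDerivIter_evolutionOp (hS : StandingAssumptions T U B f) (hs : 0 ≤ s)
    (hst : s < t) (ht : t ≤ T) (hM : MapsIntoCameronMartin ι U B t s) {UE : E →L[ℝ] E}
    (hUE : ∀ h, ι (UE h) = U t s (ι h)) (k n : ℕ) {φ : X → ℝ} (hφ : MemCk ι k φ) :
    MemCk ι (k + n) (evolutionOp U B f s t φ) ∧
      ∀ (x : X) (h : Fin (k + n) → E),
        Integrable (fun y => eDerivIter ι φ k (meanVec U f t s x + y)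
              (fun i => UE (h (Fin.castAdd n i))) *
            wickPolynomial ι U B t s n y (fun i => h (Fin.natAdd k i)))
          (gaussianMeasure (covOp U B t s)) ∧
        eDerivIter ι (evolutionOp U B f s t φ) (k + n) x h =
          ∫ y, eDerivIter ι φ k (meanVec U f t s x + y)
              (fun i => UE (h (Fin.castAdd n i))) *
            wickPolynomial ι U B t s n y (fun i => h (Fin.natAdd k i))
          ∂(gaussianMeasure (covOp U B t s)) := by
  have := UniformSpace.secondCountable_of_separable X
  obtain ⟨Lam, hLam, -⟩ := exists_clm_eq_lambdaOp hM
  have hG := isGaussianSmoothing_evolution hS hs hst ht hM hUE hLam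
  obtain ⟨K, hK⟩ := hφ.bounded_deriv k le_rfl
  have h1 := eDerivIter_smoothing hG (∫ r in s..t, U t r (f r)) n k hφ (k + n) rfl
  rw [← evolutionOp_eq] at h1
  simp only [wickPolynomial_eq_wickProduct hLam]
  exact ⟨h1.1, fun x h => ⟨integrable_wickPairing hG _ (hφ.continuous_deriv k le_rfl) hK x _ _,
    h1.2 x h⟩⟩

end Instantiation

/-! ### Gaussian pairings of Hölder continuous functions -/

section Interpolation

open ProbabilityTheory

variable {X : Type u} [NormedAddCommGroup X] [InnerProductSpace ℝ X] [CompleteSpace X]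
  [SecondCountableTopology X] [MeasurableSpace X] [BorelSpace X] {R : X →L[ℝ] X} {μ : Measure X}
  {g : X} {w : X → ℝ}

theorem wickProduct_zero (g : Fin 0 → X) (W : Fin 0 → X → ℝ) (y : X) :
    wickProduct 0 g W y = 1 := by
  rw [wickProduct, wickPoly_zero]

/-- The degree is written `0 + 1` to match the recursive step. -/
theorem wickProduct_one (g : Fin (0 + 1) → X) (W : Fin (0 + 1) → X → ℝ) (y : X) :
    wickProduct (0 + 1) g W y = W 0 y := by
  have h1 : ∀ u : Finset (Fin 0), u = ∅ := fun u => Finset.eq_empty_of_isEmpty u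
  simp [wickProduct, wickPoly_succ, wickPoly_zero, wickDeriv, h1]

theorem IsWhiteNoise.integral_sq (h : IsWhiteNoise R μ g w) (hG : IsGaussianWithRoot R μ) :
    ∫ y, w y ^ 2 ∂μ = ‖g‖ ^ 2 := by
  rw [h.integral_comp hG (F := fun z => z ^ 2) (by fun_prop)]
  simp only [mul_pow]
  rw [integral_const_mul]
  have h1 := variance_id_gaussianReal (μ := 0) (v := 1)
  rw [variance_eq_sub (memLp_id_gaussianReal 2)] at h1
  simp only [Pi.pow_apply, id_eq, integral_id_gaussianReal] at h1
  norm_num at h1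
  rw [h1, mul_one]

/-- A `σ`-Hölder bound in the direction `R g` improves the bound of the pairing with the white noise
of `g` from `‖g‖` to `‖g‖ ^ (1 - σ)`: the reflection in the direction of `g` preserves `μ` and
changes the sign of `w`. -/
theorem abs_integral_mul_whiteNoise_le (h : IsWhiteNoise R μ g w) (hG : IsGaussianWithRoot R μ)
    {F : X → ℝ} (hF : Measurable F) {K : ℝ} (hK : ∀ y, |F y| ≤ K) {σ : ℝ} (hσ0 : 0 < σ)
    (hσ1 : σ < 1) {A : ℝ} (hA0 : 0 ≤ A) (hA : ∀ y c, |F (y + c • R g) - F y| ≤ A * |c| ^ σ) :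
    |∫ y, F y * w y ∂μ| ≤ 2 * A * ‖g‖ ^ (1 - σ) := by
  have := hG.isProbabilityMeasure
  rcases eq_or_ne g 0 with rfl | hg
  · rw [integral_congr_ae (g := fun _ => (0 : ℝ)), integral_zero, abs_zero]
    · positivity
    · filter_upwards [h.ae_eq_zero hG] with y hy
      simp [hy]
  have hg0 : 0 < ‖g‖ := norm_pos_iff.2 hg
  have hn : ‖‖g‖⁻¹ • g‖ = 1 := by rw [norm_smul, norm_inv, norm_norm, inv_mul_cancel₀ hg0.ne']
  let S : X → X := fun z => z + (-2 * (‖g‖⁻¹ * w z)) • R (‖g‖⁻¹ • g)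
  have hS : MeasurePreserving S μ μ := measurePreserving_reflection (h.smul ‖g‖⁻¹) hG hn
  have hS' : ∀ z, S z = z + (-2 * (‖g‖⁻¹ * w z) * ‖g‖⁻¹) • R g := fun z => by
    simp only [S, map_smul, smul_smul]
  have hwS : ∀ᵐ z ∂μ, w (S z) = -w z := by
    filter_upwards [h.comp_ae_eq hG hS.quasiMeasurePreserving hS'] with z hz
    rw [hz, real_inner_self_eq_norm_sq]
    field_simp
    ring
  have hwi : Integrable w μ := (h.memLp hG (p := 2) (by norm_num)).integrable (by norm_num)
  have hi : Integrable (fun y => F y * w y) μ :=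
    hwi.bdd_mul hF.aestronglyMeasurable (ae_of_all _ hK)
  have hiS : Integrable (fun y => F (S y) * w y) μ :=
    hwi.bdd_mul (hF.comp hS.measurable).aestronglyMeasurable (ae_of_all _ fun y => hK _)
  have e1 : ∫ y, F y * w y ∂μ = -∫ y, F (S y) * w y ∂μ := by
    rw [← integral_neg]
    have h1 := integral_map (μ := μ) (φ := S) hS.measurable.aemeasurable (f := fun y => F y * w y)
      (hF.mul h.1).aestronglyMeasurable
    rw [hS.map_eq] at h1
    rw [h1]
    refine integral_congr_ae ?_
    filter_upwards [hwS] with z hz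
    rw [hz]
    ring
  have e2 : ∫ y, F y * w y ∂μ = -(1 / 2) * ∫ y, (F (S y) - F y) * w y ∂μ := by
    simp only [sub_mul]
    rw [integral_sub hiS hi]
    linarith
  have hsq : Integrable (fun y => w y ^ 2) μ := (h.memLp hG (p := 2) (by norm_num)).integrable_sq
  -- with `x = |w| / ‖g‖` the integrand is at most `2 ^ σ A ‖g‖ ^ (1 - σ) x ^ (1 + σ)`
  have hb : ∀ y, ‖(F (S y) - F y) * w y‖ ≤
      2 * A * ‖g‖ ^ (1 - σ) * (1 + (‖g‖ ^ 2)⁻¹ * w y ^ 2) := fun y => by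
    rw [norm_mul, Real.norm_eq_abs, Real.norm_eq_abs, hS']
    set x : ℝ := |w y| / ‖g‖ with hx
    have hx0 : 0 ≤ x := by positivity
    have h1 : |-2 * (‖g‖⁻¹ * w y) * ‖g‖⁻¹| = 2 * x / ‖g‖ := by
      rw [abs_mul, abs_mul, abs_mul, abs_neg, abs_two, abs_inv, abs_norm, hx]
      field_simp
    have h2 : |w y| = x * ‖g‖ := by rw [hx]; field_simp
    have h3 : (‖g‖ ^ 2)⁻¹ * w y ^ 2 = x ^ 2 := by rw [hx, div_pow, sq_abs]; field_simp
    have h4 : x ^ σ * x ≤ 1 + x ^ 2 := by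
      rcases le_total x 1 with hx1 | hx1
      · have : x ^ σ ≤ 1 := Real.rpow_le_one hx0 hx1 hσ0.le
        nlinarith
      · have : x ^ σ ≤ x := by
          simpa using Real.rpow_le_rpow_of_exponent_le hx1 hσ1.le
        nlinarith
    have h5 : (2 : ℝ) ^ σ ≤ 2 := by
      simpa using Real.rpow_le_rpow_of_exponent_le (x := (2 : ℝ)) (by norm_num) hσ1.le
    have h6 : ‖g‖ ^ (1 - σ) = ‖g‖ / ‖g‖ ^ σ := by rw [Real.rpow_sub hg0, Real.rpow_one]
    calc |F (y + (-2 * (‖g‖⁻¹ * w y) * ‖g‖⁻¹) • R g) - F y| * |w y|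
        ≤ A * (2 * x / ‖g‖) ^ σ * (x * ‖g‖) := by
          rw [← h1, ← h2]
          exact mul_le_mul_of_nonneg_right (hA _ _) (abs_nonneg _)
      _ = 2 ^ σ * (A * ‖g‖ ^ (1 - σ)) * (x ^ σ * x) := by
          rw [Real.div_rpow (by positivity) hg0.le, Real.mul_rpow (by norm_num) hx0, h6]
          ring
      _ ≤ 2 * (A * ‖g‖ ^ (1 - σ)) * (1 + x ^ 2) := by gcongr
      _ = _ := by rw [h3]; ring
  rw [e2, abs_mul, abs_neg, abs_of_pos (by norm_num : (0 : ℝ) < 1 / 2)]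
  have h7 := norm_integral_le_of_norm_le
    (((integrable_const (1 : ℝ)).add (hsq.const_mul (‖g‖ ^ 2)⁻¹)).const_mul
      (2 * A * ‖g‖ ^ (1 - σ))) (ae_of_all _ hb)
  rw [integral_const_mul] at h7
  simp only [Pi.add_apply] at h7
  rw [integral_add (integrable_const _) (hsq.const_mul _), integral_const_mul, h.integral_sq hG,
    inv_mul_cancel₀ (by positivity)] at h7
  simp only [integral_const, probReal_univ, smul_eq_mul, mul_one] at h7
  rw [Real.norm_eq_abs] at h7
  linarith

/-- `√2 ∫ F (v + z / √2) w(z) μ(dz)`: the derivative in a Cameron–Martin direction of the smoothing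
of `F` by half of the noise. -/
noncomputable def halfDerivative (μ : Measure X) (w : X → ℝ) (F : X → ℝ) (v : X) : ℝ :=
  Real.sqrt 2 * ∫ z, F (v + (Real.sqrt 2)⁻¹ • z) * w z ∂μ

theorem measurable_halfDerivative [SFinite μ] (hw : Measurable w) {F : X → ℝ} (hF : Measurable F) :
    Measurable (halfDerivative μ w F) := by
  have h1 : Measurable fun p : X × X => F (p.1 + (Real.sqrt 2)⁻¹ • p.2) * w p.2 := by fun_prop
  exact (h1.stronglyMeasurable.integral_prod_right').measurable.const_mul _

theorem abs_halfDerivative_le_of_bound (hw : Integrable w μ) {F : X → ℝ} {K : ℝ}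
    (hK : ∀ y, |F y| ≤ K) (v : X) :
    |halfDerivative μ w F v| ≤ Real.sqrt 2 * (K * ∫ z, |w z| ∂μ) := by
  rw [halfDerivative, abs_mul, abs_of_nonneg (Real.sqrt_nonneg 2)]
  refine mul_le_mul_of_nonneg_left ?_ (Real.sqrt_nonneg 2)
  rw [← integral_const_mul]
  rw [← Real.norm_eq_abs]
  refine norm_integral_le_of_norm_le (hw.abs.const_mul K) (ae_of_all _ fun z => ?_)
  rw [norm_mul]
  exact mul_le_mul_of_nonneg_right (hK _) (norm_nonneg _)

/-- The bound of `halfDerivative` for a function that is `σ`-Hölder in the direction `R g`. -/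
theorem abs_halfDerivative_le (h : IsWhiteNoise R μ g w) (hG : IsGaussianWithRoot R μ)
    {F : X → ℝ} (hF : Measurable F) {K : ℝ} (hK : ∀ y, |F y| ≤ K) {σ : ℝ} (hσ0 : 0 < σ)
    (hσ1 : σ < 1) {A : ℝ} (hA0 : 0 ≤ A) (hA : ∀ y c, |F (y + c • R g) - F y| ≤ A * |c| ^ σ)
    (v : X) : |halfDerivative μ w F v| ≤ Real.sqrt 2 * (2 * A * ‖g‖ ^ (1 - σ)) := by
  rw [halfDerivative, abs_mul, abs_of_nonneg (Real.sqrt_nonneg 2)]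
  refine mul_le_mul_of_nonneg_left ?_ (Real.sqrt_nonneg 2)
  refine abs_integral_mul_whiteNoise_le h hG (F := fun z => F (v + (Real.sqrt 2)⁻¹ • z))
    (by fun_prop) (fun y => hK _) hσ0 hσ1 hA0 fun y c => ?_
  rw [smul_add, ← add_assoc, smul_smul]
  refine (hA _ _).trans (mul_le_mul_of_nonneg_left ?_ hA0)
  refine Real.rpow_le_rpow (abs_nonneg _) ?_ hσ0.le
  rw [abs_mul, abs_of_nonneg (by positivity)]
  refine mul_le_of_le_one_left (abs_nonneg _) (inv_le_one_of_one_le₀ ?_)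
  exact Real.one_le_sqrt.2 (by norm_num)

/-- Integration against the law of `(y + z) / √2` for independent `y` and `z`. -/
theorem integral_eq_integral_integral_rotation (hG : IsGaussianWithRoot R μ) {F : X → ℝ}
    (hF : Measurable F) {K : ℝ} (hK : ∀ y, |F y| ≤ K) :
    ∫ y, F y ∂μ = ∫ z, ∫ y, F ((Real.sqrt 2)⁻¹ • (y + z)) ∂μ ∂μ := by
  have := hG.isProbabilityMeasure
  have hm : Measurable fun p : X × X => (Real.sqrt 2)⁻¹ • (p.1 + p.2) := by fun_prop
  conv_lhs => rw [← map_rotation hG]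
  rw [integral_map hm.aemeasurable hF.aestronglyMeasurable]
  refine integral_prod_symm _ (Integrable.of_bound (hF.comp hm).aestronglyMeasurable K
    (ae_of_all _ fun p => hK _))

/-- Both sides are derivatives at `θ = 0` of `∫ F (y + θ R g) μ(dy)`; on the right, the noise is split
into two independent halves and the translation is carried by one of them. -/
theorem integral_mul_whiteNoise_eq_halfDerivative (h : IsWhiteNoise R μ g w)
    (hG : IsGaussianWithRoot R μ) {F : X → ℝ} (hF : Measurable F) {K : ℝ} (hK : ∀ y, |F y| ≤ K) :
    ∫ y, F y * w y ∂μ = ∫ y, halfDerivative μ w F ((Real.sqrt 2)⁻¹ • y) ∂μ := by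
  have := hG.isProbabilityMeasure
  have h2 : Real.sqrt 2 ≠ 0 := by positivity
  have hder : ∀ {ψ : X → ℝ}, Measurable ψ → (∀ y, |ψ y| ≤ K) →
      HasDerivAt (fun θ : ℝ => ∫ y, ψ (y + θ • R g) ∂μ) (∫ y, ψ y * w y ∂μ) 0 := fun hψ hb => by
    have h1 := hasDerivAt_integral_mul_wickProduct (n := 0) (g := fun _ => g) (W := fun _ => w)
      (fun _ => h) hG hψ hb
    simpa only [wickProduct_one, wickProduct_zero, mul_one] using h1
  let ψ : X → ℝ := fun z => ∫ y, F ((Real.sqrt 2)⁻¹ • (y + z)) ∂μ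
  have hm : Measurable fun p : X × X => F ((Real.sqrt 2)⁻¹ • (p.2 + p.1)) := by fun_prop
  have hψ : Measurable ψ := (hm.stronglyMeasurable.integral_prod_right').measurable
  have hψK : ∀ y, |ψ y| ≤ K := fun y => by
    have h1 := norm_integral_le_of_norm_le_const (μ := μ)
      (f := fun z => F ((Real.sqrt 2)⁻¹ • (z + y))) (ae_of_all _ fun z => hK _)
    rwa [probReal_univ, mul_one] at h1
  have h3 : HasDerivAt (fun θ : ℝ => ∫ y, F (y + θ • R g) ∂μ)
      (Real.sqrt 2 * ∫ y, ψ y * w y ∂μ) 0 := by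
    have h4 : HasDerivAt (fun θ : ℝ => Real.sqrt 2 * θ) (Real.sqrt 2) 0 := by
      simpa using (hasDerivAt_id (0 : ℝ)).const_mul (Real.sqrt 2)
    have h5 := HasDerivAt.comp_of_eq (0 : ℝ) (hder hψ hψK) h4 (by simp)
    rw [mul_comm] at h5
    refine h5.congr_of_eventuallyEq (Eventually.of_forall fun θ => ?_)
    have h6 := integral_eq_integral_integral_rotation hG (F := fun y => F (y + θ • R g))
      (by fun_prop) (fun y => hK _)
    refine h6.trans ?_
    simp only [Function.comp, ψ]
    congr 1
    funext z
    congr 1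
    funext y
    rw [← add_assoc, smul_add _ (y + z), smul_smul, ← mul_assoc, inv_mul_cancel₀ h2, one_mul]
  rw [(hder hF hK).unique h3]
  simp only [halfDerivative]
  rw [integral_const_mul]
  congr 1
  have hwi : Integrable w μ := (h.memLp hG (p := 2) (by norm_num)).integrable (by norm_num)
  have h7 : Integrable (fun p : X × X => F ((Real.sqrt 2)⁻¹ • p.2 + (Real.sqrt 2)⁻¹ • p.1) * w p.1)
      (μ.prod μ) :=
    (hwi.comp_fst μ).bdd_mul (Measurable.aestronglyMeasurable (by fun_prop))
      (ae_of_all _ fun p => hK _)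
  rw [← integral_integral_swap (f := fun z y =>
    F ((Real.sqrt 2)⁻¹ • y + (Real.sqrt 2)⁻¹ • z) * w z) h7]
  simp only [ψ, ← integral_mul_const, smul_add]

/-- Splitting the noise into two independent halves: the last factor of the Wick product is carried
by the first half, the other factors by the second. Both sides are differentiated in the directions of the other factors,
which for the second half means a translation by `√2 θ R (g 0)`. -/
theorem integral_mul_wickProduct_succ (hG : IsGaussianWithRoot R μ) {q : ℕ} {g : Fin (q + 1) → X}
    {W : Fin (q + 1) → X → ℝ} (hW : ∀ i, IsWhiteNoise R μ (g i) (W i)) {F : X → ℝ}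
    (hF : Measurable F) {K : ℝ} (hK : ∀ y, |F y| ≤ K) :
    ∫ y, F y * wickProduct (q + 1) g W y ∂μ =
      Real.sqrt 2 ^ q * ∫ y, halfDerivative μ (W (Fin.last q)) F ((Real.sqrt 2)⁻¹ • y) *
        wickProduct q (fun i => g i.castSucc) (fun i => W i.castSucc) y ∂μ := by
  have := hG.isProbabilityMeasure
  have h2 : Real.sqrt 2 ≠ 0 := by positivity
  induction q generalizing F with
  | zero =>
    have h1 := integral_mul_whiteNoise_eq_halfDerivative (hW (Fin.last 0)) hG hF hK
    simp only [wickProduct_one, wickProduct_zero, mul_one, pow_zero, one_mul]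
    exact h1
  | succ q ih =>
    have h1 := hasDerivAt_integral_mul_wickProduct hW hG hF hK
    have hwi : Integrable (W (Fin.last (q + 1))) μ :=
      ((hW (Fin.last (q + 1))).memLp hG (p := 2) (by norm_num)).integrable (by norm_num)
    have h3 := hasDerivAt_integral_mul_wickProduct (n := q) (g := fun i => g i.castSucc)
      (W := fun i => W i.castSucc) (fun i => hW _) hG
      (ψ := fun y => halfDerivative μ (W (Fin.last (q + 1))) F ((Real.sqrt 2)⁻¹ • y))
      ((measurable_halfDerivative (hW _).1 hF).comp (measurable_const_smul _))
      (fun y => abs_halfDerivative_le_of_bound hwi hK _)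
    have h4 : HasDerivAt (fun θ : ℝ => Real.sqrt 2 * θ) (Real.sqrt 2) 0 := by
      simpa using (hasDerivAt_id (0 : ℝ)).const_mul (Real.sqrt 2)
    have h5 := (HasDerivAt.comp_of_eq (0 : ℝ) h3 h4 (by simp)).const_mul (Real.sqrt 2 ^ q)
    have h6 := h1.unique (h5.congr_of_eventuallyEq (Eventually.of_forall fun θ => ?_))
    · rw [h6, pow_succ]
      ring
    · have h7 := ih (g := fun i => g i.succ) (W := fun i => W i.succ) (fun i => hW _)
        (F := fun y => F (y + θ • R (g 0))) (by fun_prop) (fun y => hK _)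
      refine h7.trans ?_
      simp only [Function.comp, Fin.succ_last, Fin.succ_castSucc, Fin.castSucc_zero]
      congr 1
      refine integral_congr_ae (ae_of_all _ fun y => ?_)
      simp only [halfDerivative]
      congr 2
      refine integral_congr_ae (ae_of_all _ fun z => ?_)
      simp only [smul_add, smul_smul]
      rw [← mul_assoc, inv_mul_cancel₀ h2, one_mul, add_right_comm]

/-- The bound of a Gaussian pairing of a function which is `σ`-Hölder in the last direction. -/
theorem abs_integral_mul_wickProduct_succ_le (hG : IsGaussianWithRoot R μ) {q : ℕ}
    {g : Fin (q + 1) → X} {W : Fin (q + 1) → X → ℝ} (hW : ∀ i, IsWhiteNoise R μ (g i) (W i))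
    {F : X → ℝ} (hF : Measurable F) {K : ℝ} (hK : ∀ y, |F y| ≤ K) {σ : ℝ} (hσ0 : 0 < σ)
    (hσ1 : σ < 1) {A : ℝ} (hA0 : 0 ≤ A)
    (hA : ∀ y c, |F (y + c • R (g (Fin.last q))) - F y| ≤ A * |c| ^ σ) :
    |∫ y, F y * wickProduct (q + 1) g W y ∂μ| ≤
      2 * Real.sqrt 2 ^ (q + 1) * wickConst q * A *
        (‖g (Fin.last q)‖ ^ (1 - σ) * ∏ i : Fin q, ‖g i.castSucc‖) := by
  have := hG.isProbabilityMeasure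
  rw [integral_mul_wickProduct_succ hG hW hF hK, abs_mul, abs_of_nonneg (by positivity)]
  have h1 := abs_integral_mul_wickProduct_le (n := q) (g := fun i => g i.castSucc)
    (W := fun i => W i.castSucc) (fun i => hW _) hG
    (F := fun y => halfDerivative μ (W (Fin.last q)) F ((Real.sqrt 2)⁻¹ • y))
    ((measurable_halfDerivative (hW _).1 hF).comp
      (measurable_const_smul _)).aestronglyMeasurable
    (K := Real.sqrt 2 * (2 * A * ‖g (Fin.last q)‖ ^ (1 - σ))) (by positivity)
    (eLpNorm_two_le_of_bound hG fun y => abs_halfDerivative_le (hW _) hG hF hK hσ0 hσ1 hA0 hA _)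
  refine (mul_le_mul_of_nonneg_left h1 (by positivity)).trans (le_of_eq ?_)
  ring

end Interpolation

/-! ### Hölder estimates for Gaussian smoothings -/

section Estimates

variable {X : Type u} [NormedAddCommGroup X] [InnerProductSpace ℝ X] [CompleteSpace X]
  [SecondCountableTopology X] [MeasurableSpace X] [BorelSpace X]
variable {E : Type v} [NormedAddCommGroup E] [NormedSpace ℝ E]
variable {ι : E →L[ℝ] X} {R V : X →L[ℝ] X} {μ : Measure X} {UE : E →L[ℝ] E} {Lam : E →L[ℝ] X}
  {W : E → X → ℝ} {b : X} {φ : X → ℝ} {n m : ℕ} {σ τ N M : ℝ}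

/-- `φ ∈ C_E^n` with derivatives bounded by `N`, the last of which is `σ`-Hölder along `E` with
constant `N` if `σ > 0`. -/
structure HasHolderBound (ι : E →L[ℝ] X) (n : ℕ) (σ N : ℝ) (φ : X → ℝ) : Prop where
  memCk : MemCk ι n φ
  norm_le : ∀ j ≤ n, ∀ x, ‖eDerivIter ι φ j x‖ ≤ N
  norm_increment_le : 0 < σ → ∀ x h,
    ‖eDerivIter ι φ n (x + ι h) - eDerivIter ι φ n x‖ ≤ N * ‖h‖ ^ σ

theorem HasHolderBound.nonneg (hφ : HasHolderBound ι n σ N φ) : 0 ≤ N :=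
  (norm_nonneg _).trans (hφ.norm_le 0 n.zero_le 0)

theorem memCk_smoothing (hS : IsGaussianSmoothing ι R V μ UE Lam W) (hφ : MemCk ι n φ) (m : ℕ) :
    MemCk ι m fun x => ∫ y, φ (V x + b + y) ∂μ :=
  (eDerivIter_smoothing hS b m n hφ (n + m) rfl).1.mono (Nat.le_add_left m n)

/-- The bound by the `L²` norm of the Wick product. -/
theorem norm_eDerivIter_smoothing_le (hS : IsGaussianSmoothing ι R V μ UE Lam W) {j : ℕ}
    (hφ : MemCk ι j φ) {K : ℝ} (hK : ∀ x, ‖eDerivIter ι φ j x‖ ≤ K) (q : ℕ) (x : X) :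
    ‖eDerivIter ι (fun x => ∫ y, φ (V x + b + y) ∂μ) (j + q) x‖ ≤
      K * ‖UE‖ ^ j * (wickConst q * ‖Lam‖ ^ q) := by
  have hK0 : 0 ≤ K := (norm_nonneg _).trans (hK 0)
  have hw := wickConst_nonneg q
  refine ContinuousMultilinearMap.opNorm_le_bound (by positivity) fun h => ?_
  rw [(eDerivIter_smoothing hS b q j hφ (j + q) rfl).2, Real.norm_eq_abs, ← prod_norm_split rfl h]
  exact abs_wickPairing_le hS b (hφ.continuous_deriv j le_rfl) hK0 hK x _ _

/-- The last argument `k` of the Wick product gains the factor `‖Lam k‖ ^ (-σ)` against the Hölder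
increment in the direction `UE k`. -/
theorem HasHolderBound.abs_wickPairing_succ_le (hφ : HasHolderBound ι n σ N φ)
    (hS : IsGaussianSmoothing ι R V μ UE Lam W) (hσ0 : 0 < σ) (hσ1 : σ < 1) {q : ℕ} (x : X)
    (e : Fin n → E) (h : Fin (q + 1) → E) :
    |wickPairing V b μ UE Lam W (eDerivIter ι φ n) x e h| ≤
      2 * Real.sqrt 2 ^ (q + 1) * wickConst q * (‖UE‖ ^ n * ‖UE‖ ^ σ) * N *
        (‖Lam‖ ^ (1 - σ) * ‖Lam‖ ^ q) * ((∏ i, ‖e i‖) * ∏ i, ‖h i‖) := by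
  have hN := hφ.nonneg
  have hw := wickConst_nonneg q
  have hc := hφ.memCk.continuous_deriv n le_rfl
  have he : 0 ≤ ∏ i, ‖e i‖ := Finset.prod_nonneg fun _ _ => norm_nonneg _
  set k : E := h (Fin.last q)
  have hA : ∀ y (c : ℝ), |eDerivIter ι φ n (V x + b + (y + c • R (Lam k))) (fun i => UE (e i)) -
      eDerivIter ι φ n (V x + b + y) fun i => UE (e i)| ≤
      N * (‖UE‖ * ‖k‖) ^ σ * (‖UE‖ ^ n * ∏ i, ‖e i‖) * |c| ^ σ := fun y c => by
    have h1 := hφ.norm_increment_le hσ0 (V x + b + y) (c • UE k)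
    rw [map_smul, ← hS.root_apply, norm_smul, Real.norm_eq_abs, add_assoc] at h1
    rw [← sub_apply]
    refine (ContinuousMultilinearMap.le_of_opNorm_le h1 _).trans ?_
    calc N * (|c| * ‖UE k‖) ^ σ * ∏ i, ‖UE (e i)‖
        ≤ N * (|c| * (‖UE‖ * ‖k‖)) ^ σ * (‖UE‖ ^ n * ∏ i, ‖e i‖) := by
          gcongr
          · exact UE.le_opNorm k
          · exact prod_norm_apply_le UE e
      _ = _ := by
          rw [Real.mul_rpow (abs_nonneg c) (by positivity)]
          ring
  have h2 := abs_integral_mul_wickProduct_succ_le hS.gaussian (fun i => hS.whiteNoise (h i))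
    (F := fun y => eDerivIter ι φ n (V x + b + y) fun i => UE (e i))
    ((continuous_apply_multilinear hc _).comp (continuous_translate V b x)).measurable
    (fun y => (eDerivIter ι φ n (V x + b + y)).le_of_opNorm_le (hφ.norm_le n le_rfl _) _)
    hσ0 hσ1 (by positivity) hA
  refine h2.trans ?_
  have h3 : ∏ i : Fin q, ‖Lam (h i.castSucc)‖ ≤ ‖Lam‖ ^ q * ∏ i : Fin q, ‖h i.castSucc‖ :=
    prod_norm_apply_le Lam fun i : Fin q => h i.castSucc
  have h4 : ‖Lam k‖ ^ (1 - σ) ≤ (‖Lam‖ * ‖k‖) ^ (1 - σ) :=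
    Real.rpow_le_rpow (norm_nonneg _) (Lam.le_opNorm k) (by linarith)
  have h5 : ‖k‖ ^ σ * ‖k‖ ^ (1 - σ) = ‖k‖ := by
    rw [← Real.rpow_add' (norm_nonneg _) (by norm_num), add_sub_cancel, Real.rpow_one]
  calc _ ≤ 2 * Real.sqrt 2 ^ (q + 1) * wickConst q *
        (N * (‖UE‖ * ‖k‖) ^ σ * (‖UE‖ ^ n * ∏ i, ‖e i‖)) *
        ((‖Lam‖ * ‖k‖) ^ (1 - σ) * (‖Lam‖ ^ q * ∏ i : Fin q, ‖h i.castSucc‖)) := by gcongr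
    _ = 2 * Real.sqrt 2 ^ (q + 1) * wickConst q * (‖UE‖ ^ n * ‖UE‖ ^ σ) * N *
        (‖Lam‖ ^ (1 - σ) * ‖Lam‖ ^ q) * ((∏ i, ‖e i‖) * ((∏ i : Fin q, ‖h i.castSucc‖) *
          (‖k‖ ^ σ * ‖k‖ ^ (1 - σ)))) := by
        rw [Real.mul_rpow (norm_nonneg _) (norm_nonneg _),
          Real.mul_rpow (norm_nonneg _) (norm_nonneg _)]
        ring
    _ = _ := by rw [h5, Fin.prod_univ_castSucc (fun i => ‖h i‖)]

/-- The improved bound of the derivatives of order greater than `n` for functions in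
`C_E^(n + σ)`. -/
theorem HasHolderBound.norm_eDerivIter_smoothing_le (hφ : HasHolderBound ι n σ N φ)
    (hS : IsGaussianSmoothing ι R V μ UE Lam W) (hσ0 : 0 < σ) (hσ1 : σ < 1) (q : ℕ) (x : X) :
    ‖eDerivIter ι (fun x => ∫ y, φ (V x + b + y) ∂μ) (n + (q + 1)) x‖ ≤
      2 * Real.sqrt 2 ^ (q + 1) * wickConst q * (‖UE‖ ^ n * ‖UE‖ ^ σ) * N *
        (‖Lam‖ ^ (1 - σ) * ‖Lam‖ ^ q) := by
  have hN := hφ.nonneg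
  have hw := wickConst_nonneg q
  refine ContinuousMultilinearMap.opNorm_le_bound (by positivity) fun h => ?_
  rw [(eDerivIter_smoothing hS b (q + 1) n hφ.memCk (n + (q + 1)) rfl).2, Real.norm_eq_abs,
    ← prod_norm_split rfl h]
  exact hφ.abs_wickPairing_succ_le hS hσ0 hσ1 x _ _

/-- Increments along `E` of the derivative of order `n` are smoothed as the derivative itself. -/
theorem HasHolderBound.norm_eDerivIter_smoothing_sub_le (hφ : HasHolderBound ι n σ N φ)
    (hS : IsGaussianSmoothing ι R V μ UE Lam W) (hσ0 : 0 < σ) (x : X) (h : E) :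
    ‖eDerivIter ι (fun x => ∫ y, φ (V x + b + y) ∂μ) n (x + ι h) -
      eDerivIter ι (fun x => ∫ y, φ (V x + b + y) ∂μ) n x‖ ≤
      wickConst 0 * (‖UE‖ ^ n * ‖UE‖ ^ σ) * N * ‖h‖ ^ σ := by
  have hN := hφ.nonneg
  have hw := wickConst_nonneg 0
  have hc := hφ.memCk.continuous_deriv n le_rfl
  refine ContinuousMultilinearMap.opNorm_le_bound (by positivity) fun e => ?_
  rw [sub_apply, (eDerivIter_smoothing hS b 0 n hφ.memCk n rfl).2,
    (eDerivIter_smoothing hS b 0 n hφ.memCk n rfl).2, wickPairing, wickPairing,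
    ← integral_sub (integrable_wickPairing hS b hc (hφ.norm_le n le_rfl) _ _ _)
      (integrable_wickPairing hS b hc (hφ.norm_le n le_rfl) _ _ _), Real.norm_eq_abs]
  have hb : ∀ z, ‖eDerivIter ι φ n (z + ι (UE h)) - eDerivIter ι φ n z‖ ≤
      N * (‖UE‖ * ‖h‖) ^ σ := fun z =>
    (hφ.norm_increment_le hσ0 z (UE h)).trans (mul_le_mul_of_nonneg_left
      (Real.rpow_le_rpow (norm_nonneg _) (UE.le_opNorm h) hσ0.le) hN)
  have h1 := abs_wickPairing_le hS b
    (H := fun z => eDerivIter ι φ n (z + ι (UE h)) - eDerivIter ι φ n z)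
    ((hc.comp (continuous_id.add continuous_const)).sub hc) (K := N * (‖UE‖ * ‖h‖) ^ σ)
    (by positivity) hb (q := 0) x e (fun i => e ⟨n + i, by omega⟩)
  simp only [Finset.univ_eq_empty, Finset.prod_empty, mul_one, pow_zero] at h1
  rw [Real.mul_rpow (norm_nonneg _) (norm_nonneg _)] at h1
  refine (le_of_eq ?_).trans (h1.trans (le_of_eq (by ring)))
  rw [wickPairing]
  congr 1
  refine integral_congr_ae (ae_of_all _ fun y => ?_)
  simp only [sub_apply, sub_mul, map_add, hS.map_incl, add_right_comm]

/-- A constant for the bound of the derivative of order `j` of a smoothed function in `C_E^(n + σ)`.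
The terms serve the cases `j ≤ n`, `j > n` with `σ = 0`, and `j > n` with `σ > 0`; where a case does
not apply, its term (with truncated differences) is a harmless nonnegative number. -/
noncomputable def smoothingConst (M : ℝ) (n : ℕ) (σ : ℝ) (j : ℕ) : ℝ :=
  M ^ j * wickConst 0 + M ^ n * wickConst (j - n) +
    2 * Real.sqrt 2 ^ (j - n) * wickConst (j - n - 1) * (M ^ n * M ^ σ)

theorem smoothingConst_nonneg (hM : 0 ≤ M) (n : ℕ) (σ : ℝ) (j : ℕ) :
    0 ≤ smoothingConst M n σ j := by
  have := wickConst_nonneg 0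
  have := wickConst_nonneg (j - n)
  have := wickConst_nonneg (j - n - 1)
  rw [smoothingConst]
  positivity

/-- The exponent `max (j - (n + σ)) 0` vanishes exactly for the orders `j ≤ n + σ`, where no
smoothing is needed. -/
theorem HasHolderBound.norm_eDerivIter_smoothing_le_rpow (hφ : HasHolderBound ι n σ N φ)
    (hS : IsGaussianSmoothing ι R V μ UE Lam W) (hσ0 : 0 ≤ σ) (hσ1 : σ < 1) (hM : ‖UE‖ ≤ M)
    (j : ℕ) (x : X) : ‖eDerivIter ι (fun x => ∫ y, φ (V x + b + y) ∂μ) j x‖ ≤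
      smoothingConst M n σ j * N * ‖Lam‖ ^ max (j - (n + σ)) 0 := by
  have hM0 : 0 ≤ M := (norm_nonneg _).trans hM
  have hN := hφ.nonneg
  have hw0 := wickConst_nonneg 0
  have hw1 := wickConst_nonneg (j - n)
  have hw2 := wickConst_nonneg (j - n - 1)
  have hp1 : 0 ≤ M ^ j * wickConst 0 := by positivity
  have hp2 : 0 ≤ M ^ n * wickConst (j - n) := by positivity
  have hp3 : 0 ≤ 2 * Real.sqrt 2 ^ (j - n) * wickConst (j - n - 1) * (M ^ n * M ^ σ) := by
    positivity
  rcases le_or_gt j n with hj | hj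
  · have h1 := OUEvolution.norm_eDerivIter_smoothing_le (b := b) hS (hφ.memCk.mono hj)
      (hφ.norm_le j hj) 0 x
    have hj' : (j : ℝ) ≤ n := by exact_mod_cast hj
    rw [max_eq_right (by linarith), Real.rpow_zero, mul_one]
    refine h1.trans ?_
    calc N * ‖UE‖ ^ j * (wickConst 0 * ‖Lam‖ ^ 0) ≤ N * M ^ j * (wickConst 0 * ‖Lam‖ ^ 0) := by
          gcongr
      _ = M ^ j * wickConst 0 * N := by ring
      _ ≤ _ := by
          refine mul_le_mul_of_nonneg_right ?_ hN
          rw [smoothingConst]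
          linarith
  · obtain ⟨q, rfl⟩ : ∃ q, j = n + (q + 1) := ⟨j - n - 1, by omega⟩
    have e1 : n + (q + 1) - n = q + 1 := by omega
    have e2 : q + 1 - 1 = q := rfl
    have e3 : max (((n + (q + 1) : ℕ) : ℝ) - (n + σ)) 0 = 1 - σ + q := by
      rw [max_eq_left] <;> push_cast
      · ring
      · have : (0 : ℝ) ≤ q := q.cast_nonneg
        linarith
    have hq : (0 : ℝ) ≤ q := q.cast_nonneg
    rw [e3, Real.rpow_add' (norm_nonneg _) (by linarith), Real.rpow_natCast]
    rw [e1, e2] at hp3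
    rw [e1] at hp2
    rcases hσ0.eq_or_lt with rfl | hσ
    · refine (OUEvolution.norm_eDerivIter_smoothing_le (b := b) hS hφ.memCk
        (hφ.norm_le n le_rfl) (q + 1) x).trans ?_
      calc N * ‖UE‖ ^ n * (wickConst (q + 1) * ‖Lam‖ ^ (q + 1))
          ≤ N * M ^ n * (wickConst (q + 1) * ‖Lam‖ ^ (q + 1)) := by
            rw [e1] at hw1
            gcongr
        _ = M ^ n * wickConst (q + 1) * N * (‖Lam‖ ^ ((1 : ℝ) - 0) * ‖Lam‖ ^ q) := by
            rw [sub_zero, Real.rpow_one]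
            ring
        _ ≤ _ := by
            refine mul_le_mul_of_nonneg_right (mul_le_mul_of_nonneg_right ?_ hN) (by positivity)
            rw [smoothingConst, e1, e2]
            linarith
    · refine (hφ.norm_eDerivIter_smoothing_le (b := b) hS hσ hσ1 q x).trans ?_
      refine mul_le_mul_of_nonneg_right (mul_le_mul_of_nonneg_right ?_ hN) (by positivity)
      rw [smoothingConst, e1, e2]
      refine le_trans ?_ (le_add_of_nonneg_left (add_nonneg hp1 hp2))
      rw [e1, e2] at hw2
      gcongr

/-- Interpolation between two bounds of an increment of length `r`; the first is the better one for
`L r ≥ 1`, the second for `L r ≤ 1`. -/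
theorem le_rpow_mul_rpow_of_le {d A L r p e : ℝ} (hA : 0 ≤ A) (hL : 0 ≤ L) (hr : 0 < r)
    (hp : 0 ≤ p) (heτ : e ≤ τ) (hτ : τ < 1) (h1 : d ≤ A * L ^ p * r ^ e)
    (h2 : d ≤ A * L ^ (p + 1 - e) * r) : d ≤ A * L ^ (p + τ - e) * r ^ τ := by
  rcases hL.eq_or_lt with rfl | hL
  · rw [Real.zero_rpow (by linarith), mul_zero, zero_mul] at h2
    exact h2.trans (by positivity)
  rcases le_total (L * r) 1 with hlr | hlr
  · refine h2.trans ?_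
    have e1 : L ^ (p + 1 - e) * r = L ^ (p + τ - e) * r ^ τ * (L * r) ^ (1 - τ) := by
      rw [Real.mul_rpow hL.le hr.le, mul_mul_mul_comm, ← Real.rpow_add hL, ← Real.rpow_add hr,
        show p + τ - e + (1 - τ) = p + 1 - e by ring, show τ + (1 - τ) = 1 by ring, Real.rpow_one]
    rw [mul_assoc, e1, mul_assoc A]
    exact mul_le_mul_of_nonneg_left (mul_le_of_le_one_right (by positivity)
      (Real.rpow_le_one (by positivity) hlr (by linarith))) hA
  · refine h1.trans ?_
    have e1 : L ^ (p + τ - e) * r ^ τ = L ^ p * r ^ e * (L * r) ^ (τ - e) := by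
      rw [Real.mul_rpow hL.le hr.le, mul_mul_mul_comm, ← Real.rpow_add hL, ← Real.rpow_add hr,
        show p + (τ - e) = p + τ - e by ring, show e + (τ - e) = τ by ring]
    rw [mul_assoc, mul_assoc A, e1]
    exact mul_le_mul_of_nonneg_left (le_mul_of_one_le_right (by positivity)
      (Real.one_le_rpow hlr (by linarith))) hA

/-- The constant in the bound of the Hölder seminorm of the derivative of order `m`. -/
noncomputable def smoothingHolderConst (M : ℝ) (n : ℕ) (σ : ℝ) (m : ℕ) : ℝ :=
  2 * smoothingConst M n σ m + wickConst 0 * (M ^ n * M ^ σ) + smoothingConst M n σ (m + 1)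

theorem smoothingHolderConst_nonneg (hM : 0 ≤ M) (n : ℕ) (σ : ℝ) (m : ℕ) :
    0 ≤ smoothingHolderConst M n σ m := by
  have := wickConst_nonneg 0
  have := smoothingConst_nonneg hM n σ m
  have := smoothingConst_nonneg hM n σ (m + 1)
  rw [smoothingHolderConst]
  positivity

/-- The bound of the Hölder increments of the derivative of order `m`, by interpolation. -/
theorem HasHolderBound.norm_eDerivIter_smoothing_sub_le_rpow (hφ : HasHolderBound ι n σ N φ)
    (hS : IsGaussianSmoothing ι R V μ UE Lam W) (hσ0 : 0 ≤ σ) (hσ1 : σ < 1) (hM : ‖UE‖ ≤ M)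
    (hτ0 : 0 < τ) (hτ1 : τ < 1) (hnm : n ≤ m) (hle : n + σ ≤ m + τ) (x : X) {h : E} (hh : h ≠ 0) :
    ‖eDerivIter ι (fun x => ∫ y, φ (V x + b + y) ∂μ) m (x + ι h) -
      eDerivIter ι (fun x => ∫ y, φ (V x + b + y) ∂μ) m x‖ ≤
      smoothingHolderConst M n σ m * N * ‖Lam‖ ^ (m + τ - (n + σ)) * ‖h‖ ^ τ := by
  have hM0 : 0 ≤ M := (norm_nonneg _).trans hM
  have hN := hφ.nonneg
  have hw0 := wickConst_nonneg 0
  have hc0 := smoothingConst_nonneg hM0 n σ m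
  have hc1 := smoothingConst_nonneg hM0 n σ (m + 1)
  have hC := smoothingHolderConst_nonneg hM0 n σ m
  have hp : 0 ≤ wickConst 0 * (M ^ n * M ^ σ) := by positivity
  have hr : 0 < ‖h‖ := norm_pos_iff.2 hh
  have hmem := memCk_smoothing (b := b) hS hφ.memCk (m + 1)
  have hnm' : (n : ℝ) ≤ m := by exact_mod_cast hnm
  have hlip := norm_eDerivIter_add_sub_le (hmem.differentiable m m.lt_succ_self)
    (hφ.norm_eDerivIter_smoothing_le_rpow (b := b) hS hσ0 hσ1 hM (m + 1)) x h
  rw [max_eq_left (by push_cast; linarith)] at hlip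
  have hbd : ‖eDerivIter ι (fun x => ∫ y, φ (V x + b + y) ∂μ) m (x + ι h) -
      eDerivIter ι (fun x => ∫ y, φ (V x + b + y) ∂μ) m x‖ ≤
      2 * smoothingConst M n σ m * N * ‖Lam‖ ^ max (m - (n + σ)) 0 := by
    refine (norm_sub_le _ _).trans ?_
    have h1 := hφ.norm_eDerivIter_smoothing_le_rpow (b := b) hS hσ0 hσ1 hM m (x + ι h)
    have h2 := hφ.norm_eDerivIter_smoothing_le_rpow (b := b) hS hσ0 hσ1 hM m x
    linarith
  have hlip' : ‖eDerivIter ι (fun x => ∫ y, φ (V x + b + y) ∂μ) m (x + ι h) -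
      eDerivIter ι (fun x => ∫ y, φ (V x + b + y) ∂μ) m x‖ ≤
      smoothingHolderConst M n σ m * N * ‖Lam‖ ^ (((m + 1 : ℕ) : ℝ) - (n + σ)) * ‖h‖ := by
    refine hlip.trans ?_
    have : smoothingConst M n σ (m + 1) ≤ smoothingHolderConst M n σ m := by
      rw [smoothingHolderConst]
      linarith
    gcongr
  have hbd' : ∀ {c P r : ℝ}, c ≤ smoothingHolderConst M n σ m → 0 ≤ P → 0 ≤ r →
      c * N * P * r ≤ smoothingHolderConst M n σ m * N * P * r := fun hc _ _ => by gcongr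
  rcases hnm.eq_or_lt with rfl | hlt
  · -- at the order `n` of `φ` itself, the first bound is the Hölder bound inherited from `φ`
    have h1 : ‖eDerivIter ι (fun x => ∫ y, φ (V x + b + y) ∂μ) n (x + ι h) -
        eDerivIter ι (fun x => ∫ y, φ (V x + b + y) ∂μ) n x‖ ≤
        smoothingHolderConst M n σ n * N * ‖Lam‖ ^ (0 : ℝ) * ‖h‖ ^ σ := by
      rcases hσ0.eq_or_lt with rfl | hσ
      · rw [max_eq_right (by linarith)] at hbd
        refine hbd.trans ?_
        rw [Real.rpow_zero ‖h‖, ← mul_one (_ * _ * _)]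
        refine hbd' ?_ (by positivity) zero_le_one
        rw [smoothingHolderConst]
        linarith
      · refine (hφ.norm_eDerivIter_smoothing_sub_le (b := b) hS hσ x h).trans ?_
        rw [Real.rpow_zero, mul_one]
        have : wickConst 0 * (‖UE‖ ^ n * ‖UE‖ ^ σ) ≤ smoothingHolderConst M n σ n := by
          refine le_trans (b := wickConst 0 * (M ^ n * M ^ σ)) (by gcongr) ?_
          rw [smoothingHolderConst]
          linarith
        gcongr
    have h2 := le_rpow_mul_rpow_of_le (by positivity) (norm_nonneg Lam) hr le_rfl
      (by linarith : σ ≤ τ) hτ1 h1 (hlip'.trans (le_of_eq (by push_cast; ring_nf)))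
    refine h2.trans (le_of_eq ?_)
    congr 3
    ring
  · have hlt' : (n : ℝ) + 1 ≤ m := by exact_mod_cast hlt
    rw [max_eq_left (by linarith)] at hbd
    have h2 := le_rpow_mul_rpow_of_le (e := 0) (p := m - (n + σ))
      (A := smoothingHolderConst M n σ m * N) (by positivity) (norm_nonneg Lam) hr
      (by linarith) hτ0.le hτ1 (hbd.trans ?_) (hlip'.trans (le_of_eq (by push_cast; ring_nf)))
    · refine h2.trans (le_of_eq ?_)
      congr 3
      ring
    · rw [Real.rpow_zero, ← mul_one (_ * _ * _)]
      refine hbd' ?_ (by positivity) zero_le_one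
      rw [smoothingHolderConst]
      linarith

end Estimates

/-! ### Norms of Gaussian smoothings -/

section Norms

variable {X : Type u} [NormedAddCommGroup X] [NormedSpace ℝ X]
variable {E : Type v} [NormedAddCommGroup E] [NormedSpace ℝ E]
variable {ι : E →L[ℝ] X} {φ : X → ℝ} {α : ℝ}

theorem iSup_enorm_le {Z G : Type*} [SeminormedAddCommGroup G] {F : Z → G} {K : ℝ}
    (h : ∀ x, ‖F x‖ ≤ K) : ⨆ x, ‖F x‖ₑ ≤ ENNReal.ofReal K :=
  iSup_le fun x => by
    rw [← ofReal_norm]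
    exact ENNReal.ofReal_le_ofReal (h x)

theorem MemCk.ckNorm_ne_top {k : ℕ} (hφ : MemCk ι k φ) : ckNorm ι k φ ≠ ∞ := by
  obtain ⟨K, hK⟩ := hφ.bounded
  refine ENNReal.add_ne_top.2 ⟨((iSup_enorm_le hK).trans_lt ENNReal.ofReal_lt_top).ne,
    ENNReal.sum_ne_top.2 fun j hj => ?_⟩
  obtain ⟨K', hK'⟩ := hφ.bounded_deriv j (Finset.mem_Icc.1 hj).2
  exact ((iSup_enorm_le hK').trans_lt ENNReal.ofReal_lt_top).ne

theorem enorm_eDerivIter_le_ckNorm {j k : ℕ} (hj : j ≤ k) (x : X) :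
    ‖eDerivIter ι φ j x‖ₑ ≤ ckNorm ι k φ := by
  rcases j.eq_zero_or_pos with rfl | hj0
  · rw [← ofReal_norm, norm_eDerivIter_zero, ofReal_norm]
    exact (le_iSup (fun x => ‖φ x‖ₑ) x).trans le_self_add
  · refine (le_iSup (fun x => ‖eDerivIter ι φ j x‖ₑ) x).trans (le_trans ?_ le_add_self)
    exact Finset.single_le_sum (f := fun j => ⨆ x, ‖eDerivIter ι φ j x‖ₑ) (fun _ _ => zero_le)
      (Finset.mem_Icc.2 ⟨hj0, hj⟩)

theorem MemHolderAlong.holderNorm_ne_top (hφ : MemHolderAlong ι α φ) : holderNorm ι α φ ≠ ∞ := by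
  refine ENNReal.add_ne_top.2 ⟨hφ.1.ckNorm_ne_top, ?_⟩
  split_ifs with h
  · exact ENNReal.zero_ne_top
  · exact (hφ.2 h).ne

theorem norm_le_toReal_of_enorm_le {G : Type*} [SeminormedAddCommGroup G] {g : G} {K : ℝ≥0∞}
    (hK : K ≠ ∞) (h : ‖g‖ₑ ≤ K) : ‖g‖ ≤ K.toReal := by
  rw [← toReal_enorm]
  exact ENNReal.toReal_mono hK h

end Norms

section Final

variable {X : Type u} [NormedAddCommGroup X] [InnerProductSpace ℝ X] [CompleteSpace X]
  [SecondCountableTopology X] [MeasurableSpace X] [BorelSpace X]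
variable {E : Type v} [NormedAddCommGroup E] [NormedSpace ℝ E]
variable {ι : E →L[ℝ] X} {R V : X →L[ℝ] X} {μ : Measure X} {UE : E →L[ℝ] E} {Lam : E →L[ℝ] X}
  {W : E → X → ℝ} {b : X} {φ : X → ℝ} {α α₁ α₂ M : ℝ}

/-- The norm of `φ` in `C_E^α` is finite and bounds all derivatives and the Hölder constant. -/
theorem MemHolderAlong.hasHolderBound (hφ : MemHolderAlong ι α φ) :
    HasHolderBound ι ⌊α⌋₊ (Int.fract α) (holderNorm ι α φ).toReal φ := by
  have hN := hφ.holderNorm_ne_top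
  refine ⟨hφ.1, fun j hj x => norm_le_toReal_of_enorm_le hN
    ((enorm_eDerivIter_le_ckNorm hj x).trans le_self_add), fun hσ x h => ?_⟩
  rcases eq_or_ne h 0 with rfl | hh
  · rw [map_zero, add_zero, sub_self, norm_zero]
    positivity
  · have hr : 0 < ‖h‖ ^ Int.fract α := Real.rpow_pos_of_pos (norm_pos_iff.2 hh) _
    rw [← div_le_iff₀ hr]
    refine (ENNReal.ofReal_le_iff_le_toReal hN).1 (le_trans ?_ le_add_self)
    rw [if_neg hσ.ne']
    exact le_iSup_of_le x (le_iSup_of_le h (le_iSup_of_le hh le_rfl))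

/-- The constant in the smoothing estimate from `C_E^α₁` to `C_E^α₂`. It depends on `M`, `α₁` and `α₂`
only; the summand `1` makes it positive. -/
noncomputable def schauderConst (M α₁ α₂ : ℝ) : ℝ :=
  1 + ∑ j ∈ Finset.range (⌊α₂⌋₊ + 1), smoothingConst M ⌊α₁⌋₊ (Int.fract α₁) j +
    smoothingHolderConst M ⌊α₁⌋₊ (Int.fract α₁) ⌊α₂⌋₊

theorem schauderConst_pos (hM : 0 ≤ M) (α₁ α₂ : ℝ) : 0 < schauderConst M α₁ α₂ := by
  have h1 : 0 ≤ ∑ j ∈ Finset.range (⌊α₂⌋₊ + 1), smoothingConst M ⌊α₁⌋₊ (Int.fract α₁) j :=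
    Finset.sum_nonneg fun j _ => smoothingConst_nonneg hM _ _ _
  have h2 := smoothingHolderConst_nonneg hM ⌊α₁⌋₊ (Int.fract α₁) ⌊α₂⌋₊
  rw [schauderConst]
  positivity

theorem rpow_le_rpow_add_one {L p q : ℝ} (hL : 0 ≤ L) (hp : 0 ≤ p) (hpq : p ≤ q) :
    L ^ p ≤ L ^ q + 1 := by
  have h1 : 0 ≤ L ^ q := by positivity
  rcases le_total L 1 with h | h
  · linarith [Real.rpow_le_one hL h hp]
  · linarith [Real.rpow_le_rpow_of_exponent_le h hpq]

theorem natFloor_add_fract {a : ℝ} (ha : 0 ≤ a) : (⌊a⌋₊ : ℝ) + Int.fract a = a := by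
  rw [natCast_floor_eq_intCast_floor ha, Int.floor_add_fract]

/-- The smoothing estimate from `C_E^α₁` to `C_E^α₂`. -/
theorem holderNorm_smoothing_le (hS : IsGaussianSmoothing ι R V μ UE Lam W) (hM : ‖UE‖ ≤ M)
    (hα₁ : 0 ≤ α₁) (hα : α₁ ≤ α₂) (hφ : MemHolderAlong ι α₁ φ) :
    MemHolderAlong ι α₂ (fun x => ∫ y, φ (V x + b + y) ∂μ) ∧
      holderNorm ι α₂ (fun x => ∫ y, φ (V x + b + y) ∂μ) ≤
        ENNReal.ofReal (schauderConst M α₁ α₂ * (‖Lam‖ ^ (α₂ - α₁) + 1)) * holderNorm ι α₁ φ := by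
  have hM0 : 0 ≤ M := (norm_nonneg _).trans hM
  have hH := hφ.hasHolderBound
  have hα₂ := hα₁.trans hα
  have hf0 := Int.fract_nonneg α₁
  have hf1 := Int.fract_lt_one α₁
  set N := (holderNorm ι α₁ φ).toReal with hN
  set D := ‖Lam‖ ^ (α₂ - α₁) + 1 with hD
  set P : X → ℝ := fun x => ∫ y, φ (V x + b + y) ∂μ with hP
  set c : ℕ → ℝ := smoothingConst M ⌊α₁⌋₊ (Int.fract α₁) with hc
  have hD0 : 0 ≤ D := by positivity
  have hN0 : 0 ≤ N := hH.nonneg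
  have hc0 : ∀ j, 0 ≤ c j := smoothingConst_nonneg hM0 _ _
  have hH0 := smoothingHolderConst_nonneg hM0 ⌊α₁⌋₊ (Int.fract α₁) ⌊α₂⌋₊
  have hmem : MemCk ι ⌊α₂⌋₊ P := memCk_smoothing hS hφ.1 _
  have hder : ∀ j ≤ ⌊α₂⌋₊, ∀ x, ‖eDerivIter ι P j x‖ ≤ c j * (D * N) := fun j hj x => by
    refine (hH.norm_eDerivIter_smoothing_le_rpow (b := b) hS hf0 hf1 hM j x).trans ?_
    have hj' : (j : ℝ) ≤ α₂ := (Nat.cast_le.2 hj).trans (Nat.floor_le hα₂)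
    have h1 : ‖Lam‖ ^ max (j - (⌊α₁⌋₊ + Int.fract α₁)) 0 ≤ D := by
      refine rpow_le_rpow_add_one (norm_nonneg _) (le_max_right _ _) (max_le ?_ (by linarith))
      rw [natFloor_add_fract hα₁]
      linarith
    calc _ ≤ c j * N * D := mul_le_mul_of_nonneg_left h1 (mul_nonneg (hc0 j) hN0)
      _ = _ := by ring
  have hck : ckNorm ι ⌊α₂⌋₊ P ≤
      ENNReal.ofReal (∑ j ∈ Finset.range (⌊α₂⌋₊ + 1), c j * (D * N)) := by
    have h2 : ∀ j, 0 ≤ c j * (D * N) := fun j => mul_nonneg (hc0 j) (by positivity)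
    rw [Finset.range_eq_Ico, Finset.sum_eq_sum_Ico_succ_bot (Nat.succ_pos _),
      ENNReal.ofReal_add (h2 0) (Finset.sum_nonneg fun j _ => h2 j),
      ENNReal.ofReal_sum_of_nonneg fun j _ => h2 j]
    refine add_le_add (iSup_enorm_le fun x => ?_) (Finset.sum_le_sum fun j hj => ?_)
    · rw [← norm_eDerivIter_zero (ι := ι)]
      exact hder 0 (Nat.zero_le _) x
    · exact iSup_enorm_le (hder j (Finset.mem_Icc.1 hj).2)
  have hsem : Int.fract α₂ ≠ 0 → holderSeminorm ι (Int.fract α₂) (eDerivIter ι P ⌊α₂⌋₊) ≤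
      ENNReal.ofReal (smoothingHolderConst M ⌊α₁⌋₊ (Int.fract α₁) ⌊α₂⌋₊ * (D * N)) := fun hτ => by
    refine iSup_le fun x => iSup_le fun h => iSup_le fun hh => ENNReal.ofReal_le_ofReal ?_
    have hr : 0 < ‖h‖ ^ Int.fract α₂ := Real.rpow_pos_of_pos (norm_pos_iff.2 hh) _
    rw [div_le_iff₀ hr]
    refine (hH.norm_eDerivIter_smoothing_sub_le_rpow (b := b) hS hf0 hf1 hM
      ((Int.fract_nonneg α₂).lt_of_ne' hτ) (Int.fract_lt_one α₂) (Nat.floor_mono hα)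
      (by rwa [natFloor_add_fract hα₁, natFloor_add_fract hα₂]) x hh).trans ?_
    refine mul_le_mul_of_nonneg_right ?_ hr.le
    rw [natFloor_add_fract hα₁, natFloor_add_fract hα₂, mul_assoc, mul_comm N]
    exact mul_le_mul_of_nonneg_left (mul_le_mul_of_nonneg_right (by linarith) hN0) hH0
  refine ⟨⟨hmem, fun hτ => (hsem hτ).trans_lt ENNReal.ofReal_lt_top⟩, ?_⟩
  have hfin : holderNorm ι α₂ P ≤
      ENNReal.ofReal (∑ j ∈ Finset.range (⌊α₂⌋₊ + 1), c j * (D * N)) +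
      ENNReal.ofReal (smoothingHolderConst M ⌊α₁⌋₊ (Int.fract α₁) ⌊α₂⌋₊ * (D * N)) := by
    refine add_le_add hck ?_
    split_ifs with hτ
    · exact zero_le
    · exact hsem hτ
  refine hfin.trans ?_
  rw [← ENNReal.ofReal_toReal hφ.holderNorm_ne_top, ← hN, ← ENNReal.ofReal_mul
    (mul_nonneg (schauderConst_pos hM0 _ _).le hD0), ← ENNReal.ofReal_add
    (Finset.sum_nonneg fun j _ => mul_nonneg (hc0 j) (by positivity)) (by positivity)]
  refine ENNReal.ofReal_le_ofReal ?_
  rw [← Finset.sum_mul, ← add_mul, mul_assoc]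
  refine mul_le_mul_of_nonneg_right ?_ (by positivity)
  rw [schauderConst]
  linarith

end Final

end OUEvolution

theorem mainTheorem4 :
    (∀ (X : Type u) [NormedAddCommGroup X] [InnerProductSpace ℝ X] [CompleteSpace X]
        [TopologicalSpace.SeparableSpace X] [MeasurableSpace X] [BorelSpace X]
        (Y : Type w) [NormedAddCommGroup Y] [InnerProductSpace ℝ Y] [CompleteSpace Y]
        [TopologicalSpace.SeparableSpace Y]
        (E : Type v) [NormedAddCommGroup E] [NormedSpace ℝ E]
        (ι : E →L[ℝ] X) (_ : Function.Injective ι)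
        (T : ℝ) (_ : 0 < T)
        (U : ℝ → ℝ → X →L[ℝ] X) (B : ℝ → Y →L[ℝ] X) (f : ℝ → X)
        (_ : StandingAssumptions T U B f)
        (s t : ℝ) (_ : 0 ≤ s) (_ : s < t) (_ : t ≤ T)
        (_ : MapsIntoCameronMartin ι U B t s)
        (UE : E →L[ℝ] E) (_ : ∀ h : E, ι (UE h) = U t s (ι h))
        (k n : ℕ) (_ : 1 ≤ k + n) (φ : X → ℝ) (_ : MemCk ι k φ),
      MemCk ι (k + n) (evolutionOp U B f s t φ) ∧
      ∀ (x : X) (h : Fin (k + n) → E),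
        Integrable (fun y => eDerivIter ι φ k (meanVec U f t s x + y)
              (fun i => UE (h (Fin.castAdd n i))) *
            wickPolynomial ι U B t s n y (fun i => h (Fin.natAdd k i)))
          (gaussianMeasure (covOp U B t s)) ∧
        eDerivIter ι (evolutionOp U B f s t φ) (k + n) x h =
          ∫ y, eDerivIter ι φ k (meanVec U f t s x + y)
              (fun i => UE (h (Fin.castAdd n i))) *
            wickPolynomial ι U B t s n y (fun i => h (Fin.natAdd k i))
          ∂(gaussianMeasure (covOp U B t s))) ∧
    (∀ M α₁ α₂ : ℝ, 0 < M → 0 ≤ α₁ → α₁ ≤ α₂ → ∃ C : ℝ, 0 < C ∧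
      ∀ (X : Type u) [NormedAddCommGroup X] [InnerProductSpace ℝ X] [CompleteSpace X]
        [TopologicalSpace.SeparableSpace X] [MeasurableSpace X] [BorelSpace X]
        (Y : Type w) [NormedAddCommGroup Y] [InnerProductSpace ℝ Y] [CompleteSpace Y]
        [TopologicalSpace.SeparableSpace Y]
        (E : Type v) [NormedAddCommGroup E] [NormedSpace ℝ E]
        (ι : E →L[ℝ] X) (_ : Function.Injective ι)
        (T : ℝ) (_ : 0 < T)
        (U : ℝ → ℝ → X →L[ℝ] X) (B : ℝ → Y →L[ℝ] X) (f : ℝ → X)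
        (_ : StandingAssumptions T U B f)
        (s t : ℝ) (_ : 0 ≤ s) (_ : s < t) (_ : t ≤ T)
        (_ : MapsIntoCameronMartin ι U B t s)
        (UE : E →L[ℝ] E) (_ : ∀ h : E, ι (UE h) = U t s (ι h)) (_ : ‖UE‖ ≤ M)
        (φ : X → ℝ) (_ : MemHolderAlong ι α₁ φ),
      MemHolderAlong ι α₂ (evolutionOp U B f s t φ) ∧
      holderNorm ι α₂ (evolutionOp U B f s t φ) ≤
        ENNReal.ofReal (C * (lambdaNorm ι U B t s ^ (α₂ - α₁) + 1)) * holderNorm ι α₁ φ) := by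
  refine ⟨?_, fun M α₁ α₂ hM hα₁ hα => ⟨schauderConst M α₁ α₂, schauderConst_pos hM.le _ _, ?_⟩⟩
  · intro X _ _ _ _ _ _ Y _ _ _ _ E _ _ ι _ T _ U B f hS s t hs hst ht hM UE hUE k n _ φ hφ
    exact eDerivIter_evolutionOp hS hs hst ht hM hUE k n hφ
  · intro X _ _ _ _ _ _ Y _ _ _ _ E _ _ ι _ T _ U B f hS s t hs hst ht hMC UE hUE hUM φ hφ
    have := UniformSpace.secondCountable_of_separable X
    obtain ⟨Lam, hLam, hnorm⟩ := exists_clm_eq_lambdaOp hMC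
    rw [evolutionOp_eq, ← hnorm]
    exact holderNorm_smoothing_le (isGaussianSmoothing_evolution hS hs hst ht hMC hUE hLam) hUM
      hα₁ hα hφ
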